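/- Let $n\ge 1$ be an integer, let $\sigma\in[1,\infty)$ with $\sigma>\frac n2$, and let $1\le\gamma<\infty$. There is a constant $C=C(n,\sigma,\gamma)>0$ such that the following holds for every $T>0$, every real-valued $a\in L^\infty((0,T);L^\sigma(\mathbb R^n))$ and every real-valued $u_0\in L^\gamma(\mathbb R^n)$. The problem $$\partial_t u-\Delta u+a\,u=0\ \text{ in }\mathbb R^n\times(0,T),\qquad u(\cdot,0)=u_0,$$ has exactly one solution $u\in C([0,T];L^\gamma(\mathbb R^n))\cap L^\infty_{loc}((0,T);L^\infty(\mathbb R^n))$, where the equation is understood in the sense of distributions, that is, $$\int_0^T\!\!\int_{\mathbb R^n}\big(u\,(-\partial_t\varphi-\Delta\varphi)+a\,u\,\varphi\big)\,dx\,dt=0\quad\text{for all }\varphi\in C_c^\infty((0,T)\times\mathbb R^n),$$ and the initial condition means $u(0)=u_0$ in $L^\gamma(\mathbb R^n)$. Moreover, for every $t\in(0,T]$, $$\|u(t)\|_{L^\infty(\mathbb R^n)}\le C\,e^{C\mathcal L^{\vartheta}t}\,t^{-\frac{n}{2\gamma}}\,\|u_0\|_{L^\gamma(\mathbb R^n)},\qquad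 \mathcal L=\|a\|_{L^\infty((0,T);L^\sigma(\mathbb R^n))},\quad \vartheta=\frac{2\sigma}{2\sigma-n}.$$ -/

import Mathlib

open MeasureTheory Set
open scoped ENNReal

/-- `u : ℝ → L^γ(ℝⁿ)` (only its values on `[0,T]` matter) is a solution, in the class
`C([0,T]; L^γ) ∩ L^∞_loc((0,T); L^∞)`, of `∂ₜu - Δu + a u = 0` on `ℝⁿ × (0,T)` with `u(0) = u₀`.
The equation is meant in the sense of distributions on `(0,T) × ℝⁿ`. -/
structure IsHeatPotentialSolution {n : ℕ} {σ γ : ℝ≥0∞} [Fact (1 ≤ γ)] (T : ℝ)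
    (a : ℝ → Lp ℝ σ (volume : Measure (EuclideanSpace ℝ (Fin n))))
    (u₀ : Lp ℝ γ (volume : Measure (EuclideanSpace ℝ (Fin n))))
    (u : ℝ → Lp ℝ γ (volume : Measure (EuclideanSpace ℝ (Fin n)))) : Prop where
  /-- `u ∈ C([0,T]; L^γ)` -/
  continuousOn : ContinuousOn u (Icc 0 T)
  /-- `u ∈ L^∞_loc((0,T); L^∞)`: essentially bounded on every compact subset of `(0,T)` -/
  locally_bounded : ∀ K : Set ℝ, IsCompact K → K ⊆ Ioo 0 T →
    ∃ M : ℝ, ∀ᵐ t ∂(volume.restrict K), eLpNorm (u t) ∞ volume ≤ ENNReal.ofReal M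
  /-- the initial condition -/
  initial : u 0 = u₀
  /-- the equation, tested against `φ ∈ C_c^∞((0,T) × ℝⁿ)` -/
  equation : ∀ φ : ℝ × EuclideanSpace ℝ (Fin n) → ℝ, ContDiff ℝ (⊤ : ℕ∞) φ → HasCompactSupport φ →
    tsupport φ ⊆ Ioo 0 T ×ˢ univ →
    ∫ t in Ioo 0 T, ∫ x,
      (u t x * (-deriv (fun s => φ (s, x)) t - Laplacian.laplacian (fun y => φ (t, y)) x)
        + a t x * u t x * φ (t, x)) = 0

/-- The density of the Gaussian measure of covariance `2` on `ℝⁿ`. -/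
noncomputable def gaussDensity (n : ℕ) (v : EuclideanSpace ℝ (Fin n)) : ℝ :=
  (4 * Real.pi) ^ (-((n : ℝ) / 2)) * Real.exp (-(1 / 4) * ‖v‖ ^ 2)

/-- The Gaussian measure of covariance `2` on `ℝⁿ`. -/
noncomputable def gaussMeasure (n : ℕ) : Measure (EuclideanSpace ℝ (Fin n)) :=
  volume.withDensity fun v => ENNReal.ofReal (gaussDensity n v)

/-- The heat semigroup acting on functions. -/
noncomputable def heatFun {n : ℕ} (τ : ℝ) (ψ : EuclideanSpace ℝ (Fin n) → ℝ)
    (x : EuclideanSpace ℝ (Fin n)) : ℝ :=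
  ∫ v, ψ (x + √τ • v) ∂gaussMeasure n

section Gaussian

variable {n : ℕ}

lemma gaussDensity_pos (v : EuclideanSpace ℝ (Fin n)) : 0 < gaussDensity n v := by
  unfold gaussDensity; positivity

lemma gaussDensity_le_one (v : EuclideanSpace ℝ (Fin n)) : gaussDensity n v ≤ 1 := by
  unfold gaussDensity
  have h1 : (4 * Real.pi) ^ (-((n : ℝ) / 2)) ≤ 1 :=
    Real.rpow_le_one_of_one_le_of_nonpos (by linarith [Real.pi_gt_three])
      (by simp only [Left.neg_nonpos_iff]; positivity)
  have h2 : Real.exp (-(1 / 4) * ‖v‖ ^ 2) ≤ 1 := by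
    rw [Real.exp_le_one_iff]; nlinarith [sq_nonneg ‖v‖]
  calc _ ≤ (1 : ℝ) * 1 := mul_le_mul h1 h2 (by positivity) (by positivity)
    _ = 1 := by norm_num

lemma contDiff_gaussDensity : ContDiff ℝ (⊤ : ℕ∞) (gaussDensity n) := by
  unfold gaussDensity
  exact contDiff_const.mul ((contDiff_const.mul (contDiff_norm_sq ℝ)).exp)

lemma continuous_gaussDensity : Continuous (gaussDensity n) := contDiff_gaussDensity.continuous

lemma integral_gaussDensity : ∫ v, gaussDensity n v = 1 := by
  unfold gaussDensity
  rw [integral_const_mul, GaussianFourier.integral_rexp_neg_mul_sq_norm (by norm_num),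
    finrank_euclideanSpace, Fintype.card_fin,
    show Real.pi / (1 / 4) = 4 * Real.pi by ring, ← Real.rpow_add (by positivity)]
  simp

lemma integrable_gaussDensity : Integrable (gaussDensity n) := by
  by_contra h
  have := integral_undef h
  rw [integral_gaussDensity] at this
  exact one_ne_zero this

instance : IsProbabilityMeasure (gaussMeasure n) := by
  constructor
  rw [gaussMeasure, withDensity_apply _ MeasurableSet.univ, Measure.restrict_univ,
    ← ofReal_integral_eq_lintegral_ofReal integrable_gaussDensity
      (Filter.Eventually.of_forall fun v => (gaussDensity_pos v).le), integral_gaussDensity]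
  simp

lemma gaussMeasure_le : gaussMeasure n ≤ volume := by
  conv_rhs => rw [← withDensity_one (μ := (volume : Measure (EuclideanSpace ℝ (Fin n))))]
  refine withDensity_mono (Filter.Eventually.of_forall fun v => ?_)
  simpa using ENNReal.ofReal_le_ofReal (gaussDensity_le_one v)

lemma integral_gaussMeasure {F : Type*} [NormedAddCommGroup F] [NormedSpace ℝ F]
    (f : EuclideanSpace ℝ (Fin n) → F) :
    ∫ v, f v ∂gaussMeasure n = ∫ v, gaussDensity n v • f v := by
  rw [gaussMeasure, integral_withDensity_eq_integral_toReal_smul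
    continuous_gaussDensity.measurable.ennreal_ofReal (by simp)]
  simp [ENNReal.toReal_ofReal (gaussDensity_pos _).le]

end Gaussian

section Averages

variable {n : ℕ}

/-- Averaging over translations is a contraction of `L^p`. -/
lemma eLpNorm_average_le (m : Measure (EuclideanSpace ℝ (Fin n))) [IsProbabilityMeasure m]
    {ψ : EuclideanSpace ℝ (Fin n) → ℝ} (hψ : Measurable ψ) {p : ℝ≥0∞} (hp : 1 ≤ p) :
    eLpNorm (fun x => ∫ y, ψ (x + y) ∂m) p volume ≤ eLpNorm ψ p volume := by
  have hmeas : Measurable fun z : EuclideanSpace ℝ (Fin n) × EuclideanSpace ℝ (Fin n) =>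
      ψ (z.1 + z.2) := hψ.comp (measurable_fst.add measurable_snd)
  by_cases htop : p = ∞
  · subst htop
    rw [eLpNorm_exponent_top, eLpNorm_exponent_top]
    have h1 : ∀ᵐ x ∂(volume : Measure (EuclideanSpace ℝ (Fin n))), ∀ᵐ y ∂m,
        ‖ψ (x + y)‖ₑ ≤ eLpNormEssSup ψ volume := by
      rw [Measure.ae_ae_comm (p := fun x y => ‖ψ (x + y)‖ₑ ≤ eLpNormEssSup ψ volume)
        (measurableSet_le hmeas.enorm measurable_const)]
      refine Filter.Eventually.of_forall fun y => ?_
      have := (measurePreserving_add_right (volume : Measure (EuclideanSpace ℝ (Fin n))) y)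
      exact this.quasiMeasurePreserving.ae (enorm_ae_le_eLpNormEssSup ψ volume)
    refine essSup_le_of_ae_le _ ?_
    filter_upwards [h1] with x hx
    calc ‖∫ y, ψ (x + y) ∂m‖ₑ ≤ ∫⁻ y, ‖ψ (x + y)‖ₑ ∂m := enorm_integral_le_lintegral_enorm _
      _ ≤ ∫⁻ y, eLpNormEssSup ψ volume ∂m := lintegral_mono_ae hx
      _ = _ := by simp
  · have hp0 : p ≠ 0 := (zero_lt_one.trans_le hp).ne'
    have hpr : 0 < p.toReal := ENNReal.toReal_pos hp0 htop
    rw [eLpNorm_eq_lintegral_rpow_enorm_toReal hp0 htop,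
      eLpNorm_eq_lintegral_rpow_enorm_toReal hp0 htop]
    gcongr ?_ ^ _
    have key : ∀ x, ‖∫ y, ψ (x + y) ∂m‖ₑ ^ p.toReal ≤ ∫⁻ y, ‖ψ (x + y)‖ₑ ^ p.toReal ∂m := by
      intro x
      have hx : AEStronglyMeasurable (fun y => ψ (x + y)) m :=
        (hψ.comp (measurable_const_add x)).aestronglyMeasurable
      have h1 : ‖∫ y, ψ (x + y) ∂m‖ₑ ≤ eLpNorm (fun y => ψ (x + y)) p m := by
        refine (enorm_integral_le_lintegral_enorm _).trans ?_
        rw [← eLpNorm_one_eq_lintegral_enorm]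
        exact eLpNorm_le_eLpNorm_of_exponent_le hp hx
      rw [eLpNorm_eq_lintegral_rpow_enorm_toReal hp0 htop] at h1
      calc _ ≤ ((∫⁻ y, ‖ψ (x + y)‖ₑ ^ p.toReal ∂m) ^ (1 / p.toReal)) ^ p.toReal := by gcongr
        _ = _ := by rw [← ENNReal.rpow_mul, one_div_mul_cancel hpr.ne', ENNReal.rpow_one]
    calc _ ≤ ∫⁻ x, ∫⁻ y, ‖ψ (x + y)‖ₑ ^ p.toReal ∂m := lintegral_mono key
      _ = ∫⁻ y, ∫⁻ x, ‖ψ (x + y)‖ₑ ^ p.toReal ∂volume ∂m :=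
        lintegral_lintegral_swap (hmeas.enorm.pow_const _).aemeasurable
      _ = ∫⁻ y, ∫⁻ x, ‖ψ x‖ₑ ^ p.toReal ∂volume ∂m := by
        congr 1; ext y
        exact lintegral_add_right_eq_self (fun x => ‖ψ x‖ₑ ^ p.toReal) y
      _ = _ := by simp

lemma heatFun_eq_average (τ : ℝ) {ψ : EuclideanSpace ℝ (Fin n) → ℝ} (hψ : Measurable ψ)
    (x : EuclideanSpace ℝ (Fin n)) :
    heatFun τ ψ x = ∫ y, ψ (x + y) ∂((gaussMeasure n).map fun v => √τ • v) := by
  exact (integral_map (f := fun y => ψ (x + y)) (measurable_const_smul _).aemeasurable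
    (hψ.comp (measurable_const_add x)).aestronglyMeasurable).symm

lemma measurable_heatFun (τ : ℝ) {ψ : EuclideanSpace ℝ (Fin n) → ℝ} (hψ : Measurable ψ) :
    Measurable (heatFun τ ψ) := by
  have h : Measurable fun z : EuclideanSpace ℝ (Fin n) × EuclideanSpace ℝ (Fin n) =>
      ψ (z.1 + √τ • z.2) := hψ.comp (by fun_prop)
  exact h.stronglyMeasurable.integral_prod_right.measurable

lemma eLpNorm_heatFun_le (τ : ℝ) {ψ : EuclideanSpace ℝ (Fin n) → ℝ} (hψ : Measurable ψ)
    {p : ℝ≥0∞} (hp : 1 ≤ p) :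
    eLpNorm (heatFun τ ψ) p volume ≤ eLpNorm ψ p volume := by
  have : IsProbabilityMeasure ((gaussMeasure n).map fun v => √τ • v) :=
    Measure.isProbabilityMeasure_map (measurable_const_smul _).aemeasurable
  convert eLpNorm_average_le ((gaussMeasure n).map fun v => √τ • v) hψ hp using 2
  ext x; exact heatFun_eq_average τ hψ x

lemma enorm_heatFun_le {τ : ℝ} (hτ : 0 < τ) {ψ : EuclideanSpace ℝ (Fin n) → ℝ}
    (hψ : Measurable ψ) {p : ℝ≥0∞} (hp : 1 ≤ p) (x : EuclideanSpace ℝ (Fin n)) :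
    ‖heatFun τ ψ x‖ₑ ≤
      ENNReal.ofReal (τ ^ (-((n : ℝ) / 2 * p.toReal⁻¹))) * eLpNorm ψ p volume := by
  have hs : √τ ≠ 0 := (Real.sqrt_pos.2 hτ).ne'
  have hmap : (volume : Measure (EuclideanSpace ℝ (Fin n))).map (fun v => x + √τ • v) =
      ENNReal.ofReal (τ ^ (-((n : ℝ) / 2))) • volume := by
    have h1 := Measure.map_addHaar_smul (volume : Measure (EuclideanSpace ℝ (Fin n))) hs
    have h2 : (fun v : EuclideanSpace ℝ (Fin n) => x + √τ • v) =
      (fun v => x + v) ∘ (fun v => √τ • v) := rfl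
    rw [h2, ← Measure.map_map (measurable_const_add x) (measurable_const_smul _), h1,
      Measure.map_smul, map_add_left_eq_self]
    congr 2
    rw [finrank_euclideanSpace, Fintype.card_fin, abs_of_nonneg (by positivity),
      Real.sqrt_eq_rpow, ← Real.rpow_natCast, ← Real.rpow_mul hτ.le, Real.rpow_neg hτ.le]
    ring_nf
  have hpos : 0 < τ ^ (-((n : ℝ) / 2)) := Real.rpow_pos_of_pos hτ _
  have hm : Measurable fun v : EuclideanSpace ℝ (Fin n) => x + √τ • v := by fun_prop
  have hcomp : Measurable fun v : EuclideanSpace ℝ (Fin n) => ψ (x + √τ • v) := hψ.comp hm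
  calc ‖heatFun τ ψ x‖ₑ ≤ ∫⁻ v, ‖ψ (x + √τ • v)‖ₑ ∂gaussMeasure n :=
        enorm_integral_le_lintegral_enorm _
    _ = eLpNorm (fun v => ψ (x + √τ • v)) 1 (gaussMeasure n) :=
        eLpNorm_one_eq_lintegral_enorm.symm
    _ ≤ eLpNorm (fun v => ψ (x + √τ • v)) p (gaussMeasure n) :=
        eLpNorm_le_eLpNorm_of_exponent_le hp hcomp.aestronglyMeasurable
    _ ≤ eLpNorm (fun v => ψ (x + √τ • v)) p volume := eLpNorm_mono_measure _ gaussMeasure_le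
    _ = eLpNorm ψ p (volume.map fun v => x + √τ • v) :=
        (eLpNorm_map_measure hψ.aestronglyMeasurable hm.aemeasurable).symm
    _ = _ := by
        rw [hmap, eLpNorm_smul_measure_of_ne_zero (by simpa using hpos), smul_eq_mul,
          ENNReal.ofReal_rpow_of_pos hpos, ← Real.rpow_mul hτ.le]
        congr 3
        simp [ENNReal.toReal_inv]

lemma eLpNorm_top_heatFun_le {τ : ℝ} (hτ : 0 < τ) {ψ : EuclideanSpace ℝ (Fin n) → ℝ}
    (hψ : Measurable ψ) {p : ℝ≥0∞} (hp : 1 ≤ p) :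
    eLpNorm (heatFun τ ψ) ∞ volume ≤
      ENNReal.ofReal (τ ^ (-((n : ℝ) / 2 * p.toReal⁻¹))) * eLpNorm ψ p volume := by
  rw [eLpNorm_exponent_top]
  exact essSup_le_of_ae_le _ (Filter.Eventually.of_forall (enorm_heatFun_le hτ hψ hp))

/-- Interpolation of the `L^p` norm between `L^1` and `L^∞`. -/
lemma eLpNorm_le_rpow_mul_rpow {α : Type*} [MeasurableSpace α] {μ : Measure α} {g : α → ℝ}
    (hgm : AEStronglyMeasurable g μ) {p : ℝ≥0∞} (hp : 1 ≤ p) :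
    eLpNorm g p μ ≤ eLpNorm g 1 μ ^ p.toReal⁻¹ * eLpNorm g ∞ μ ^ (1 - p.toReal⁻¹) := by
  by_cases htop : p = ∞
  · simp [htop]
  have hp0 : p ≠ 0 := (zero_lt_one.trans_le hp).ne'
  have hpr : 1 ≤ p.toReal := by
    rw [← ENNReal.toReal_one]; exact ENNReal.toReal_mono htop hp
  rw [eLpNorm_eq_lintegral_rpow_enorm_toReal hp0 htop, one_div, eLpNorm_one_eq_lintegral_enorm]
  have h : ∫⁻ x, ‖g x‖ₑ ^ p.toReal ∂μ ≤
      (∫⁻ x, ‖g x‖ₑ ∂μ) * eLpNorm g ∞ μ ^ (p.toReal - 1) := by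
    by_cases hg : eLpNorm g ∞ μ ^ (p.toReal - 1) = ∞
    · rw [hg]
      by_cases h0 : ∫⁻ x, ‖g x‖ₑ ∂μ = 0
      · exfalso
        have : eLpNorm g ∞ μ = 0 := by
          rw [eLpNorm_exponent_top, eLpNormEssSup_eq_zero_iff]
          rw [lintegral_eq_zero_iff' hgm.enorm] at h0
          filter_upwards [h0] with x hx
          simpa using hx
        rw [this, ENNReal.rpow_eq_top_iff] at hg
        rcases hg with ⟨_, h⟩ | ⟨h, _⟩
        · linarith
        · exact ENNReal.zero_ne_top h
      · rw [ENNReal.mul_top h0]; exact le_top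
    rw [← lintegral_mul_const' _ _ hg]
    refine lintegral_mono_ae ?_
    filter_upwards [enorm_ae_le_eLpNormEssSup g μ] with x hx
    rcases eq_or_ne ‖g x‖ₑ 0 with h0 | h0
    · rw [h0, ENNReal.zero_rpow_of_pos (by linarith)]; simp
    calc ‖g x‖ₑ ^ p.toReal = ‖g x‖ₑ ^ (1 + (p.toReal - 1)) := by ring_nf
      _ = ‖g x‖ₑ * ‖g x‖ₑ ^ (p.toReal - 1) := by
        rw [ENNReal.rpow_add _ _ h0 enorm_ne_top, ENNReal.rpow_one]
      _ ≤ _ := by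
        rw [eLpNorm_exponent_top]
        gcongr
  calc _ ≤ ((∫⁻ x, ‖g x‖ₑ ∂μ) * eLpNorm g ∞ μ ^ (p.toReal - 1)) ^ p.toReal⁻¹ := by gcongr
    _ = _ := by
      rw [ENNReal.mul_rpow_of_nonneg _ _ (by positivity), ← ENNReal.rpow_mul]
      congr 2
      field_simp

lemma eLpNorm_heatFun_le_of_one {τ : ℝ} (hτ : 0 < τ) {ψ : EuclideanSpace ℝ (Fin n) → ℝ}
    (hψ : Measurable ψ) {p : ℝ≥0∞} (hp : 1 ≤ p) :
    eLpNorm (heatFun τ ψ) p volume ≤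
      ENNReal.ofReal (τ ^ (-((n : ℝ) / 2 * (1 - p.toReal⁻¹)))) * eLpNorm ψ 1 volume := by
  have hip : 0 ≤ 1 - p.toReal⁻¹ := by
    rw [sub_nonneg]
    by_cases htop : p = ∞
    · simp [htop]
    · apply inv_le_one_of_one_le₀
      rw [← ENNReal.toReal_one]; exact ENNReal.toReal_mono htop hp
  refine (eLpNorm_le_rpow_mul_rpow (measurable_heatFun τ hψ).aestronglyMeasurable hp).trans ?_
  have h1 := eLpNorm_heatFun_le τ hψ (p := 1) le_rfl
  have h2 := eLpNorm_top_heatFun_le hτ hψ (p := 1) le_rfl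
  simp only [ENNReal.toReal_one, inv_one, mul_one] at h2
  calc _ ≤ eLpNorm ψ 1 volume ^ p.toReal⁻¹ *
        (ENNReal.ofReal (τ ^ (-((n : ℝ) / 2))) * eLpNorm ψ 1 volume) ^ (1 - p.toReal⁻¹) := by
        gcongr
    _ = ENNReal.ofReal (τ ^ (-((n : ℝ) / 2 * (1 - p.toReal⁻¹)))) *
        (eLpNorm ψ 1 volume ^ p.toReal⁻¹ * eLpNorm ψ 1 volume ^ (1 - p.toReal⁻¹)) := by
        rw [ENNReal.mul_rpow_of_nonneg _ _ hip,
          ENNReal.ofReal_rpow_of_pos (Real.rpow_pos_of_pos hτ _), ← Real.rpow_mul hτ.le]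
        ring_nf
    _ = _ := by
        rw [← ENNReal.rpow_add_of_nonneg _ _ (by positivity) hip]
        simp

lemma toReal_inv_eq_one_sub (p q : ℝ≥0∞) [hpq : p.HolderConjugate q] :
    q.toReal⁻¹ = 1 - p.toReal⁻¹ := by
  rw [← ENNReal.toReal_inv, ← ENNReal.toReal_inv, eq_sub_iff_add_eq, ← ENNReal.toReal_add,
    add_comm, ENNReal.HolderConjugate.inv_add_inv_eq_one, ENNReal.toReal_one]
  · simpa using (zero_lt_one.trans_le hpq.symm.one_le).ne'
  · simpa using (zero_lt_one.trans_le hpq.one_le).ne'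

/-- Hölder's inequality against `L^σ`, with the dual norm interpolated between `L^1` and `L^∞`. -/
lemma lintegral_enorm_mul_le {α : Type*} [MeasurableSpace α] {μ : Measure α} {b g : α → ℝ}
    (hb : AEStronglyMeasurable b μ) (hg : AEStronglyMeasurable g μ) {σ : ℝ≥0∞} (hσ : 1 ≤ σ) :
    ∫⁻ x, ‖b x * g x‖ₑ ∂μ ≤
      eLpNorm b σ μ * (eLpNorm g 1 μ ^ (1 - σ.toReal⁻¹) * eLpNorm g ∞ μ ^ σ.toReal⁻¹) := by
  have : ENNReal.HolderConjugate σ (ENNReal.conjExponent σ) := .conjExponent hσ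
  have h1 : 1 ≤ ENNReal.conjExponent σ := (ENNReal.HolderConjugate.symm (p := σ)).one_le
  have hinv := toReal_inv_eq_one_sub σ (ENNReal.conjExponent σ)
  have h2 := eLpNorm_smul_le_mul_eLpNorm (p := σ) (q := ENNReal.conjExponent σ) (r := 1) hg hb
  rw [eLpNorm_one_eq_lintegral_enorm] at h2
  refine h2.trans ?_
  gcongr
  refine (eLpNorm_le_rpow_mul_rpow hg h1).trans ?_
  rw [hinv]
  simp

end Averages

section Duality

open Filter Topology

variable {n : ℕ}

/-- Smooth approximation of bounded, compactly supported functions, not increasing any norm. -/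
lemma exists_smooth_approx {ζ : EuclideanSpace ℝ (Fin n) → ℝ} (hζ : Measurable ζ) {B : ℝ}
    (hB : ∀ x, |ζ x| ≤ B) {R : ℝ} (hR : ∀ x, R < ‖x‖ → ζ x = 0) :
    ∃ ψ : ℕ → EuclideanSpace ℝ (Fin n) → ℝ,
      (∀ j, ContDiff ℝ (⊤ : ℕ∞) (ψ j)) ∧ (∀ j, HasCompactSupport (ψ j)) ∧
      (∀ j x, |ψ j x| ≤ B) ∧ (∀ j x, R + 2 < ‖x‖ → ψ j x = 0) ∧
      (∀ j (p : ℝ≥0∞), 1 ≤ p → eLpNorm (ψ j) p volume ≤ eLpNorm ζ p volume) ∧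
      ∀ᵐ x, Tendsto (fun j => ψ j x) atTop (𝓝 (ζ x)) := by
  have hB0 : 0 ≤ B := (abs_nonneg _).trans (hB 0)
  let φ : ℕ → ContDiffBump (0 : EuclideanSpace ℝ (Fin n)) := fun j =>
    ⟨1 / ((j : ℝ) + 1), 2 / ((j : ℝ) + 1), by positivity, by gcongr; norm_num⟩
  have hζsupp : HasCompactSupport ζ :=
    HasCompactSupport.intro (isCompact_closedBall (0 : EuclideanSpace ℝ (Fin n)) R)
      fun x hx => hR x (by simpa using hx)
  have hζint : Integrable ζ := by
    have h1 : IntegrableOn ζ (Metric.closedBall 0 R) :=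
      Measure.integrableOn_of_bounded (M := B)
        (isCompact_closedBall (0 : EuclideanSpace ℝ (Fin n)) R).measure_lt_top.ne
        hζ.aestronglyMeasurable (Eventually.of_forall hB)
    exact (integrableOn_iff_integrable_of_support_subset fun x hx => by
      by_contra h; exact hx (hR x (by simpa using h))).1 h1
  let ρ : ℕ → EuclideanSpace ℝ (Fin n) → ℝ := fun j => (φ j).normed volume
  let ψ : ℕ → EuclideanSpace ℝ (Fin n) → ℝ := fun j =>
    convolution (ρ j) ζ (ContinuousLinearMap.lsmul ℝ ℝ) volume
  have hψ : ∀ j x, ψ j x = ∫ y, ρ j y * ζ (x - y) := fun j x => rfl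
  have hρ0 : ∀ j x, 0 ≤ ρ j x := fun j x => (φ j).nonneg_normed x
  have hρi : ∀ j, Integrable (ρ j) := fun j => (φ j).integrable_normed
  have hρ1 : ∀ j, ∫ x, ρ j x = 1 := fun j => (φ j).integral_normed
  have hρc : ∀ j, Continuous (ρ j) := fun j => (φ j).continuous_normed
  refine ⟨ψ, fun j => ?_, fun j => ?_, fun j x => ?_, fun j x hx => ?_, fun j p hp => ?_, ?_⟩
  · exact HasCompactSupport.contDiff_convolution_left
      (ContinuousLinearMap.lsmul ℝ ℝ : ℝ →L[ℝ] ℝ →L[ℝ] ℝ)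
      (φ j).hasCompactSupport_normed (φ j).contDiff_normed hζint.locallyIntegrable
  · exact HasCompactSupport.convolution (ContinuousLinearMap.lsmul ℝ ℝ : ℝ →L[ℝ] ℝ →L[ℝ] ℝ)
      (φ j).hasCompactSupport_normed hζsupp
  · rw [hψ]
    calc |∫ y, ρ j y * ζ (x - y)| ≤ ∫ y, ρ j y * B := by
          rw [← Real.norm_eq_abs]
          refine norm_integral_le_of_norm_le ((hρi j).mul_const B) (Eventually.of_forall ?_)
          intro y
          rw [Real.norm_eq_abs, abs_mul, abs_of_nonneg (hρ0 j y)]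
          exact mul_le_mul_of_nonneg_left (hB _) (hρ0 j y)
      _ = B := by rw [integral_mul_const, hρ1, one_mul]
  · rw [hψ]
    refine integral_eq_zero_of_ae (Eventually.of_forall fun y => ?_)
    by_cases hy : y ∈ Function.support (ρ j)
    · rw [(φ j).support_normed_eq, Metric.mem_ball, dist_zero_right] at hy
      have h2 : (φ j).rOut ≤ 2 := by
        change 2 / ((j : ℝ) + 1) ≤ 2
        rw [div_le_iff₀ (by positivity)]; nlinarith [(Nat.cast_nonneg j : (0 : ℝ) ≤ j)]
      have h3 := norm_sub_norm_le x y
      simp [hR (x - y) (by linarith)]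
    · simp [Function.notMem_support.1 hy]
  · let m : Measure (EuclideanSpace ℝ (Fin n)) :=
      (volume.withDensity fun y => ENNReal.ofReal (ρ j y)).map fun y => -y
    have hm0 : IsProbabilityMeasure
        ((volume : Measure (EuclideanSpace ℝ (Fin n))).withDensity
          fun y => ENNReal.ofReal (ρ j y)) := by
      constructor
      rw [withDensity_apply _ MeasurableSet.univ, Measure.restrict_univ,
        ← ofReal_integral_eq_lintegral_ofReal (hρi j) (Eventually.of_forall (hρ0 j)), hρ1]
      simp
    have hm : IsProbabilityMeasure m :=
      Measure.isProbabilityMeasure_map measurable_neg.aemeasurable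
    have : ψ j = fun x => ∫ y, ζ (x + y) ∂m := by
      ext x
      rw [integral_map (f := fun y => ζ (x + y)) measurable_neg.aemeasurable
        (hζ.comp (measurable_const_add x)).aestronglyMeasurable,
        integral_withDensity_eq_integral_toReal_smul (hρc j).measurable.ennreal_ofReal (by simp),
        hψ]
      simp [ENNReal.toReal_ofReal (hρ0 j _), sub_eq_add_neg]
    rw [this]
    exact eLpNorm_average_le m hζ hp
  · refine ContDiffBump.ae_convolution_tendsto_right_of_locallyIntegrable (K := 2) ?_ ?_
      hζint.locallyIntegrable
    · have : Tendsto (fun j : ℕ => 2 * (1 / ((j : ℝ) + 1))) atTop (𝓝 (2 * 0)) :=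
        tendsto_one_div_add_atTop_nhds_zero_nat.const_mul 2
      simpa [φ, div_eq_mul_inv] using this
    · exact Eventually.of_forall fun j => le_of_eq (by
        change 2 / ((j : ℝ) + 1) = 2 * (1 / ((j : ℝ) + 1)); ring)

/-- An estimate against test functions extends to bounded, compactly supported functions. -/
lemma abs_integral_mul_le_of_forall_test {g : EuclideanSpace ℝ (Fin n) → ℝ}
    (hg : LocallyIntegrable g) {q : ℝ≥0∞} (hq : 1 ≤ q) {M : ℝ} (hM : 0 ≤ M)
    (h : ∀ ψ : EuclideanSpace ℝ (Fin n) → ℝ, ContDiff ℝ (⊤ : ℕ∞) ψ → HasCompactSupport ψ →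
      |∫ x, g x * ψ x| ≤ M * (eLpNorm ψ q volume).toReal)
    {ζ : EuclideanSpace ℝ (Fin n) → ℝ} (hζ : Measurable ζ) {B : ℝ}
    (hB : ∀ x, |ζ x| ≤ B) {R : ℝ} (hR : ∀ x, R < ‖x‖ → ζ x = 0)
    (hfin : eLpNorm ζ q volume ≠ ∞) :
    |∫ x, g x * ζ x| ≤ M * (eLpNorm ζ q volume).toReal := by
  obtain ⟨ψ, h1, h2, h3, h4, h5, h6⟩ := exists_smooth_approx hζ hB hR
  have hB0 : 0 ≤ B := (abs_nonneg _).trans (hB 0)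
  have hlim : Tendsto (fun j => ∫ x, g x * ψ j x) atTop (𝓝 (∫ x, g x * ζ x)) := by
    refine tendsto_integral_of_dominated_convergence
      ((Metric.closedBall 0 (R + 2)).indicator fun x => |g x| * B) ?_ ?_ ?_ ?_
    · intro j
      exact hg.aestronglyMeasurable.mul (h1 j).continuous.aestronglyMeasurable
    · rw [integrable_indicator_iff measurableSet_closedBall]
      exact ((hg.integrableOn_isCompact (isCompact_closedBall _ _)).abs).mul_const B
    · intro j
      refine Eventually.of_forall fun x => ?_
      by_cases hx : x ∈ Metric.closedBall (0 : EuclideanSpace ℝ (Fin n)) (R + 2)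
      · rw [indicator_of_mem hx, norm_mul, Real.norm_eq_abs, Real.norm_eq_abs]
        exact mul_le_mul_of_nonneg_left (h3 j x) (abs_nonneg _)
      · rw [indicator_of_notMem hx, h4 j x (by simpa using hx)]; simp
    · filter_upwards [h6] with x hx using hx.const_mul _
  refine le_of_tendsto hlim.abs (Eventually.of_forall fun j => ?_)
  exact (h _ (h1 j) (h2 j)).trans
    (mul_le_mul_of_nonneg_left (ENNReal.toReal_mono hfin (h5 j q hq)) hM)

lemma memLp_of_bounded_of_compact {ζ : EuclideanSpace ℝ (Fin n) → ℝ} (hζ : Measurable ζ) {B : ℝ}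
    (hB : ∀ x, |ζ x| ≤ B) {R : ℝ} (hR : ∀ x, R < ‖x‖ → ζ x = 0) (p : ℝ≥0∞) :
    MemLp ζ p volume := by
  have h : ζ = (Metric.closedBall (0 : EuclideanSpace ℝ (Fin n)) R).indicator ζ := by
    ext x
    by_cases hx : x ∈ Metric.closedBall (0 : EuclideanSpace ℝ (Fin n)) R
    · rw [indicator_of_mem hx]
    · rw [indicator_of_notMem hx, hR x (by simpa using hx)]
  rw [h, memLp_indicator_iff_restrict measurableSet_closedBall]
  have : IsFiniteMeasure ((volume : Measure (EuclideanSpace ℝ (Fin n))).restrict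
      (Metric.closedBall 0 R)) :=
    isFiniteMeasure_restrict.2 (isCompact_closedBall _ _).measure_lt_top.ne
  exact MemLp.of_bound hζ.aestronglyMeasurable B (Eventually.of_forall hB)

/-- The `L^∞` norm is controlled by duality with test functions in `L^1`. -/
lemma eLpNorm_top_le_of_forall_test {g : EuclideanSpace ℝ (Fin n) → ℝ}
    (hg : LocallyIntegrable g) {M : ℝ} (hM : 0 ≤ M)
    (h : ∀ ψ : EuclideanSpace ℝ (Fin n) → ℝ, ContDiff ℝ (⊤ : ℕ∞) ψ → HasCompactSupport ψ →
      |∫ x, g x * ψ x| ≤ M * (eLpNorm ψ 1 volume).toReal) :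
    eLpNorm g ∞ volume ≤ ENNReal.ofReal M := by
  have key : ∀ R : ℕ, ∀ᵐ x ∂(volume.restrict (Metric.closedBall (0 : EuclideanSpace ℝ (Fin n)) R)),
      |g x| ≤ M := by
    intro R
    have hfin := (isCompact_closedBall (0 : EuclideanSpace ℝ (Fin n)) (R : ℝ)).measure_lt_top
      (μ := volume)
    have : IsFiniteMeasure ((volume : Measure (EuclideanSpace ℝ (Fin n))).restrict
      (Metric.closedBall 0 R)) := isFiniteMeasure_restrict.2 hfin.ne
    have hgi : IntegrableOn g (Metric.closedBall (0 : EuclideanSpace ℝ (Fin n)) R) :=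
      hg.integrableOn_isCompact (isCompact_closedBall _ _)
    have hset : ∀ s : Set (EuclideanSpace ℝ (Fin n)), MeasurableSet s →
        |∫ x in s, g x ∂(volume.restrict (Metric.closedBall 0 R))| ≤
          ∫ x in s, M ∂(volume.restrict (Metric.closedBall 0 R)) := by
      intro s hs
      have hs' : MeasurableSet (s ∩ Metric.closedBall (0 : EuclideanSpace ℝ (Fin n)) (R : ℝ)) :=
        hs.inter measurableSet_closedBall
      have hlt : volume (s ∩ Metric.closedBall (0 : EuclideanSpace ℝ (Fin n)) (R : ℝ)) ≠ ∞ :=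
        ((measure_mono inter_subset_right).trans_lt hfin).ne
      let ζ : EuclideanSpace ℝ (Fin n) → ℝ := (s ∩ Metric.closedBall 0 (R : ℝ)).indicator 1
      have h1 : Measurable ζ := measurable_one.indicator hs'
      have hb : ∀ x, |ζ x| ≤ 1 := fun x => by
        by_cases hx : x ∈ s ∩ Metric.closedBall (0 : EuclideanSpace ℝ (Fin n)) (R : ℝ)
        · simp [ζ, indicator_of_mem hx]
        · simp [ζ, indicator_of_notMem hx]
      have hz : ∀ x, (R : ℝ) < ‖x‖ → ζ x = 0 := fun x hx =>
        indicator_of_notMem (fun h => by have := h.2; simp at this; linarith) _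
      have h2 : eLpNorm ζ 1 volume =
          volume (s ∩ Metric.closedBall (0 : EuclideanSpace ℝ (Fin n)) (R : ℝ)) := by
        have := eLpNorm_indicator_const (c := (1 : ℝ)) hs' one_ne_zero ENNReal.one_ne_top
          (μ := volume)
        simpa [ζ, Pi.one_def] using this
      have := abs_integral_mul_le_of_forall_test hg le_rfl hM h h1 hb hz (by rw [h2]; exact hlt)
      rw [h2] at this
      have h3 : ∫ x, g x * ζ x = ∫ x in s ∩ Metric.closedBall 0 (R : ℝ), g x := by
        rw [← integral_indicator hs']
        congr 1; ext x
        by_cases hx : x ∈ s ∩ Metric.closedBall (0 : EuclideanSpace ℝ (Fin n)) (R : ℝ)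
        · simp [ζ, indicator_of_mem hx]
        · simp [ζ, indicator_of_notMem hx]
      rw [Measure.restrict_restrict hs, ← h3, setIntegral_const, smul_eq_mul, mul_comm]
      exact this
    have h1 : g ≤ᵐ[volume.restrict (Metric.closedBall 0 R)] fun _ => M :=
      ae_le_of_forall_setIntegral_le hgi (integrable_const M)
        fun s hs _ => (le_abs_self _).trans (hset s hs)
    have h2 : (fun x => -g x) ≤ᵐ[volume.restrict (Metric.closedBall 0 R)] fun _ => M := by
      refine ae_le_of_forall_setIntegral_le hgi.neg (integrable_const M) fun s hs _ => ?_
      rw [integral_neg]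
      exact (neg_le_abs _).trans (hset s hs)
    filter_upwards [h1, h2] with x hx1 hx2
    exact abs_le'.2 ⟨hx1, hx2⟩
  have hall : ∀ᵐ x, |g x| ≤ M := by
    have := ae_all_iff.2 fun R : ℕ => (ae_restrict_iff' measurableSet_closedBall).1 (key R)
    filter_upwards [this] with x hx
    obtain ⟨R, hR⟩ := exists_nat_ge ‖x‖
    exact hx R (by simpa using hR)
  rw [eLpNorm_exponent_top]
  refine essSup_le_of_ae_le _ ?_
  filter_upwards [hall] with x hx
  rw [Real.enorm_eq_ofReal_abs]
  exact ENNReal.ofReal_le_ofReal hx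

/-- The `L^p` norm is controlled by duality with test functions in the conjugate space. -/
lemma eLpNorm_le_of_forall_test {p q : ℝ≥0∞} [hpq : p.HolderConjugate q] (hp' : p ≠ ∞)
    {g : EuclideanSpace ℝ (Fin n) → ℝ} (hgm : Measurable g) (hg : LocallyIntegrable g)
    {M : ℝ} (hM : 0 ≤ M)
    (h : ∀ ψ : EuclideanSpace ℝ (Fin n) → ℝ, ContDiff ℝ (⊤ : ℕ∞) ψ → HasCompactSupport ψ →
      |∫ x, g x * ψ x| ≤ M * (eLpNorm ψ q volume).toReal) :
    eLpNorm g p volume ≤ ENNReal.ofReal M := by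
  have hp : 1 ≤ p := hpq.one_le
  have hq : 1 ≤ q := hpq.symm.one_le
  have hp0 : p ≠ 0 := (zero_lt_one.trans_le hp).ne'
  have hpr : 1 ≤ p.toReal := by
    rw [← ENNReal.toReal_one]; exact ENNReal.toReal_mono hp' hp
  let r := p.toReal
  let A : ℕ → Set (EuclideanSpace ℝ (Fin n)) := fun k => {x | |g x| ≤ k ∧ ‖x‖ ≤ k}
  have hA : ∀ k, MeasurableSet (A k) := fun k =>
    (measurableSet_le hgm.abs measurable_const).inter
      (measurableSet_le measurable_norm measurable_const)
  have key : ∀ k, ∫⁻ x in A k, ‖g x‖ₑ ^ r ≤ ENNReal.ofReal M ^ r := by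
    intro k
    let ζ : EuclideanSpace ℝ (Fin n) → ℝ := (A k).indicator fun x => g x * |g x| ^ (r - 2)
    have hζm : Measurable ζ := (hgm.mul (hgm.abs.pow_const _)).indicator (hA k)
    have hζabs : ∀ x ∈ A k, |ζ x| ≤ |g x| ^ (r - 1) := by
      intro x hx
      simp only [ζ, indicator_of_mem hx]
      rcases eq_or_ne (g x) 0 with h0 | h0
      · rw [h0]; simp only [zero_mul, abs_zero]; positivity
      · rw [abs_mul, abs_of_nonneg (a := |g x| ^ (r - 2)) (by positivity)]
        conv_lhs => rw [← Real.rpow_one |g x|]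
        rw [← Real.rpow_mul (abs_nonneg _), ← Real.rpow_add (abs_pos.2 h0)]
        exact le_of_eq (by ring_nf)
    have hζb : ∀ x, |ζ x| ≤ (k : ℝ) ^ (r - 1) := by
      intro x
      by_cases hx : x ∈ A k
      · exact (hζabs x hx).trans
          (Real.rpow_le_rpow (abs_nonneg _) hx.1 (by simp only [r]; linarith))
      · simp only [ζ, indicator_of_notMem hx, abs_zero]; positivity
    have hζz : ∀ x, (k : ℝ) < ‖x‖ → ζ x = 0 := fun x hx =>
      indicator_of_notMem (fun h => by have := h.2; linarith) _
    have hmem := memLp_of_bounded_of_compact hζm hζb hζz q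
    have hle := abs_integral_mul_le_of_forall_test hg hq hM h hζm hζb hζz hmem.2.ne
    let I : ℝ := ∫ x in A k, |g x| ^ r
    have hAfin : volume (A k) ≠ ∞ :=
      ((measure_mono (fun x hx => by simpa using hx.2)).trans_lt
        (isCompact_closedBall (0 : EuclideanSpace ℝ (Fin n)) (k : ℝ)).measure_lt_top).ne
    have hIint : IntegrableOn (fun x => |g x| ^ r) (A k) := by
      refine Measure.integrableOn_of_bounded (M := (k : ℝ) ^ r) hAfin
        (hgm.abs.pow_const _).aestronglyMeasurable ?_
      filter_upwards [ae_restrict_mem (hA k)] with x hx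
      rw [Real.norm_eq_abs, abs_of_nonneg (by positivity)]
      exact Real.rpow_le_rpow (abs_nonneg _) hx.1 (by positivity)
    have hI0 : 0 ≤ I := integral_nonneg fun x => by positivity
    have hIe : ∫⁻ x in A k, ‖g x‖ₑ ^ r = ENNReal.ofReal I := by
      rw [ofReal_integral_eq_lintegral_ofReal hIint
        (Eventually.of_forall fun x => by positivity)]
      congr 1; ext x
      rw [Real.enorm_eq_ofReal_abs, ENNReal.ofReal_rpow_of_nonneg (abs_nonneg _) (by positivity)]
    have hgζ : ∫ x, g x * ζ x = I := by
      simp only [I]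
      rw [← integral_indicator (hA k)]
      congr 1; ext x
      by_cases hx : x ∈ A k
      · simp only [ζ, indicator_of_mem hx]
        rcases eq_or_ne (g x) 0 with h0 | h0
        · rw [h0]; simp [Real.zero_rpow (show r ≠ 0 by simp only [r]; linarith)]
        · rw [← mul_assoc, ← abs_mul_abs_self (g x), ← pow_two, ← Real.rpow_natCast,
            ← Real.rpow_add (abs_pos.2 h0)]
          norm_num
      · simp [ζ, indicator_of_notMem hx]
    have hinv := toReal_inv_eq_one_sub p q
    have hζq : eLpNorm ζ q volume ≤ ENNReal.ofReal (I ^ (1 - r⁻¹)) := by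
      by_cases hqtop : q = ∞
      · have hr1 : r⁻¹ = 1 := by
          rw [hqtop] at hinv; simp only [ENNReal.toReal_top, inv_zero] at hinv
          simp only [r]; linarith
        have hr1' : r = 1 := inv_eq_one.1 hr1
        rw [hqtop, eLpNorm_exponent_top, hr1, sub_self, Real.rpow_zero]
        refine essSup_le_of_ae_le _ (Eventually.of_forall fun x => ?_)
        change ‖ζ x‖ₑ ≤ ENNReal.ofReal 1
        rw [Real.enorm_eq_ofReal_abs]
        refine ENNReal.ofReal_le_ofReal ?_
        have := hζb x
        rwa [hr1', sub_self, Real.rpow_zero] at this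
      · have hq0 : q ≠ 0 := (zero_lt_one.trans_le hq).ne'
        have hqr : 0 < q.toReal := ENNReal.toReal_pos hq0 hqtop
        rw [eLpNorm_eq_lintegral_rpow_enorm_toReal hq0 hqtop, one_div, hinv]
        have hexp : (r - 1) * q.toReal = r := by
          have h1 : q.toReal⁻¹ = (r - 1) / r := by
            rw [hinv]; simp only [r]; field_simp
          have h2 : r - 1 = r * q.toReal⁻¹ := by
            rw [h1, mul_div_cancel₀ _ (by simp only [r]; linarith)]
          rw [h2]; field_simp
        have h3 : ∫⁻ x, ‖ζ x‖ₑ ^ q.toReal ≤ ENNReal.ofReal I := by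
          rw [← hIe, ← lintegral_indicator (hA k)]
          refine lintegral_mono fun x => ?_
          by_cases hx : x ∈ A k
          · rw [indicator_of_mem hx, Real.enorm_eq_ofReal_abs, Real.enorm_eq_ofReal_abs,
              ENNReal.ofReal_rpow_of_nonneg (abs_nonneg _) hqr.le,
              ENNReal.ofReal_rpow_of_nonneg (abs_nonneg _) (by positivity)]
            refine ENNReal.ofReal_le_ofReal ?_
            calc |ζ x| ^ q.toReal ≤ (|g x| ^ (r - 1)) ^ q.toReal :=
                  Real.rpow_le_rpow (abs_nonneg _) (hζabs x hx) hqr.le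
              _ = |g x| ^ r := by rw [← Real.rpow_mul (abs_nonneg _), hexp]
          · simp [ζ, indicator_of_notMem hx, hqr]
        have h4 : 0 ≤ 1 - r⁻¹ := by
          have := inv_le_one_of_one_le₀ hpr; simp only [r]; linarith
        rw [← ENNReal.ofReal_rpow_of_nonneg hI0 h4]
        exact ENNReal.rpow_le_rpow h3 h4
    rw [hgζ, abs_of_nonneg hI0] at hle
    have h5 : I ≤ M * I ^ (1 - r⁻¹) := by
      refine hle.trans (mul_le_mul_of_nonneg_left ?_ hM)
      exact ENNReal.toReal_le_of_le_ofReal (by positivity) hζq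
    have h6 : I ≤ M ^ r := by
      rcases hI0.eq_or_lt with h0 | h0
      · rw [← h0]; positivity
      · have h7 : I ^ (r⁻¹) ≤ M := by
          have : I = I ^ (r⁻¹) * I ^ (1 - r⁻¹) := by
            rw [← Real.rpow_add h0]; simp
          rw [this] at h5
          nth_rewrite 2 [← this] at h5
          exact le_of_mul_le_mul_right h5 (by positivity)
        calc I = (I ^ r⁻¹) ^ r := by
              rw [← Real.rpow_mul hI0, inv_mul_cancel₀ (by simp only [r]; linarith), Real.rpow_one]
          _ ≤ M ^ r := Real.rpow_le_rpow (by positivity) h7 (by positivity)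
    rw [hIe, ENNReal.ofReal_rpow_of_nonneg hM (by positivity)]
    exact ENNReal.ofReal_le_ofReal h6
  have hmono : Monotone A := fun i j hij x hx =>
    ⟨hx.1.trans (by exact_mod_cast hij), hx.2.trans (by exact_mod_cast hij)⟩
  have hUn : ⋃ k, A k = univ := by
    refine eq_univ_of_forall fun x => mem_iUnion.2 ?_
    obtain ⟨k, hk⟩ := exists_nat_ge (max |g x| ‖x‖)
    exact ⟨k, (le_max_left _ _).trans hk, (le_max_right _ _).trans hk⟩
  have hlim : ∫⁻ x, ‖g x‖ₑ ^ r ≤ ENNReal.ofReal M ^ r := by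
    rw [← setLIntegral_univ, ← hUn, setLIntegral_iUnion_of_directed _ hmono.directed_le]
    exact iSup_le key
  rw [eLpNorm_eq_lintegral_rpow_enorm_toReal hp0 hp', one_div]
  calc _ ≤ (ENNReal.ofReal M ^ r) ^ (p.toReal)⁻¹ := by gcongr
    _ = ENNReal.ofReal M := by
      rw [← ENNReal.rpow_mul, mul_inv_cancel₀ (by linarith), ENNReal.rpow_one]

end Duality

/-- The space `L^p(ℝⁿ)` of real functions. -/
abbrev LpE (n : ℕ) (p : ℝ≥0∞) : Type :=
  Lp ℝ p (volume : Measure (EuclideanSpace ℝ (Fin n)))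

section Pairing

variable {n : ℕ} {p : ℝ≥0∞}

/-- Hölder's inequality for the integral pairing. -/
lemma integral_norm_mul_le (q : ℝ≥0∞) [p.HolderConjugate q] (z : LpE n p)
    {ψ : EuclideanSpace ℝ (Fin n) → ℝ} (hψ : MemLp ψ q volume) :
    ∫ x, ‖z x * ψ x‖ ≤ ‖z‖ * (eLpNorm ψ q volume).toReal := by
  have h2 := eLpNorm_smul_le_mul_eLpNorm (p := p) (q := q) (r := 1) hψ.1 (Lp.aestronglyMeasurable z)
  rw [eLpNorm_one_eq_lintegral_enorm] at h2
  have h4 := ENNReal.toReal_mono (ENNReal.mul_ne_top (Lp.eLpNorm_ne_top z) hψ.2.ne) h2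
  rw [ENNReal.toReal_mul, ← Lp.norm_def] at h4
  exact (integral_norm_eq_lintegral_enorm ((Lp.aestronglyMeasurable z).mul hψ.1)).trans_le h4

lemma abs_integral_mul_le (q : ℝ≥0∞) [p.HolderConjugate q] (z : LpE n p)
    {ψ : EuclideanSpace ℝ (Fin n) → ℝ} (hψ : MemLp ψ q volume) :
    |∫ x, z x * ψ x| ≤ ‖z‖ * (eLpNorm ψ q volume).toReal :=
  (norm_integral_le_integral_norm _).trans (integral_norm_mul_le q z hψ)

lemma integrable_coe_mul (q : ℝ≥0∞) [p.HolderConjugate q] (z : LpE n p)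
    {ψ : EuclideanSpace ℝ (Fin n) → ℝ} (hψ : MemLp ψ q volume) :
    Integrable fun x => z x * ψ x :=
  (Lp.memLp z).integrable_mul hψ

variable [hp : Fact (1 ≤ p)]

/-- The pairing with a fixed function, as a continuous linear form on `L^p`. -/
noncomputable def pairCLM {q : ℝ≥0∞} [p.HolderConjugate q]
    {ψ : EuclideanSpace ℝ (Fin n) → ℝ} (hψ : MemLp ψ q volume) : LpE n p →L[ℝ] ℝ :=
  LinearMap.mkContinuous
    { toFun := fun z => ∫ x, z x * ψ x
      map_add' := fun z w => by
        rw [← integral_add (integrable_coe_mul q z hψ) (integrable_coe_mul q w hψ)]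
        refine integral_congr_ae ?_
        filter_upwards [Lp.coeFn_add z w] with x hx
        rw [← add_mul]; exact congrArg (· * ψ x) hx
      map_smul' := fun c z => by
        rw [RingHom.id_apply, smul_eq_mul, ← integral_const_mul]
        refine integral_congr_ae ?_
        filter_upwards [Lp.coeFn_smul c z] with x hx
        rw [← mul_assoc]; exact congrArg (· * ψ x) hx }
    (eLpNorm ψ q volume).toReal
    fun z => by
      rw [mul_comm]
      exact abs_integral_mul_le q z hψ

lemma pairCLM_apply {q : ℝ≥0∞} [p.HolderConjugate q]
    {ψ : EuclideanSpace ℝ (Fin n) → ℝ} (hψ : MemLp ψ q volume) (z : LpE n p) :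
    pairCLM hψ z = ∫ x, z x * ψ x := rfl

lemma locallyIntegrable_coe (z : LpE n p) : LocallyIntegrable z volume :=
  (Lp.memLp z).locallyIntegrable hp.out

end Pairing

section HeatLp

open Filter Topology

variable {n : ℕ} {p : ℝ≥0∞} [hp : Fact (1 ≤ p)]

/-- The heat semigroup on `L^p`, as an average of translations. -/
noncomputable def heatLp (τ : ℝ) (z : LpE n p) : LpE n p :=
  ∫ v, (DomAddAct.mk (-(√τ • v)) +ᵥ z : LpE n p) ∂gaussMeasure n

lemma norm_heatLp_le (τ : ℝ) (z : LpE n p) : ‖heatLp τ z‖ ≤ ‖z‖ := by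
  refine (norm_integral_le_of_norm_le (integrable_const ‖z‖)
    (Eventually.of_forall fun v => ?_)).trans ?_
  · rw [DomAddAct.norm_vadd_Lp]
  · simp

lemma heatLp_of_nonpos {τ : ℝ} (hτ : τ ≤ 0) (z : LpE n p) : heatLp τ z = z := by
  simp [heatLp, Real.sqrt_eq_zero_of_nonpos hτ]

variable [hp' : Fact (p ≠ ∞)]

lemma integrable_translate (τ : ℝ) (z : LpE n p) :
    Integrable (fun v : EuclideanSpace ℝ (Fin n) => (DomAddAct.mk (-(√τ • v)) +ᵥ z : LpE n p)) (gaussMeasure n) := by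
  have hc : Continuous fun v : EuclideanSpace ℝ (Fin n) =>
      (DomAddAct.mk (-(√τ • v)) +ᵥ z : LpE n p) :=
    (DomAddAct.continuous_mk.comp
      (by fun_prop : Continuous fun v : EuclideanSpace ℝ (Fin n) => -(√τ • v))).vadd
        continuous_const
  refine Integrable.mono' (integrable_const ‖z‖) hc.aestronglyMeasurable
    (Eventually.of_forall fun v => ?_)
  rw [DomAddAct.norm_vadd_Lp]

lemma heatLp_sub (τ : ℝ) (z w : LpE n p) : heatLp τ (z - w) = heatLp τ z - heatLp τ w := by
  unfold heatLp
  rw [← integral_sub (integrable_translate τ z) (integrable_translate τ w)]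
  congr 1; ext1 v
  exact DomAddAct.vadd_Lp_sub _ _ _

lemma continuous_heatLp_left (z : LpE n p) : Continuous fun τ => heatLp τ z := by
  refine continuous_of_dominated (bound := fun _ => ‖z‖)
    (fun τ => (integrable_translate τ z).aestronglyMeasurable)
    (fun τ => Eventually.of_forall fun v => by rw [DomAddAct.norm_vadd_Lp]) (integrable_const _)
    (Eventually.of_forall fun v => ?_)
  exact (DomAddAct.continuous_mk.comp
    (by fun_prop : Continuous fun τ : ℝ => -(√τ • v))).vadd continuous_const

lemma continuous_heatLp : Continuous fun r : ℝ × LpE n p => heatLp r.1 r.2 := by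
  rw [continuous_iff_continuousAt]
  rintro ⟨τ, z⟩
  rw [ContinuousAt, tendsto_iff_norm_sub_tendsto_zero]
  have h1 : Tendsto (fun r : ℝ × LpE n p => ‖r.2 - z‖ + ‖heatLp r.1 z - heatLp τ z‖)
      (𝓝 (τ, z)) (𝓝 0) := by
    have : Continuous fun r : ℝ × LpE n p => ‖r.2 - z‖ + ‖heatLp r.1 z - heatLp τ z‖ :=
      (continuous_snd.sub continuous_const).norm.add
        (((continuous_heatLp_left z).comp continuous_fst).sub continuous_const).norm
    simpa using this.tendsto (τ, z)
  refine squeeze_zero (fun _ => norm_nonneg _) (fun r => ?_) h1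
  calc ‖heatLp r.1 r.2 - heatLp τ z‖
      = ‖heatLp r.1 (r.2 - z) + (heatLp r.1 z - heatLp τ z)‖ := by rw [heatLp_sub]; abel_nf
    _ ≤ _ := (norm_add_le _ _).trans (add_le_add_left (norm_heatLp_le _ _) _)

/-- The heat semigroup is symmetric. -/
lemma integral_heatLp_mul (q : ℝ≥0∞) [p.HolderConjugate q] (τ : ℝ) (z : LpE n p)
    {ψ : EuclideanSpace ℝ (Fin n) → ℝ} (hψ : Measurable ψ) (hψq : MemLp ψ q volume) :
    ∫ x, heatLp τ z x * ψ x = ∫ x, z x * heatFun τ ψ x := by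
  have hq : 1 ≤ q := (ENNReal.HolderConjugate.symm (p := p) (q := q)).one_le
  have h1 : ∫ x, heatLp τ z x * ψ x =
      ∫ v, ∫ x, (DomAddAct.mk (-(√τ • v)) +ᵥ z : LpE n p) x * ψ x ∂volume ∂gaussMeasure n := by
    rw [← pairCLM_apply hψq, heatLp,
      ← ContinuousLinearMap.integral_comp_comm _ (integrable_translate τ z)]
    rfl
  have h2 : ∀ v : EuclideanSpace ℝ (Fin n),
      ∫ x, (DomAddAct.mk (-(√τ • v)) +ᵥ z : LpE n p) x * ψ x = ∫ x, z x * ψ (x + √τ • v) := by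
    intro v
    rw [← integral_add_right_eq_self (fun x => z x * ψ (x + √τ • v)) (-(√τ • v))]
    refine integral_congr_ae ?_
    filter_upwards [DomAddAct.vadd_Lp_ae_eq (DomAddAct.mk (-(√τ • v))) z] with x hx
    rw [hx]
    simp [add_comm]
  simp_rw [h1, h2]
  rw [integral_integral_swap]
  · congr 1; ext x
    rw [integral_const_mul]; rfl
  · have hm : Measurable fun r : EuclideanSpace ℝ (Fin n) × EuclideanSpace ℝ (Fin n) =>
        ψ (r.2 + √τ • r.1) := hψ.comp (by fun_prop)
    have hz : AEStronglyMeasurable (fun r : EuclideanSpace ℝ (Fin n) × EuclideanSpace ℝ (Fin n) =>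
        z r.2) ((gaussMeasure n).prod volume) := (Lp.aestronglyMeasurable z).comp_snd
    have hae : AEStronglyMeasurable (Function.uncurry fun (v x : EuclideanSpace ℝ (Fin n)) =>
        z x * ψ (x + √τ • v)) ((gaussMeasure n).prod volume) :=
      hz.mul hm.aestronglyMeasurable
    have hmem : ∀ v : EuclideanSpace ℝ (Fin n), MemLp (fun x => ψ (x + √τ • v)) q volume :=
      fun v => hψq.comp_measurePreserving (measurePreserving_add_right volume (√τ • v))
    rw [integrable_prod_iff hae]
    refine ⟨Eventually.of_forall fun v => integrable_coe_mul q z (hmem v), ?_⟩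
    refine Integrable.mono' (integrable_const (‖z‖ * (eLpNorm ψ q volume).toReal))
      hae.norm.integral_prod_right' (Eventually.of_forall fun v => ?_)
    rw [Real.norm_eq_abs, abs_of_nonneg (integral_nonneg fun _ => norm_nonneg _)]
    have h6 : eLpNorm (fun x => ψ (x + √τ • v)) q volume = eLpNorm ψ q volume :=
      eLpNorm_comp_measurePreserving hψ.aestronglyMeasurable
        (measurePreserving_add_right volume (√τ • v))
    rw [← h6]
    exact integral_norm_mul_le q z (hmem v)

end HeatLp

/-- The backward heat operator `∂ₜφ + Δφ`. -/
noncomputable def backHeat {n : ℕ} (φ : ℝ × EuclideanSpace ℝ (Fin n) → ℝ)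
    (r : ℝ × EuclideanSpace ℝ (Fin n)) : ℝ :=
  deriv (fun s => φ (s, r.2)) r.1 + Laplacian.laplacian (fun y => φ (r.1, y)) r.2

section Laplacian

open Filter Topology

variable {n : ℕ}

lemma laplacian_eq_sum_fderiv {f : EuclideanSpace ℝ (Fin n) → ℝ} (hf : ContDiff ℝ (⊤ : ℕ∞) f)
    (x : EuclideanSpace ℝ (Fin n)) :
    Laplacian.laplacian f x = ∑ i, fderiv ℝ (fun y => fderiv ℝ f y
      (EuclideanSpace.basisFun (Fin n) ℝ i)) x (EuclideanSpace.basisFun (Fin n) ℝ i) := by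
  rw [InnerProductSpace.laplacian_eq_iteratedFDeriv_orthonormalBasis f
    (EuclideanSpace.basisFun (Fin n) ℝ)]
  refine Finset.sum_congr rfl fun i _ => ?_
  rw [iteratedFDeriv_two_apply, fderiv_clm_apply]
  · simp
  · exact ((hf.fderiv_right (m := (⊤ : ℕ∞)) (by exact_mod_cast le_top)).differentiable (by simp)) x
  · fun_prop

lemma contDiff_fderiv_apply {F : Type*} [NormedAddCommGroup F] [NormedSpace ℝ F] {f : F → ℝ}
    (hf : ContDiff ℝ (⊤ : ℕ∞) f) (w : F) :
    ContDiff ℝ (⊤ : ℕ∞) fun y => fderiv ℝ f y w :=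
  (hf.fderiv_right (m := (⊤ : ℕ∞)) (by exact_mod_cast le_top)).clm_apply contDiff_const

/-- The Ornstein–Uhlenbeck identity. -/
lemma integral_gaussDensity_mul_laplacian {h : EuclideanSpace ℝ (Fin n) → ℝ}
    (hh : ContDiff ℝ (⊤ : ℕ∞) h) (hc : HasCompactSupport h) :
    ∫ v, gaussDensity n v * Laplacian.laplacian h v =
      ∫ v, gaussDensity n v * (2⁻¹ * fderiv ℝ h v v) := by
  set e := EuclideanSpace.basisFun (Fin n) ℝ with he
  have hcont : ∀ w, ContDiff ℝ (⊤ : ℕ∞) fun y => fderiv ℝ h y w := contDiff_fderiv_apply hh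
  have hsupp : ∀ w, HasCompactSupport fun y => fderiv ℝ h y w := fun w => hc.fderiv_apply ℝ w
  have hg : ∀ v w : EuclideanSpace ℝ (Fin n),
      fderiv ℝ (gaussDensity n) v w = -(2⁻¹ * inner ℝ v w) * gaussDensity n v := by
    intro v w
    have h1 : HasFDerivAt (gaussDensity n) _ v :=
      (((hasStrictFDerivAt_norm_sq v).hasFDerivAt.const_mul (-(1 / 4) : ℝ)).exp).const_mul
        ((4 * Real.pi) ^ (-((n : ℝ) / 2)))
    rw [h1.fderiv]
    simp [gaussDensity]
    ring
  have hci : ∀ {f : EuclideanSpace ℝ (Fin n) → ℝ} {k : EuclideanSpace ℝ (Fin n) → ℝ},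
      Continuous f → Continuous k → HasCompactSupport k → Integrable fun v => f v * k v :=
    fun hf hk hkc => (hf.mul hk).integrable_of_hasCompactSupport hkc.mul_left
  have hgc : ∀ w, Continuous fun v => fderiv ℝ (gaussDensity n) v w := fun w =>
    (contDiff_fderiv_apply contDiff_gaussDensity w).continuous
  have hparts : ∀ i, ∫ v, gaussDensity n v * fderiv ℝ (fun y => fderiv ℝ h y (e i)) v (e i) =
      ∫ v, gaussDensity n v * (2⁻¹ * (inner ℝ v (e i) * fderiv ℝ h v (e i))) := by
    intro i
    rw [integral_mul_fderiv_eq_neg_fderiv_mul_of_integrable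
      (hci (hgc _) (hcont _).continuous (hsupp _))
      (hci continuous_gaussDensity (contDiff_fderiv_apply (hcont (e i)) (e i)).continuous
        ((hsupp (e i)).fderiv_apply ℝ (e i)))
      (hci continuous_gaussDensity (hcont _).continuous (hsupp _))
      (fun x _ => (contDiff_gaussDensity.differentiable (by simp)) x)
      (fun x _ => ((hcont (e i)).differentiable (by simp)) x), ← integral_neg]
    congr 1; ext v
    rw [hg]; ring
  have h1 : ∀ v, gaussDensity n v * Laplacian.laplacian h v =
      ∑ i, gaussDensity n v * fderiv ℝ (fun y => fderiv ℝ h y (e i)) v (e i) := fun v => by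
    rw [laplacian_eq_sum_fderiv hh, Finset.mul_sum]
  have h2 : ∀ v, gaussDensity n v * (2⁻¹ * fderiv ℝ h v v) =
      ∑ i, gaussDensity n v * (2⁻¹ * (inner ℝ v (e i) * fderiv ℝ h v (e i))) := fun v => by
    have : fderiv ℝ h v v = ∑ i, inner ℝ v (e i) * fderiv ℝ h v (e i) := by
      conv_lhs => rw [← e.sum_repr v, map_sum]
      rw [e.sum_repr v]
      refine Finset.sum_congr rfl fun i _ => ?_
      rw [map_smul, smul_eq_mul, e.repr_apply_apply, real_inner_comm]
    rw [this, Finset.mul_sum, Finset.mul_sum]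
  simp_rw [h1, h2]
  rw [integral_finsetSum, integral_finsetSum]
  · exact Finset.sum_congr rfl fun i _ => hparts i
  · intro i _
    refine hci continuous_gaussDensity (Continuous.mul continuous_const
      (Continuous.mul (by fun_prop) (hcont _).continuous)) ?_
    exact ((hsupp (e i)).mul_left).mul_left
  · intro i _
    exact hci continuous_gaussDensity (contDiff_fderiv_apply (hcont (e i)) (e i)).continuous
        ((hsupp (e i)).fderiv_apply ℝ (e i))

/-- The gradient term produced by differentiating the heat semigroup is the Laplacian. -/
lemma integral_fderiv_gauss_eq_heatFun_laplacian {ψ : EuclideanSpace ℝ (Fin n) → ℝ}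
    (hψ : ContDiff ℝ (⊤ : ℕ∞) ψ) (hc : HasCompactSupport ψ) {τ : ℝ} (hτ : 0 < τ)
    (x : EuclideanSpace ℝ (Fin n)) :
    ∫ v, (2 * √τ)⁻¹ * fderiv ℝ ψ (x + √τ • v) v ∂gaussMeasure n =
      heatFun τ (Laplacian.laplacian ψ) x := by
  have hs : 0 < √τ := Real.sqrt_pos.2 hτ
  set h : EuclideanSpace ℝ (Fin n) → ℝ := fun v => ψ (x + √τ • v) with hh
  have hcd : ContDiff ℝ (⊤ : ℕ∞) h := hψ.comp (contDiff_const.add (contDiff_id.const_smul √τ))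
  have hcs : HasCompactSupport h :=
    hc.comp_homeomorph ((Homeomorph.smulOfNeZero √τ hs.ne').trans (Homeomorph.addLeft x))
  have hD : ∀ {f : EuclideanSpace ℝ (Fin n) → ℝ} (_ : ContDiff ℝ (⊤ : ℕ∞) f)
      (v w : EuclideanSpace ℝ (Fin n)),
      fderiv ℝ (fun v => f (x + √τ • v)) v w = √τ * fderiv ℝ f (x + √τ • v) w := by
    intro f hf v w
    have h1 : HasFDerivAt (fun v : EuclideanSpace ℝ (Fin n) => x + √τ • v)
        (√τ • ContinuousLinearMap.id ℝ _) v := ((hasFDerivAt_id v).const_smul √τ).const_add x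
    have h2 : HasFDerivAt (fun v => f (x + √τ • v)) _ v :=
      ((hf.differentiable (by simp)) (x + √τ • v)).hasFDerivAt.comp v h1
    rw [h2.fderiv]
    simp
  have hL : ∀ v, Laplacian.laplacian h v = τ * Laplacian.laplacian ψ (x + √τ • v) := by
    intro v
    rw [laplacian_eq_sum_fderiv hcd, laplacian_eq_sum_fderiv hψ, Finset.mul_sum]
    refine Finset.sum_congr rfl fun i _ => ?_
    simp_rw [hh, hD hψ]
    rw [fderiv_const_mul]
    · rw [_root_.smul_apply, hD (contDiff_fderiv_apply hψ _), smul_eq_mul, ← mul_assoc,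
        Real.mul_self_sqrt hτ.le]
    · exact (((contDiff_fderiv_apply hψ _).comp
        (contDiff_const.add (contDiff_id.const_smul √τ))).differentiable (by simp)) v
  have key := integral_gaussDensity_mul_laplacian hcd hcs
  have h3 : ∀ v, fderiv ℝ h v v = √τ * fderiv ℝ ψ (x + √τ • v) v := fun v => hD hψ v v
  simp_rw [hL, h3] at key
  rw [heatFun, integral_gaussMeasure, integral_gaussMeasure]
  simp only [smul_eq_mul]
  have e1 : ∀ v, gaussDensity n v * ((2 * √τ)⁻¹ * fderiv ℝ ψ (x + √τ • v) v) =
      τ⁻¹ * (gaussDensity n v * (2⁻¹ * (√τ * fderiv ℝ ψ (x + √τ • v) v))) := by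
    intro v
    have : (2 * √τ)⁻¹ = τ⁻¹ * 2⁻¹ * √τ := by
      nth_rewrite 2 [← Real.mul_self_sqrt hτ.le]
      field_simp
    rw [this]; ring
  simp_rw [e1]
  rw [integral_const_mul, ← key, ← integral_const_mul]
  congr 1; ext v
  field_simp

end Laplacian

section TestFunctions

open Filter Topology

variable {n : ℕ} {φ : ℝ × EuclideanSpace ℝ (Fin n) → ℝ}

lemma contDiff_slice (hφ : ContDiff ℝ (⊤ : ℕ∞) φ) (t : ℝ) :
    ContDiff ℝ (⊤ : ℕ∞) fun y => φ (t, y) :=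
  hφ.comp (contDiff_const.prodMk contDiff_id)

lemma hasCompactSupport_slice (hc : HasCompactSupport φ) (t : ℝ) :
    HasCompactSupport fun y => φ (t, y) := by
  refine HasCompactSupport.intro (hc.isCompact.image continuous_snd) fun y hy => ?_
  by_contra h
  exact hy ⟨(t, y), subset_tsupport _ h, rfl⟩

lemma fderiv_slice (hφ : ContDiff ℝ (⊤ : ℕ∞) φ) (t : ℝ) (x w : EuclideanSpace ℝ (Fin n)) :
    fderiv ℝ (fun y => φ (t, y)) x w = fderiv ℝ φ (t, x) (0, w) := by
  have h1 : HasFDerivAt (fun y : EuclideanSpace ℝ (Fin n) => (t, y))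
      (ContinuousLinearMap.inr ℝ ℝ _) x := hasFDerivAt_prodMk_right t x
  have h2 : HasFDerivAt (fun y => φ (t, y)) _ x :=
    ((hφ.differentiable (by simp)) (t, x)).hasFDerivAt.comp x h1
  rw [h2.fderiv]; simp

lemma deriv_slice (hφ : ContDiff ℝ (⊤ : ℕ∞) φ) (t : ℝ) (x : EuclideanSpace ℝ (Fin n)) :
    deriv (fun s => φ (s, x)) t = fderiv ℝ φ (t, x) (1, 0) := by
  have h1 : HasFDerivAt (fun s : ℝ => (s, x))
    (ContinuousLinearMap.inl ℝ ℝ (EuclideanSpace ℝ (Fin n))) t := hasFDerivAt_prodMk_left t x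
  have h2 : HasFDerivAt (fun s => φ (s, x)) _ t :=
    ((hφ.differentiable (by simp)) (t, x)).hasFDerivAt.comp t h1
  rw [h2.hasDerivAt.deriv]; simp

lemma backHeat_eq (hφ : ContDiff ℝ (⊤ : ℕ∞) φ) :
    backHeat φ = fun r => fderiv ℝ φ r (1, 0) + ∑ i, fderiv ℝ (fun q => fderiv ℝ φ q
      (0, EuclideanSpace.basisFun (Fin n) ℝ i)) r (0, EuclideanSpace.basisFun (Fin n) ℝ i) := by
  ext ⟨t, x⟩
  simp only [backHeat]
  congr 1
  · exact deriv_slice hφ t x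
  · rw [laplacian_eq_sum_fderiv (contDiff_slice hφ t)]
    refine Finset.sum_congr rfl fun i _ => ?_
    simp_rw [fderiv_slice hφ]
    exact fderiv_slice (contDiff_fderiv_apply hφ _) t x _

lemma contDiff_backHeat (hφ : ContDiff ℝ (⊤ : ℕ∞) φ) : ContDiff ℝ (⊤ : ℕ∞) (backHeat φ) := by
  rw [backHeat_eq hφ]
  exact (contDiff_fderiv_apply hφ _).add
    (ContDiff.sum fun i _ => contDiff_fderiv_apply (contDiff_fderiv_apply hφ _) _)

lemma backHeat_eq_zero (r : ℝ × EuclideanSpace ℝ (Fin n)) (hφ : ContDiff ℝ (⊤ : ℕ∞) φ)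
    (hr : r ∉ tsupport φ) : backHeat φ r = 0 := by
  have h0 : ∀ {f : ℝ × EuclideanSpace ℝ (Fin n) → ℝ}, r ∉ tsupport f → fderiv ℝ f r = 0 := by
    intro f hf
    by_contra h
    exact hf (support_fderiv_subset ℝ h)
  rw [backHeat_eq hφ]
  simp only [h0 hr, zero_apply, zero_add]
  refine Finset.sum_eq_zero fun i _ => ?_
  rw [h0, zero_apply]
  exact fun h => hr (tsupport_fderiv_apply_subset ℝ _ h)

lemma hasCompactSupport_backHeat (hφ : ContDiff ℝ (⊤ : ℕ∞) φ) (hc : HasCompactSupport φ) :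
    HasCompactSupport (backHeat φ) :=
  HasCompactSupport.intro hc.isCompact fun r hr => backHeat_eq_zero r hφ hr

/-- Slices of a compactly supported continuous function are uniformly bounded in every `L^q`. -/
lemma exists_slice_bound {Φ : ℝ × EuclideanSpace ℝ (Fin n) → ℝ} (hΦ : Continuous Φ)
    (hc : HasCompactSupport Φ) (q : ℝ≥0∞) :
    ∃ B : ℝ, 0 ≤ B ∧ ∀ t, MemLp (fun x => Φ (t, x)) q volume ∧
      (eLpNorm (fun x => Φ (t, x)) q volume).toReal ≤ B := by
  obtain ⟨C, hC⟩ := hc.exists_bound_of_continuous hΦ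
  obtain ⟨R, hR⟩ := hc.isCompact.isBounded.exists_norm_le
  let ζ : EuclideanSpace ℝ (Fin n) → ℝ := (Metric.closedBall 0 R).indicator fun _ => C
  have hC0 : 0 ≤ C := (norm_nonneg _).trans (hC 0)
  have hζ : MemLp ζ q volume := memLp_indicator_const q measurableSet_closedBall C
    (Or.inr (isCompact_closedBall _ _).measure_lt_top.ne)
  have hle : ∀ t x, ‖Φ (t, x)‖ ≤ ‖ζ x‖ := by
    intro t x
    by_cases hx : x ∈ Metric.closedBall (0 : EuclideanSpace ℝ (Fin n)) R
    · simp only [ζ, indicator_of_mem hx]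
      exact (hC _).trans (le_abs_self _)
    · have : Φ (t, x) = 0 := by
        by_contra h
        have h2 := hR (t, x) (subset_tsupport _ h)
        exact hx (by simpa using (norm_snd_le (t, x)).trans h2)
      simp [this]
  have hm : ∀ t, AEStronglyMeasurable (fun x => Φ (t, x)) volume := fun t =>
    (hΦ.comp (by fun_prop)).aestronglyMeasurable
  refine ⟨(eLpNorm ζ q volume).toReal, ENNReal.toReal_nonneg, fun t => ⟨?_, ?_⟩⟩
  · exact hζ.mono (hm t) (Eventually.of_forall (hle t))
  · exact ENNReal.toReal_mono hζ.2.ne (eLpNorm_mono (hle t))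

lemma integrable_norm_gauss :
    Integrable (fun v : EuclideanSpace ℝ (Fin n) => ‖v‖) (gaussMeasure n) := by
  have hint : Integrable fun v : EuclideanSpace ℝ (Fin n) => Real.exp (-(1 / 8) * ‖v‖ ^ 2) := by
    by_contra h
    have h1 := integral_undef h
    rw [GaussianFourier.integral_rexp_neg_mul_sq_norm (by norm_num)] at h1
    exact (Real.rpow_pos_of_pos (by positivity) _).ne' h1
  rw [gaussMeasure, integrable_withDensity_iff
    continuous_gaussDensity.measurable.ennreal_ofReal (by simp)]
  refine Integrable.mono' (hint.const_mul 2)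
    (measurable_norm.mul
      continuous_gaussDensity.measurable.ennreal_ofReal.ennreal_toReal).aestronglyMeasurable
    (Eventually.of_forall fun v => ?_)
  rw [ENNReal.toReal_ofReal (gaussDensity_pos v).le, Real.norm_eq_abs,
    abs_of_nonneg (mul_nonneg (norm_nonneg _) (gaussDensity_pos v).le)]
  have h1 : ‖v‖ ≤ 2 * Real.exp (1 / 8 * ‖v‖ ^ 2) := by
    nlinarith [Real.add_one_le_exp (1 / 8 * ‖v‖ ^ 2), sq_nonneg (‖v‖ / 2 - 1)]
  have h2 : gaussDensity n v ≤ Real.exp (-(1 / 4) * ‖v‖ ^ 2) := by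
    unfold gaussDensity
    refine mul_le_of_le_one_left (by positivity)
      (Real.rpow_le_one_of_one_le_of_nonpos (by linarith [Real.pi_gt_three]) ?_)
    simp only [Left.neg_nonpos_iff]; positivity
  calc ‖v‖ * gaussDensity n v
      ≤ (2 * Real.exp (1 / 8 * ‖v‖ ^ 2)) * Real.exp (-(1 / 4) * ‖v‖ ^ 2) :=
        mul_le_mul h1 h2 (gaussDensity_pos v).le (by positivity)
    _ = 2 * Real.exp (-(1 / 8) * ‖v‖ ^ 2) := by
        rw [mul_assoc, ← Real.exp_add]; ring_nf

/-- The heat semigroup applied to a moving test function. -/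
lemma continuous_heatFun_slice {Φ : ℝ × EuclideanSpace ℝ (Fin n) → ℝ} (hΦ : Continuous Φ)
    (hc : HasCompactSupport Φ) (s : ℝ) :
    Continuous fun r : ℝ × EuclideanSpace ℝ (Fin n) =>
      heatFun r.1 (fun y => Φ (s + r.1, y)) r.2 := by
  obtain ⟨C, hC⟩ := hc.exists_bound_of_continuous hΦ
  refine continuous_of_dominated (bound := fun _ => C) (fun r => ?_) (fun r => ?_)
    (integrable_const _) ?_
  · exact (hΦ.comp (by fun_prop)).aestronglyMeasurable
  · exact Eventually.of_forall fun v => hC _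
  · exact Eventually.of_forall fun v => hΦ.comp (by fun_prop)

lemma hasDerivAt_heatFun_slice (hφ : ContDiff ℝ (⊤ : ℕ∞) φ) (hc : HasCompactSupport φ)
    (s : ℝ) (x : EuclideanSpace ℝ (Fin n)) {r : ℝ} (hr : 0 < r) :
    HasDerivAt (fun r => heatFun r (fun y => φ (s + r, y)) x)
      (heatFun r (fun y => backHeat φ (s + r, y)) x) r := by
  obtain ⟨C, hC⟩ := (hc.fderiv ℝ).exists_bound_of_continuous
    (hφ.continuous_fderiv (by simp))
  have hC0 : 0 ≤ C := (norm_nonneg _).trans (hC 0)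
  have hcurve : ∀ v : EuclideanSpace ℝ (Fin n), ∀ ρ : ℝ, 0 < ρ →
      HasDerivAt (fun ρ => φ (s + ρ, x + √ρ • v))
        (fderiv ℝ φ (s + ρ, x + √ρ • v) (1, (2 * √ρ)⁻¹ • v)) ρ := by
    intro v ρ hρ
    have h1 : HasDerivAt (fun ρ : ℝ => (s + ρ, x + √ρ • v)) (1, (2 * √ρ)⁻¹ • v) ρ := by
      refine ((hasDerivAt_id ρ).const_add s).prodMk ?_
      have := ((Real.hasDerivAt_sqrt hρ.ne').smul_const v).const_add x
      simpa using this
    exact ((hφ.differentiable (by simp)) _).hasFDerivAt.comp_hasDerivAt ρ h1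
  have hD := hasDerivAt_integral_of_dominated_loc_of_deriv_le (μ := gaussMeasure n)
    (F := fun ρ v => φ (s + ρ, x + √ρ • v))
    (F' := fun ρ v => fderiv ℝ φ (s + ρ, x + √ρ • v) (1, (2 * √ρ)⁻¹ • v))
    (bound := fun v => C * (1 + (2 * √(r / 2))⁻¹ * ‖v‖)) (x₀ := r) (s := Ioi (r / 2))
    (Ioi_mem_nhds (by linarith))
    (Eventually.of_forall fun ρ => (hφ.continuous.comp (by fun_prop)).aestronglyMeasurable) ?_ ?_ ?_
    ?_ ?_
  · have hval : heatFun r (fun y => backHeat φ (s + r, y)) x =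
        ∫ v, fderiv ℝ φ (s + r, x + √r • v) (1, (2 * √r)⁻¹ • v) ∂gaussMeasure n := ?_
    · rw [hval]; exact hD.2
    have hsplit : ∀ v : EuclideanSpace ℝ (Fin n),
        fderiv ℝ φ (s + r, x + √r • v) (1, (2 * √r)⁻¹ • v) =
          fderiv ℝ φ (s + r, x + √r • v) (1, 0) +
          (2 * √r)⁻¹ * fderiv ℝ (fun y => φ (s + r, y)) (x + √r • v) v := by
      intro v
      rw [fderiv_slice hφ]
      have h1 : ((1 : ℝ), (2 * √r)⁻¹ • v) = (1, 0) + (2 * √r)⁻¹ • ((0 : ℝ), v) := by simp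
      rw [h1, map_add, map_smul, smul_eq_mul]
    have hi1 : Integrable (fun v => fderiv ℝ φ (s + r, x + √r • v) (1, 0)) (gaussMeasure n) := by
      refine Integrable.mono' (integrable_const (C * ‖((1 : ℝ), (0 : EuclideanSpace ℝ (Fin n)))‖))
        ((contDiff_fderiv_apply hφ (1, 0)).continuous.comp
          (by fun_prop : Continuous fun v : EuclideanSpace ℝ (Fin n) =>
            (s + r, x + √r • v))).aestronglyMeasurable
        (Eventually.of_forall fun v => ?_)
      exact (ContinuousLinearMap.le_opNorm _ _).trans
        (mul_le_mul_of_nonneg_right (hC _) (norm_nonneg _))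
    have hi2 := hD.1.sub hi1
    simp_rw [hsplit] at hi2 ⊢
    have hi3 : Integrable (fun v => (2 * √r)⁻¹ *
        fderiv ℝ (fun y => φ (s + r, y)) (x + √r • v) v) (gaussMeasure n) := by
      refine hi2.congr (Eventually.of_forall fun v => ?_)
      simp
    rw [integral_add hi1 hi3, integral_fderiv_gauss_eq_heatFun_laplacian
      (contDiff_slice hφ _) (hasCompactSupport_slice hc _) hr]
    have hlap : Integrable (fun v => Laplacian.laplacian (fun y => φ (s + r, y)) (x + √r • v))
        (gaussMeasure n) := by
      obtain ⟨B, hB⟩ := (hasCompactSupport_backHeat hφ hc).exists_bound_of_continuous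
        (contDiff_backHeat hφ).continuous
      have h1 : Integrable (fun v => backHeat φ (s + r, x + √r • v)) (gaussMeasure n) :=
        Integrable.mono' (integrable_const B)
          ((contDiff_backHeat hφ).continuous.comp (by fun_prop)).aestronglyMeasurable
          (Eventually.of_forall fun v => hB _)
      refine (h1.sub hi1).congr (Eventually.of_forall fun v => ?_)
      simp [backHeat, deriv_slice hφ]
    rw [heatFun, heatFun, ← integral_add hi1 hlap]
    congr 1; ext v
    simp only [backHeat, deriv_slice hφ]
  · obtain ⟨B, hB⟩ := hc.exists_bound_of_continuous hφ.continuous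
    exact Integrable.mono' (integrable_const B)
      (hφ.continuous.comp (by fun_prop)).aestronglyMeasurable (Eventually.of_forall fun v => hB _)
  · have : Continuous fun v : EuclideanSpace ℝ (Fin n) =>
        fderiv ℝ φ (s + r, x + √r • v) (1, (2 * √r)⁻¹ • v) :=
      ((hφ.continuous_fderiv (by simp)).comp (by fun_prop)).clm_apply (by fun_prop)
    exact this.aestronglyMeasurable
  · refine Eventually.of_forall fun v ρ hρ => ?_
    refine (ContinuousLinearMap.le_opNorm _ _).trans
      (mul_le_mul (hC _) ?_ (norm_nonneg _) hC0)
    have hr2 : (0 : ℝ) < r / 2 := by positivity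
    have h1 : (2 * √ρ)⁻¹ ≤ (2 * √(r / 2))⁻¹ := by
      have : 0 < √(r / 2) := Real.sqrt_pos.2 hr2
      have := Real.sqrt_le_sqrt (le_of_lt (mem_Ioi.1 hρ))
      gcongr
    rw [Prod.norm_def]
    refine max_le ?_ ?_
    · simp only [norm_one]
      have : 0 ≤ (2 * √(r / 2))⁻¹ * ‖v‖ := by positivity
      linarith
    · simp only [norm_smul, Real.norm_eq_abs, abs_of_nonneg (show 0 ≤ (2 * √ρ)⁻¹ by positivity)]
      have := mul_le_mul_of_nonneg_right h1 (norm_nonneg v)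
      linarith
  · exact ((integrable_const (1 : ℝ)).add (integrable_norm_gauss.const_mul _)).const_mul C
  · refine Eventually.of_forall fun v ρ hρ => hcurve v ρ ?_
    exact lt_trans (by positivity) (mem_Ioi.1 hρ)

/-- Duhamel's formula for a test function against the heat flow of `z`. -/
lemma integral_heatLp_mul_test {p q : ℝ≥0∞} [Fact (1 ≤ p)] [Fact (p ≠ ∞)] [p.HolderConjugate q]
    (hφ : ContDiff ℝ (⊤ : ℕ∞) φ) (hc : HasCompactSupport φ) (z : LpE n p) (s : ℝ) {τ : ℝ}
    (hτ : 0 ≤ τ) :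
    (∫ x, heatLp τ z x * φ (s + τ, x)) - ∫ x, z x * φ (s, x) =
      ∫ r in 0..τ, ∫ x, heatLp r z x * backHeat φ (s + r, x) := by
  have hΦ := (contDiff_backHeat hφ).continuous
  have hΦc := hasCompactSupport_backHeat hφ hc
  have hq : 1 ≤ q := (ENNReal.HolderConjugate.symm (p := p) (q := q)).one_le
  obtain ⟨B, hB0, hB⟩ := exists_slice_bound hΦ hΦc q
  obtain ⟨B', hB0', hB'⟩ := exists_slice_bound hφ.continuous hc q
  have hsm : ∀ t, Measurable fun x => φ (t, x) := fun t =>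
    (contDiff_slice hφ t).continuous.measurable
  have hsm' : ∀ t, Measurable fun x => backHeat φ (t, x) := fun t =>
    (contDiff_slice (contDiff_backHeat hφ) t).continuous.measurable
  have hmemH : ∀ {ψ : EuclideanSpace ℝ (Fin n) → ℝ} (r : ℝ), Measurable ψ → MemLp ψ q volume →
      MemLp (heatFun r ψ) q volume := fun r h1 h2 =>
    ⟨(measurable_heatFun r h1).aestronglyMeasurable, (eLpNorm_heatFun_le r h1 hq).trans_lt h2.2⟩
  have hR := continuous_heatFun_slice hΦ hΦc s
  have hQ := continuous_heatFun_slice hφ.continuous hc s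
  have hpt : ∀ x, heatFun τ (fun y => φ (s + τ, y)) x - φ (s, x) =
      ∫ r in 0..τ, heatFun r (fun y => backHeat φ (s + r, y)) x := by
    intro x
    rw [intervalIntegral.integral_eq_sub_of_hasDerivAt_of_le hτ
      (f := fun r => heatFun r (fun y => φ (s + r, y)) x)]
    · simp [heatFun]
    · exact (hQ.comp (by fun_prop : Continuous fun r : ℝ => (r, x))).continuousOn
    · intro r hr
      exact hasDerivAt_heatFun_slice hφ hc s x hr.1
    · exact (hR.comp (by fun_prop : Continuous fun r : ℝ => (r, x))).intervalIntegrable _ _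
  rw [integral_heatLp_mul q τ z (hsm _) (hB' _).1,
    ← integral_sub (integrable_coe_mul q z (hmemH τ (hsm _) (hB' _).1))
      (integrable_coe_mul q z (hB' s).1)]
  simp_rw [← mul_sub, hpt, integral_heatLp_mul q _ z (hsm' _) (hB _).1,
    intervalIntegral.integral_of_le hτ, ← integral_const_mul]
  rw [integral_integral_swap]
  have hae : AEStronglyMeasurable (fun r : ℝ × EuclideanSpace ℝ (Fin n) =>
      z r.2 * heatFun r.1 (fun y => backHeat φ (s + r.1, y)) r.2)
      ((volume.restrict (Ioc 0 τ)).prod volume) :=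
    (Lp.aestronglyMeasurable z).comp_snd.mul hR.aestronglyMeasurable
  have hint : Integrable (fun r : ℝ × EuclideanSpace ℝ (Fin n) =>
      z r.2 * heatFun r.1 (fun y => backHeat φ (s + r.1, y)) r.2)
      ((volume.restrict (Ioc 0 τ)).prod volume) := by
    rw [integrable_prod_iff hae]
    refine ⟨Eventually.of_forall fun r =>
      integrable_coe_mul q z (hmemH r (hsm' (s + r)) (hB (s + r)).1), ?_⟩
    refine Integrable.mono' (integrable_const (‖z‖ * B)) hae.norm.integral_prod_right'
      (Eventually.of_forall fun r => ?_)
    rw [Real.norm_eq_abs, abs_of_nonneg (integral_nonneg fun _ => norm_nonneg _)]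
    have h1 : (eLpNorm (heatFun r fun y => backHeat φ (s + r, y)) q volume).toReal ≤ B :=
      (ENNReal.toReal_mono (hB (s + r)).1.2.ne
        (eLpNorm_heatFun_le r (hsm' (s + r)) hq)).trans (hB (s + r)).2
    exact (integral_norm_mul_le q z (hmemH r (hsm' (s + r)) (hB (s + r)).1)).trans
      (mul_le_mul_of_nonneg_left h1 (norm_nonneg _))
  exact hint.swap

end TestFunctions

section PotentialTerm

open Filter Topology

variable {n : ℕ} {σ γ : ℝ≥0∞}

/-- The potential term, controlled by the `L^1` and `L^∞` norms of the remaining factors. -/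
lemma lintegral_potential_le [hσ : Fact (1 ≤ σ)] (hσ' : σ ≠ ∞) (b : LpE n σ)
    {g : EuclideanSpace ℝ (Fin n) → ℝ} (hg : AEStronglyMeasurable g volume) {X Y : ℝ}
    (hX : 0 ≤ X) (hY : 0 ≤ Y) (h1 : eLpNorm g 1 volume ≤ ENNReal.ofReal X)
    (h2 : eLpNorm g ∞ volume ≤ ENNReal.ofReal (X * Y)) :
    ∫⁻ x, ‖b x * g x‖ₑ ≤ ENNReal.ofReal (‖b‖ * (X * Y ^ σ.toReal⁻¹)) := by
  have hσ1 : 1 ≤ σ.toReal := by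
    rw [← ENNReal.toReal_one]; exact ENNReal.toReal_mono hσ' hσ.out
  have hi0 : 0 < σ.toReal⁻¹ := by positivity
  have hi1 : 0 ≤ 1 - σ.toReal⁻¹ := sub_nonneg.2 (inv_le_one_of_one_le₀ hσ1)
  refine (lintegral_enorm_mul_le (Lp.aestronglyMeasurable b) hg hσ.out).trans ?_
  have hb : eLpNorm b σ volume = ENNReal.ofReal ‖b‖ := by
    rw [Lp.norm_def, ENNReal.ofReal_toReal (Lp.eLpNorm_ne_top b)]
  have hprod : X ^ (1 - σ.toReal⁻¹) * (X * Y) ^ σ.toReal⁻¹ = X * Y ^ σ.toReal⁻¹ := by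
    rw [Real.mul_rpow hX hY, ← mul_assoc]
    congr 1
    rcases hX.eq_or_lt with h | h
    · rw [← h, Real.zero_rpow hi0.ne', mul_zero]
    · rw [← Real.rpow_add h]; simp
  rw [hb, ENNReal.ofReal_mul (norm_nonneg _), ← hprod, ENNReal.ofReal_mul (by positivity),
    ← ENNReal.ofReal_rpow_of_nonneg hX hi1,
    ← ENNReal.ofReal_rpow_of_nonneg (by positivity) hi0.le]
  gcongr

lemma abs_integral_le_of_lintegral_enorm_le {f : EuclideanSpace ℝ (Fin n) → ℝ} {c : ℝ} (hc : 0 ≤ c)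
    (h : ∫⁻ x, ‖f x‖ₑ ≤ ENNReal.ofReal c) : |∫ x, f x| ≤ c := by
  have h1 := (enorm_integral_le_lintegral_enorm f).trans h
  rw [Real.enorm_eq_ofReal_abs] at h1
  exact (ENNReal.ofReal_le_ofReal_iff hc).1 h1

/-- Interpolating two decay rates. -/
lemma rpow_mul_rpow_rpow_le {s τ N σr γr : ℝ} (hs : 0 < s) (hτ : 0 < τ)
    (hγ : 1 ≤ γr) :
    (s ^ (-(N / (2 * γr))) * τ ^ (-(N / 2 * (1 - γr⁻¹)))) ^ σr⁻¹ ≤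
      s ^ (-(N / (2 * σr))) + τ ^ (-(N / (2 * σr))) := by
  set S := s ^ (-(N / (2 * σr))) + τ ^ (-(N / (2 * σr))) with hS
  have hs1 : 0 < s ^ (-(N / (2 * σr))) := Real.rpow_pos_of_pos hs _
  have hτ1 : 0 < τ ^ (-(N / (2 * σr))) := Real.rpow_pos_of_pos hτ _
  have hS0 : 0 < S := by positivity
  have hi0 : 0 ≤ γr⁻¹ := by positivity
  have hi1 : 0 ≤ 1 - γr⁻¹ := sub_nonneg.2 (inv_le_one_of_one_le₀ hγ)
  have e1 : (s ^ (-(N / (2 * γr))) * τ ^ (-(N / 2 * (1 - γr⁻¹)))) ^ σr⁻¹ =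
      (s ^ (-(N / (2 * σr)))) ^ γr⁻¹ * (τ ^ (-(N / (2 * σr)))) ^ (1 - γr⁻¹) := by
    rw [Real.mul_rpow (by positivity) (by positivity), ← Real.rpow_mul hs.le, ← Real.rpow_mul hτ.le,
      ← Real.rpow_mul hs.le, ← Real.rpow_mul hτ.le]
    congr 2 <;> simp only [div_eq_mul_inv, mul_inv] <;> ring
  calc _ = (s ^ (-(N / (2 * σr)))) ^ γr⁻¹ * (τ ^ (-(N / (2 * σr)))) ^ (1 - γr⁻¹) := e1
    _ ≤ S ^ γr⁻¹ * S ^ (1 - γr⁻¹) := by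
        gcongr
        · linarith
        · linarith
    _ = S := by rw [← Real.rpow_add hS0]; simp

lemma eLpNorm_mul_one_le (γ' : ℝ≥0∞) [γ.HolderConjugate γ'] {u v : EuclideanSpace ℝ (Fin n) → ℝ}
    (hu : AEStronglyMeasurable u volume) (hv : AEStronglyMeasurable v volume) {A V : ℝ}
    (hA : 0 ≤ A) (h1 : eLpNorm u γ volume ≤ ENNReal.ofReal A)
    (h2 : eLpNorm v γ' volume ≤ ENNReal.ofReal V) :
    eLpNorm (fun x => u x * v x) 1 volume ≤ ENNReal.ofReal (A * V) := by
  refine (eLpNorm_smul_le_mul_eLpNorm (p := γ) (q := γ') (r := 1) hv hu).trans ?_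
  rw [ENNReal.ofReal_mul hA]
  gcongr

lemma eLpNorm_mul_top_le {u v : EuclideanSpace ℝ (Fin n) → ℝ}
    (hu : AEStronglyMeasurable u volume) (hv : AEStronglyMeasurable v volume) {A V : ℝ}
    (hA : 0 ≤ A) (h1 : eLpNorm u ∞ volume ≤ ENNReal.ofReal A)
    (h2 : eLpNorm v ∞ volume ≤ ENNReal.ofReal V) :
    eLpNorm (fun x => u x * v x) ∞ volume ≤ ENNReal.ofReal (A * V) := by
  refine (eLpNorm_smul_le_mul_eLpNorm (p := ∞) (q := ∞) (r := ∞) hv hu).trans ?_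
  rw [ENNReal.ofReal_mul hA]
  gcongr

variable [hσ : Fact (1 ≤ σ)] [hγ : Fact (1 ≤ γ)]

/-- The potential term tested against the heat flow of a function in the dual space. -/
lemma lintegral_potential_heatFun_le (hσ' : σ ≠ ∞) (hγ' : γ ≠ ∞) (γ' : ℝ≥0∞)
    [hc : γ.HolderConjugate γ'] (b : LpE n σ) (u : LpE n γ) {M s τ : ℝ} (hM : 0 ≤ M) (hs : 0 < s)
    (hτ : 0 < τ) (hu : ‖u‖ ≤ M)
    (hu' : eLpNorm u ∞ volume ≤ ENNReal.ofReal (M * s ^ (-((n : ℝ) / (2 * γ.toReal)))))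
    {ψ : EuclideanSpace ℝ (Fin n) → ℝ} (hψ : Measurable ψ) (hψ' : MemLp ψ γ' volume) :
    ∫⁻ x, ‖b x * (u x * heatFun τ ψ x)‖ₑ ≤ ENNReal.ofReal (‖b‖ *
      (M * (eLpNorm ψ γ' volume).toReal * (s ^ (-((n : ℝ) / (2 * σ.toReal))) +
        τ ^ (-((n : ℝ) / (2 * σ.toReal)))))) := by
  have hγ1 : 1 ≤ γ.toReal := by
    rw [← ENNReal.toReal_one]; exact ENNReal.toReal_mono hγ' hγ.out
  have hinv := toReal_inv_eq_one_sub γ γ'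
  have h1γ' : 1 ≤ γ' := hc.symm.one_le
  set Ψ := (eLpNorm ψ γ' volume).toReal with hΨ
  have hΨ' : eLpNorm ψ γ' volume = ENNReal.ofReal Ψ := (ENNReal.ofReal_toReal hψ'.2.ne).symm
  have hum := Lp.aestronglyMeasurable u
  have hvm := (measurable_heatFun τ hψ).aestronglyMeasurable (μ := volume)
  have hunorm : eLpNorm u γ volume ≤ ENNReal.ofReal M := by
    rw [← ENNReal.ofReal_toReal (Lp.eLpNorm_ne_top u), ← Lp.norm_def]
    exact ENNReal.ofReal_le_ofReal hu
  set Y := s ^ (-((n : ℝ) / (2 * γ.toReal))) * τ ^ (-((n : ℝ) / 2 * (1 - γ.toReal⁻¹))) with hYdef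
  have hY : 0 ≤ Y := by positivity
  refine (lintegral_potential_le hσ' b (hum.mul hvm) (X := M * Ψ) (Y := Y) (by positivity) hY
    ?_ ?_).trans (ENNReal.ofReal_le_ofReal ?_)
  · refine eLpNorm_mul_one_le γ' hum hvm hM hunorm ?_
    rw [← hΨ']; exact eLpNorm_heatFun_le τ hψ h1γ'
  · have h2 := eLpNorm_top_heatFun_le hτ hψ h1γ'
    rw [hinv, hΨ', ← ENNReal.ofReal_mul (by positivity)] at h2
    have h3 := eLpNorm_mul_top_le hum hvm (by positivity) hu' h2
    refine h3.trans (le_of_eq ?_)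
    rw [hYdef]; ring_nf
  · gcongr
    exact rpow_mul_rpow_rpow_le hs hτ hγ1

/-- The potential term tested against the heat flow of an integrable function. -/
lemma lintegral_potential_heatFun_le_of_one (hσ' : σ ≠ ∞) (hγ' : γ ≠ ∞) (γ' : ℝ≥0∞)
    [hc : γ.HolderConjugate γ'] (b : LpE n σ) (u : LpE n γ) {M s τ : ℝ} (hM : 0 ≤ M) (hs : 0 < s)
    (hτ : 0 < τ) (hu : ‖u‖ ≤ M)
    (hu' : eLpNorm u ∞ volume ≤ ENNReal.ofReal (M * s ^ (-((n : ℝ) / (2 * γ.toReal)))))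
    {ψ : EuclideanSpace ℝ (Fin n) → ℝ} (hψ : Measurable ψ) (hψ' : MemLp ψ 1 volume) :
    ∫⁻ x, ‖b x * (u x * heatFun τ ψ x)‖ₑ ≤ ENNReal.ofReal (‖b‖ *
      (M * (2 ^ ((n : ℝ) / (2 * γ.toReal)) * (s + τ) ^ (-((n : ℝ) / (2 * γ.toReal)))) *
        (eLpNorm ψ 1 volume).toReal * (s ^ (-((n : ℝ) / (2 * σ.toReal))) +
        τ ^ (-((n : ℝ) / (2 * σ.toReal)))))) := by
  have hγ1 : 1 ≤ γ.toReal := by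
    rw [← ENNReal.toReal_one]; exact ENNReal.toReal_mono hγ' hγ.out
  have hinv := toReal_inv_eq_one_sub γ γ'
  have h1γ' : 1 ≤ γ' := hc.symm.one_le
  set κ := (n : ℝ) / (2 * γ.toReal) with hκ
  have hκ0 : 0 ≤ κ := by positivity
  set Ψ := (eLpNorm ψ 1 volume).toReal with hΨ
  have hΨ' : eLpNorm ψ 1 volume = ENNReal.ofReal Ψ := (ENNReal.ofReal_toReal hψ'.2.ne).symm
  have hum := Lp.aestronglyMeasurable u
  have hvm := (measurable_heatFun τ hψ).aestronglyMeasurable (μ := volume)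
  have hunorm : eLpNorm u γ volume ≤ ENNReal.ofReal M := by
    rw [← ENNReal.ofReal_toReal (Lp.eLpNorm_ne_top u), ← Lp.norm_def]
    exact ENNReal.ofReal_le_ofReal hu
  have htop : eLpNorm (heatFun τ ψ) ∞ volume ≤ ENNReal.ofReal (τ ^ (-((n : ℝ) / 2)) * Ψ) := by
    have h2 := eLpNorm_top_heatFun_le hτ hψ (p := 1) le_rfl
    rw [hΨ', ← ENNReal.ofReal_mul (by positivity)] at h2
    simpa using h2
  have hmax : ∀ r, 0 < r → (s + τ) / 2 ≤ r → r ^ (-κ) ≤ 2 ^ κ * (s + τ) ^ (-κ) := by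
    intro r hr hle
    calc r ^ (-κ) ≤ ((s + τ) / 2) ^ (-κ) :=
          Real.rpow_le_rpow_of_nonpos (by positivity) hle (by linarith)
      _ = 2 ^ κ * (s + τ) ^ (-κ) := by
          rw [Real.div_rpow (by positivity) (by norm_num), Real.rpow_neg (by norm_num : (0:ℝ) ≤ 2)]
          field_simp
  rcases le_total s τ with hle | hle
  · set Y := s ^ (-κ) * τ ^ (-((n : ℝ) / 2 * (1 - γ.toReal⁻¹))) with hYdef
    have hY : 0 ≤ Y := by positivity
    refine (lintegral_potential_le hσ' b (hum.mul hvm) (X := M * (τ ^ (-κ) * Ψ)) (Y := Y)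
      (by positivity) hY ?_ ?_).trans (ENNReal.ofReal_le_ofReal ?_)
    · refine eLpNorm_mul_one_le γ' hum hvm hM hunorm ?_
      have h2 := eLpNorm_heatFun_le_of_one hτ hψ h1γ'
      rw [hΨ', ← ENNReal.ofReal_mul (by positivity), hinv] at h2
      convert h2 using 4
      rw [hκ]; field_simp; ring
    · refine (eLpNorm_mul_top_le hum hvm (by positivity) hu' htop).trans (le_of_eq ?_)
      congr 1
      have : τ ^ (-((n : ℝ) / 2)) = τ ^ (-κ) * τ ^ (-((n : ℝ) / 2 * (1 - γ.toReal⁻¹))) := by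
        rw [← Real.rpow_add hτ]
        congr 1
        rw [hκ]; field_simp; ring
      rw [this, hYdef]; ring
    · have h5 := hmax τ hτ (by linarith)
      have h6 := rpow_mul_rpow_rpow_le (N := n) (σr := σ.toReal) hs hτ hγ1
      rw [← mul_assoc M (τ ^ (-κ)) Ψ]
      gcongr
  · set Y := τ ^ (-((n : ℝ) / 2)) with hYdef
    have hY : 0 ≤ Y := by positivity
    refine (lintegral_potential_le hσ' b (hum.mul hvm) (X := M * s ^ (-κ) * Ψ) (Y := Y)
      (by positivity) hY ?_ ?_).trans (ENNReal.ofReal_le_ofReal ?_)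
    · refine (eLpNorm_smul_le_mul_eLpNorm (p := ∞) (q := 1) (r := 1) hvm hum).trans ?_
      rw [ENNReal.ofReal_mul (by positivity)]
      gcongr
      rw [← hΨ']; exact eLpNorm_heatFun_le τ hψ le_rfl
    · refine (eLpNorm_mul_top_le hum hvm (by positivity) hu' htop).trans (le_of_eq ?_)
      rw [hYdef]; ring_nf
    · have h5 := hmax s hs (by linarith)
      have h6 : Y ^ σ.toReal⁻¹ ≤ s ^ (-((n : ℝ) / (2 * σ.toReal))) +
          τ ^ (-((n : ℝ) / (2 * σ.toReal))) := by
        rw [hYdef, ← Real.rpow_mul hτ.le]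
        have : -((n : ℝ) / 2) * σ.toReal⁻¹ = -((n : ℝ) / (2 * σ.toReal)) := by
          rw [div_eq_mul_inv, div_eq_mul_inv, mul_inv]; ring
        rw [this]
        have : 0 ≤ s ^ (-((n : ℝ) / (2 * σ.toReal))) := by positivity
        linarith
      gcongr

end PotentialTerm

/-- Growth and smoothing bounds of heat type on `(0,T]`, with an exponential weight. -/
def HeatBound {n : ℕ} {γ : ℝ≥0∞} (T M l : ℝ) (u : ℝ → LpE n γ) : Prop :=
  ∀ t ∈ Ioc 0 T, ‖u t‖ ≤ M * Real.exp (l * t) ∧ eLpNorm (u t) ∞ volume ≤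
    ENNReal.ofReal (M * Real.exp (l * t) * t ^ (-((n : ℝ) / (2 * γ.toReal))))

/-- The singular kernel of the Duhamel integral. -/
noncomputable def duhamelKernel (θ t s : ℝ) : ℝ := s ^ (-θ) + (t - s) ^ (-θ)

/-- A weighted bound of the Duhamel integral of a potential of size `h`. -/
def KernelBound (θ l T K : ℝ) (h : ℝ → ℝ) : Prop :=
  ∀ t ∈ Ioc 0 T, IntegrableOn (fun s => h s * Real.exp (l * s) * duhamelKernel θ t s) (Ioo 0 t) ∧
    ∫ s in Ioo 0 t, h s * Real.exp (l * s) * duhamelKernel θ t s ≤ K * Real.exp (l * t)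

section MainEstimate

open Filter Topology

variable {n : ℕ} {σ γ : ℝ≥0∞} [hσ : Fact (1 ≤ σ)] [hγ : Fact (1 ≤ γ)]

lemma memLp_of_test {ψ : EuclideanSpace ℝ (Fin n) → ℝ} (hψ : ContDiff ℝ (⊤ : ℕ∞) ψ)
    (hc : HasCompactSupport ψ) (q : ℝ≥0∞) : MemLp ψ q volume :=
  hψ.continuous.memLp_of_hasCompactSupport hc

/-- The main a priori estimate: bounds for a function given by a Duhamel formula. -/
lemma heatBound_of_duhamel (hσ' : σ ≠ ∞) (hγ' : γ ≠ ∞) {T l : ℝ} (hl : 0 ≤ l)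
    {f : LpE n γ} {b₁ b₂ : ℝ → LpE n σ} {u₁ u₂ v : ℝ → LpE n γ} {h₁ h₂ : ℝ → ℝ}
    {M₁ M₂ K₁ K₂ : ℝ} (hM₁ : 0 ≤ M₁) (hM₂ : 0 ≤ M₂) (hK₁0 : 0 ≤ K₁) (hK₂0 : 0 ≤ K₂)
    (hu₁ : HeatBound T M₁ l u₁)
    (hu₂ : HeatBound T M₂ l u₂)
    (hb₁ : ∀ᵐ s ∂(volume.restrict (Ioo 0 T)), ‖b₁ s‖ ≤ h₁ s)
    (hb₂ : ∀ᵐ s ∂(volume.restrict (Ioo 0 T)), ‖b₂ s‖ ≤ h₂ s)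
    (hK₁ : KernelBound ((n : ℝ) / (2 * σ.toReal)) l T K₁ h₁)
    (hK₂ : KernelBound ((n : ℝ) / (2 * σ.toReal)) l T K₂ h₂)
    (hv : ∀ t ∈ Ioc 0 T, ∀ ψ : EuclideanSpace ℝ (Fin n) → ℝ, ContDiff ℝ (⊤ : ℕ∞) ψ →
      HasCompactSupport ψ → ∃ F : ℝ → ℝ,
        |∫ x, v t x * ψ x| ≤ |∫ x, f x * heatFun t ψ x| + |∫ s in Ioo 0 t, F s| ∧
        ∀ᵐ s ∂(volume.restrict (Ioo 0 t)), |F s| ≤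
          |∫ x, b₁ s x * (u₁ s x * heatFun (t - s) ψ x)| +
          |∫ x, b₂ s x * (u₂ s x * heatFun (t - s) ψ x)|) :
    HeatBound T (2 ^ ((n : ℝ) / (2 * γ.toReal)) * (‖f‖ + K₁ * M₁ + K₂ * M₂)) l v := by
  intro t ht
  have : γ.HolderConjugate (ENNReal.conjExponent γ) := .conjExponent hγ.out
  set γ' := ENNReal.conjExponent γ with hγ'def
  have h1γ' : 1 ≤ γ' := (ENNReal.HolderConjugate.symm (p := γ)).one_le
  set κ := (n : ℝ) / (2 * γ.toReal) with hκ
  set θ := (n : ℝ) / (2 * σ.toReal) with hθ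
  have hκ0 : 0 ≤ κ := by positivity
  have hC1 : (1 : ℝ) ≤ 2 ^ κ := Real.one_le_rpow (by norm_num) hκ0
  have ht0 : 0 < t := ht.1
  have hexp : 1 ≤ Real.exp (l * t) := Real.one_le_exp (by positivity)
  set W := (‖f‖ + K₁ * M₁ + K₂ * M₂) * Real.exp (l * t) with hW
  have hW0 : 0 ≤ W := by positivity
  -- a bound of the integrals by a common kernel yields a bound of the pairing
  have hcore : ∀ (Z : ℝ), 0 ≤ Z → ∀ ψ : EuclideanSpace ℝ (Fin n) → ℝ, ContDiff ℝ (⊤ : ℕ∞) ψ →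
      HasCompactSupport ψ → |∫ x, f x * heatFun t ψ x| ≤ ‖f‖ * Z →
      (∀ (b : LpE n σ) (u : LpE n γ) (M s : ℝ), 0 ≤ M → s ∈ Ioo 0 t → ‖u‖ ≤ M →
        eLpNorm u ∞ volume ≤ ENNReal.ofReal (M * s ^ (-κ)) →
        |∫ x, b x * (u x * heatFun (t - s) ψ x)| ≤ ‖b‖ * (M * Z * duhamelKernel θ t s)) →
      |∫ x, v t x * ψ x| ≤ W * Z := by
    intro Z hZ ψ hψ hψc hf hbu
    obtain ⟨F, hF1, hF2⟩ := hv t ht ψ hψ hψc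
    have hsub : Ioo 0 t ⊆ Ioo 0 T := Ioo_subset_Ioo_right ht.2
    have hb₁' := ae_restrict_of_ae_restrict_of_subset hsub hb₁
    have hb₂' := ae_restrict_of_ae_restrict_of_subset hsub hb₂
    have hint := (((hK₁ t ht).1.const_mul (M₁ * Z)).add ((hK₂ t ht).1.const_mul (M₂ * Z)))
    have hFb : |∫ s in Ioo 0 t, F s| ≤
        ∫ s in Ioo 0 t, (M₁ * Z * (h₁ s * Real.exp (l * s) * duhamelKernel θ t s) +
          M₂ * Z * (h₂ s * Real.exp (l * s) * duhamelKernel θ t s)) := by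
      rw [← Real.norm_eq_abs]
      refine norm_integral_le_of_norm_le hint ?_
      filter_upwards [hF2, hb₁', hb₂', ae_restrict_mem measurableSet_Ioo] with s hs h1 h2 hs'
      have hsT : s ∈ Ioc 0 T := ⟨hs'.1, hs'.2.le.trans ht.2⟩
      have hker : 0 ≤ duhamelKernel θ t s := by
        have := hs'.1; have := sub_pos.2 hs'.2
        unfold duhamelKernel; positivity
      have e1 := hbu (b₁ s) (u₁ s) (M₁ * Real.exp (l * s)) s (by positivity) hs'
        (hu₁ s hsT).1 (hu₁ s hsT).2
      have e2 := hbu (b₂ s) (u₂ s) (M₂ * Real.exp (l * s)) s (by positivity) hs'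
        (hu₂ s hsT).1 (hu₂ s hsT).2
      have e3 : ‖b₁ s‖ * (M₁ * Real.exp (l * s) * Z * duhamelKernel θ t s) ≤
          h₁ s * (M₁ * Real.exp (l * s) * Z * duhamelKernel θ t s) :=
        mul_le_mul_of_nonneg_right h1 (by positivity)
      have e4 : ‖b₂ s‖ * (M₂ * Real.exp (l * s) * Z * duhamelKernel θ t s) ≤
          h₂ s * (M₂ * Real.exp (l * s) * Z * duhamelKernel θ t s) :=
        mul_le_mul_of_nonneg_right h2 (by positivity)
      rw [Real.norm_eq_abs]
      calc |F s| ≤ _ := hs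
        _ ≤ h₁ s * (M₁ * Real.exp (l * s) * Z * duhamelKernel θ t s) +
            h₂ s * (M₂ * Real.exp (l * s) * Z * duhamelKernel θ t s) :=
          add_le_add (e1.trans e3) (e2.trans e4)
        _ = _ := by ring
    rw [integral_add ((hK₁ t ht).1.const_mul (M₁ * Z)) ((hK₂ t ht).1.const_mul (M₂ * Z)),
      integral_const_mul, integral_const_mul] at hFb
    have e5 := mul_le_mul_of_nonneg_left (hK₁ t ht).2 (show 0 ≤ M₁ * Z by positivity)
    have e6 := mul_le_mul_of_nonneg_left (hK₂ t ht).2 (show 0 ≤ M₂ * Z by positivity)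
    have e7 : ‖f‖ * Z ≤ ‖f‖ * Real.exp (l * t) * Z := by
      have := mul_le_mul_of_nonneg_left hexp (show 0 ≤ ‖f‖ * Z by positivity)
      linarith
    calc |∫ x, v t x * ψ x| ≤ _ := hF1
      _ ≤ ‖f‖ * Real.exp (l * t) * Z + (M₁ * Z * (K₁ * Real.exp (l * t)) +
          M₂ * Z * (K₂ * Real.exp (l * t))) := by
        linarith
      _ = W * Z := by rw [hW]; ring
  have hmeas : ∀ {ψ : EuclideanSpace ℝ (Fin n) → ℝ}, ContDiff ℝ (⊤ : ℕ∞) ψ → Measurable ψ :=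
    fun h => h.continuous.measurable
  have hsm := Lp.stronglyMeasurable (v t)
  constructor
  · have hest : eLpNorm (v t) γ volume ≤ ENNReal.ofReal W := by
      refine eLpNorm_le_of_forall_test (q := γ') hγ' hsm.measurable (locallyIntegrable_coe (v t)) hW0
        fun ψ hψ hψc => ?_
      have hmem := memLp_of_test hψ hψc γ'
      refine hcore _ ENNReal.toReal_nonneg ψ hψ hψc ?_ ?_
      · have hmem' : MemLp (heatFun t ψ) γ' volume :=
          ⟨(measurable_heatFun t (hmeas hψ)).aestronglyMeasurable,
            (eLpNorm_heatFun_le t (hmeas hψ) h1γ').trans_lt hmem.2⟩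
        refine (abs_integral_mul_le γ' f hmem').trans (mul_le_mul_of_nonneg_left ?_ (norm_nonneg _))
        exact ENNReal.toReal_mono hmem.2.ne (eLpNorm_heatFun_le t (hmeas hψ) h1γ')
      · intro b u M s hM hs hu hu'
        have hs0 := hs.1
        have hτ : 0 < t - s := sub_pos.2 hs.2
        rw [duhamelKernel]
        refine abs_integral_le_of_lintegral_enorm_le ?_
          (lintegral_potential_heatFun_le hσ' hγ' γ' b u hM hs.1 (sub_pos.2 hs.2) hu hu'
            (hmeas hψ) hmem)
        positivity
    have h2 : ‖v t‖ ≤ W := by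
      rw [Lp.norm_def]; exact ENNReal.toReal_le_of_le_ofReal hW0 hest
    calc ‖v t‖ ≤ W := h2
      _ ≤ 2 ^ κ * W := le_mul_of_one_le_left hW0 hC1
      _ = _ := by rw [hW]; ring
  · have hest : eLpNorm (v t) ∞ volume ≤ ENNReal.ofReal (W * (2 ^ κ * t ^ (-κ))) := by
      refine eLpNorm_top_le_of_forall_test (locallyIntegrable_coe (v t)) (by positivity)
        fun ψ hψ hψc => ?_
      have hmem := memLp_of_test hψ hψc 1
      rw [mul_assoc]
      refine hcore _ (by positivity) ψ hψ hψc ?_ ?_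
      · have h3 := eLpNorm_heatFun_le_of_one ht0 (hmeas hψ) h1γ'
        have hfin := ENNReal.mul_ne_top
          (ENNReal.ofReal_ne_top (r := t ^ (-((n : ℝ) / 2 * (1 - γ'.toReal⁻¹))))) hmem.2.ne
        have hmem' : MemLp (heatFun t ψ) γ' volume :=
          ⟨(measurable_heatFun t (hmeas hψ)).aestronglyMeasurable, h3.trans_lt hfin.lt_top⟩
        refine (abs_integral_mul_le γ' f hmem').trans (mul_le_mul_of_nonneg_left ?_ (norm_nonneg _))
        have h4 := ENNReal.toReal_mono hfin h3
        rw [ENNReal.toReal_mul, ENNReal.toReal_ofReal (by positivity),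
          toReal_inv_eq_one_sub γ γ'] at h4
        refine h4.trans (mul_le_mul_of_nonneg_right ?_ ENNReal.toReal_nonneg)
        have : (n : ℝ) / 2 * (1 - (1 - γ.toReal⁻¹)) = κ := by
          rw [hκ, div_eq_mul_inv, div_eq_mul_inv, mul_inv]; ring
        rw [this]
        exact le_mul_of_one_le_left (by positivity) hC1
      · intro b u M s hM hs hu hu'
        have hs0 := hs.1
        have hτ : 0 < t - s := sub_pos.2 hs.2
        have h5 := lintegral_potential_heatFun_le_of_one hσ' hγ' γ' b u hM hs.1 (sub_pos.2 hs.2)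
          hu hu' (hmeas hψ) hmem
        rw [add_sub_cancel] at h5
        have h6 := abs_integral_le_of_lintegral_enorm_le (by positivity) h5
        refine h6.trans (le_of_eq ?_)
        rw [duhamelKernel]; ring
    refine hest.trans (le_of_eq ?_)
    rw [hW]; ring_nf

end MainEstimate

section KernelBounds

open Filter Topology

lemma integrableOn_reflect {G : ℝ → ℝ} (hG : IntegrableOn G (Ioi 0)) (hG0 : ∀ s, 0 < s → 0 ≤ G s)
    {t : ℝ} (ht : 0 < t) :
    IntegrableOn G (Ioo 0 t) ∧ IntegrableOn (fun s => G (t - s)) (Ioo 0 t) ∧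
      ∫ s in Ioo 0 t, G s ≤ ∫ s in Ioi 0, G s ∧
      ∫ s in Ioo 0 t, G (t - s) ≤ ∫ s in Ioi 0, G s := by
  have hsub : Ioo 0 t ⊆ Ioi 0 := Ioo_subset_Ioi_self
  have h1 : IntegrableOn G (Ioo 0 t) := hG.mono_set hsub
  have hii : IntervalIntegrable G volume 0 t :=
    (intervalIntegrable_iff_integrableOn_Ioo_of_le ht.le).2 h1
  have h2 : IntegrableOn (fun s => G (t - s)) (Ioo 0 t) := by
    rw [← intervalIntegrable_iff_integrableOn_Ioo_of_le ht.le]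
    simpa using (hii.comp_sub_left t).symm
  have h3 : ∫ s in Ioo 0 t, G s ≤ ∫ s in Ioi 0, G s :=
    setIntegral_mono_set hG ((ae_restrict_iff' measurableSet_Ioi).2
      (Eventually.of_forall fun s hs => hG0 s hs)) (Eventually.of_forall hsub)
  refine ⟨h1, h2, h3, ?_⟩
  have h4 : ∫ s in Ioo 0 t, G (t - s) = ∫ s in Ioo 0 t, G s := by
    rw [← integral_Ioc_eq_integral_Ioo, ← integral_Ioc_eq_integral_Ioo,
      ← intervalIntegral.integral_of_le ht.le, ← intervalIntegral.integral_of_le ht.le,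
      intervalIntegral.integral_comp_sub_left]
    simp
  rwa [h4]

lemma integrableOn_exp_mul_duhamelKernel {θ : ℝ} (hθ1 : θ < 1) (l : ℝ) {t : ℝ}
    (ht : 0 < t) :
    IntegrableOn (fun s => Real.exp (l * s) * duhamelKernel θ t s) (Ioo 0 t) := by
  have h1 : IntervalIntegrable (fun s : ℝ => s ^ (-θ)) volume 0 t :=
    intervalIntegral.intervalIntegrable_rpow' (by linarith)
  have h2 : IntervalIntegrable (fun s : ℝ => (t - s) ^ (-θ)) volume 0 t := by
    simpa using (h1.comp_sub_left t).symm
  have h3 := (h1.add h2).continuousOn_mul (g := fun s => Real.exp (l * s))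
    (by fun_prop : Continuous fun s : ℝ => Real.exp (l * s)).continuousOn
  exact (intervalIntegrable_iff_integrableOn_Ioo_of_le ht.le).1 h3

/-- The kernel bound for a potential of constant size. -/
lemma kernelBound_const {θ l L T : ℝ} (hθ0 : 0 ≤ θ) (hθ1 : θ < 1) (hl : 0 < l) (hL : 0 ≤ L) :
    KernelBound θ l T (3 * L * (Real.Gamma (1 - θ) * (1 / l) ^ (1 - θ))) fun _ => L := by
  intro t ht
  have ht0 := ht.1
  have hint := (integrableOn_exp_mul_duhamelKernel hθ1 l ht0).const_mul L
  simp only [← mul_assoc] at hint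
  refine ⟨hint, ?_⟩
  let G : ℝ → ℝ := fun s => s ^ (-θ) * Real.exp (-(l * s))
  have hval : ∫ s in Ioi 0, G s = (1 / l) ^ (1 - θ) * Real.Gamma (1 - θ) := by
    rw [← Real.integral_rpow_mul_exp_neg_mul_Ioi (by linarith) hl]
    simp [G]
  have hG0 : ∀ s, 0 < s → 0 ≤ G s := fun s hs => by positivity
  have hG : IntegrableOn G (Ioi 0) := by
    by_contra h
    have h1 := integral_undef h
    rw [hval] at h1
    have := Real.Gamma_pos_of_pos (show 0 < 1 - θ by linarith)
    have h2 : 0 < (1 / l) ^ (1 - θ) * Real.Gamma (1 - θ) := by positivity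
    linarith
  obtain ⟨i1, i2, i3, i4⟩ := integrableOn_reflect hG hG0 ht0
  have hpt : ∀ s ∈ Ioo 0 t, L * Real.exp (l * s) * duhamelKernel θ t s ≤
      L * Real.exp (l * t) * (2 * G (t - s) + G s) := by
    intro s hs
    have hs0 := hs.1
    have hτ : 0 < t - s := sub_pos.2 hs.2
    have e1 : Real.exp (l * s) = Real.exp (l * t) * Real.exp (-(l * (t - s))) := by
      rw [← Real.exp_add]; ring_nf
    have e2 : Real.exp (-(l * (t - s))) * s ^ (-θ) ≤ G (t - s) + G s := by
      rcases le_total (t - s) s with h | h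
      · have : s ^ (-θ) ≤ (t - s) ^ (-θ) := Real.rpow_le_rpow_of_nonpos hτ h (by linarith)
        have h5 := mul_le_mul_of_nonneg_left this (Real.exp_pos (-(l * (t - s)))).le
        have h6 := hG0 s hs0
        simp only [G] at h6 ⊢
        linarith
      · have : Real.exp (-(l * (t - s))) ≤ Real.exp (-(l * s)) := by
          apply Real.exp_le_exp.2
          nlinarith
        have h5 := mul_le_mul_of_nonneg_right this (Real.rpow_nonneg hs0.le (-θ))
        have h6 := hG0 (t - s) hτ
        simp only [G] at h6 ⊢
        linarith
    rw [e1, duhamelKernel]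
    have e3 : Real.exp (-(l * (t - s))) * (s ^ (-θ) + (t - s) ^ (-θ)) ≤ 2 * G (t - s) + G s := by
      simp only [G] at e2 ⊢
      linarith
    have := mul_le_mul_of_nonneg_left e3 (show 0 ≤ L * Real.exp (l * t) by positivity)
    linarith
  calc ∫ s in Ioo 0 t, L * Real.exp (l * s) * duhamelKernel θ t s
      ≤ ∫ s in Ioo 0 t, L * Real.exp (l * t) * (2 * G (t - s) + G s) :=
        setIntegral_mono_on hint (((i2.const_mul 2).add i1).const_mul _) measurableSet_Ioo hpt
    _ = L * Real.exp (l * t) * (2 * ∫ s in Ioo 0 t, G (t - s)) +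
          L * Real.exp (l * t) * ∫ s in Ioo 0 t, G s := by
        rw [integral_const_mul, integral_add (i2.const_mul 2) i1, integral_const_mul, mul_add]
    _ ≤ L * Real.exp (l * t) * (2 * ∫ s in Ioi 0, G s) +
          L * Real.exp (l * t) * ∫ s in Ioi 0, G s := by gcongr
    _ = _ := by rw [hval]; ring

/-- The kernel bound for a bounded potential of small mean size. -/
lemma kernelBound_of_integral {θ l H T δ : ℝ} (hθ0 : 0 ≤ θ) (hθ1 : θ < 1) (hl : 0 ≤ l)
    (hδ : 0 < δ) (hH0 : 0 ≤ H) {h : ℝ → ℝ} (hm : AEStronglyMeasurable h (volume.restrict (Ioo 0 T)))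
    (h0 : ∀ s, 0 ≤ h s) (hH : ∀ᵐ s ∂(volume.restrict (Ioo 0 T)), h s ≤ H) :
    KernelBound θ l T (2 * (δ ^ (-θ) * (∫ s in Ioo 0 T, h s) + H * (δ ^ (1 - θ) / (1 - θ)))) h := by
  intro t ht
  have ht0 := ht.1
  have hsub : Ioo 0 t ⊆ Ioo 0 T := Ioo_subset_Ioo_right ht.2
  have hH' := ae_restrict_of_ae_restrict_of_subset hsub hH
  have hmt : AEStronglyMeasurable h (volume.restrict (Ioo 0 t)) := hm.mono_set hsub
  have hiT : IntegrableOn h (Ioo 0 T) := by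
    refine Integrable.mono' (integrable_const H) hm ?_
    filter_upwards [hH] with s hs
    rwa [Real.norm_eq_abs, abs_of_nonneg (h0 s)]
  have hker := integrableOn_exp_mul_duhamelKernel hθ1 l ht0
  have hint : IntegrableOn (fun s => h s * Real.exp (l * s) * duhamelKernel θ t s) (Ioo 0 t) := by
    simp only [mul_assoc]
    refine Integrable.bdd_mul (c := H) hker hmt ?_
    filter_upwards [hH'] with s hs
    rwa [Real.norm_eq_abs, abs_of_nonneg (h0 s)]
  refine ⟨hint, ?_⟩
  let G : ℝ → ℝ := (Ioo 0 δ).indicator fun s => s ^ (-θ)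
  have hG1 : IntegrableOn (fun s : ℝ => s ^ (-θ)) (Ioo 0 δ) :=
    (intervalIntegrable_iff_integrableOn_Ioo_of_le hδ.le).1
      (intervalIntegral.intervalIntegrable_rpow' (by linarith))
  have hG : IntegrableOn G (Ioi 0) := (hG1.integrable_indicator measurableSet_Ioo).integrableOn
  have hval : ∫ s in Ioi 0, G s = δ ^ (1 - θ) / (1 - θ) := by
    rw [setIntegral_indicator measurableSet_Ioo, inter_eq_self_of_subset_right Ioo_subset_Ioi_self,
      ← integral_Ioc_eq_integral_Ioo, ← intervalIntegral.integral_of_le hδ.le,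
      integral_rpow (Or.inl (by linarith)), Real.zero_rpow (by linarith)]
    ring_nf
  have hG0 : ∀ s, 0 < s → 0 ≤ G s := fun s hs => indicator_nonneg (fun r hr => by
    have := hr.1; positivity) s
  obtain ⟨i1, i2, i3, i4⟩ := integrableOn_reflect hG hG0 ht0
  have hrp : ∀ s, 0 < s → s ^ (-θ) ≤ δ ^ (-θ) + G s := by
    intro s hs
    rcases lt_or_ge s δ with h | h
    · simp only [G, indicator_of_mem (show s ∈ Ioo 0 δ from ⟨hs, h⟩)]
      have : 0 ≤ δ ^ (-θ) := by positivity
      linarith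
    · have : s ^ (-θ) ≤ δ ^ (-θ) := Real.rpow_le_rpow_of_nonpos hδ h (by linarith)
      linarith [hG0 s hs]
  have hpt : ∀ᵐ s ∂(volume.restrict (Ioo 0 t)), h s * Real.exp (l * s) * duhamelKernel θ t s ≤
      Real.exp (l * t) * (2 * (δ ^ (-θ) * h s) + H * (G s + G (t - s))) := by
    filter_upwards [hH', ae_restrict_mem measurableSet_Ioo] with s hs hs'
    have hs0 := hs'.1
    have hτ : 0 < t - s := sub_pos.2 hs'.2
    have e1 : Real.exp (l * s) ≤ Real.exp (l * t) := by
      apply Real.exp_le_exp.2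
      nlinarith
    have e2 : duhamelKernel θ t s ≤ 2 * δ ^ (-θ) + (G s + G (t - s)) := by
      unfold duhamelKernel
      linarith [hrp s hs0, hrp (t - s) hτ]
    have e3 := hG0 s hs0
    have e4 := hG0 (t - s) hτ
    have e5 := h0 s
    have e6 : 0 ≤ duhamelKernel θ t s := by unfold duhamelKernel; positivity
    calc h s * Real.exp (l * s) * duhamelKernel θ t s
        ≤ h s * Real.exp (l * t) * (2 * δ ^ (-θ) + (G s + G (t - s))) := by gcongr
      _ = Real.exp (l * t) * (2 * (δ ^ (-θ) * h s) + h s * (G s + G (t - s))) := by ring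
      _ ≤ _ := by gcongr
  have j1 := (hiT.mono_set hsub).const_mul (δ ^ (-θ))
  calc ∫ s in Ioo 0 t, h s * Real.exp (l * s) * duhamelKernel θ t s
      ≤ ∫ s in Ioo 0 t, Real.exp (l * t) * (2 * (δ ^ (-θ) * h s) + H * (G s + G (t - s))) :=
        integral_mono_ae hint (((j1.const_mul 2).add ((i1.add i2).const_mul H)).const_mul _) hpt
    _ = Real.exp (l * t) * (2 * (δ ^ (-θ) * ∫ s in Ioo 0 t, h s) +
          H * ((∫ s in Ioo 0 t, G s) + ∫ s in Ioo 0 t, G (t - s))) := by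
        have j2 : Integrable (fun s => H * (G s + G (t - s))) (volume.restrict (Ioo 0 t)) :=
          (i1.add i2).const_mul H
        rw [integral_const_mul, integral_add (j1.const_mul 2) j2,
          integral_const_mul, integral_const_mul, integral_const_mul, integral_add i1 i2]
    _ ≤ Real.exp (l * t) * (2 * (δ ^ (-θ) * ∫ s in Ioo 0 T, h s) +
          H * ((∫ s in Ioi 0, G s) + ∫ s in Ioi 0, G s)) := by
        have : ∫ s in Ioo 0 t, h s ≤ ∫ s in Ioo 0 T, h s :=
          setIntegral_mono_set hiT (Eventually.of_forall h0) (Eventually.of_forall hsub)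
        gcongr
    _ = _ := by rw [hval]; ring

end KernelBounds

/-- Truncation of a real number at level `k`. -/
noncomputable def truncReal (k : ℕ) (x : ℝ) : ℝ := max (-(k : ℝ)) (min k x)

section Truncation

open Filter Topology

variable {n : ℕ} {σ γ : ℝ≥0∞}

lemma lipschitzWith_truncReal (k : ℕ) : LipschitzWith 1 (truncReal k) :=
  (LipschitzWith.id.const_min (k : ℝ)).const_max (-(k : ℝ))

lemma truncReal_zero (k : ℕ) : truncReal k 0 = 0 := by
  have : (0 : ℝ) ≤ k := Nat.cast_nonneg k
  simp [truncReal, this]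

lemma abs_truncReal_le (k : ℕ) (x : ℝ) : |truncReal k x| ≤ k := by
  have : (0 : ℝ) ≤ k := Nat.cast_nonneg k
  rw [abs_le]
  exact ⟨le_max_left _ _, max_le (by linarith) (min_le_left _ _)⟩

lemma abs_truncReal_le_abs (k : ℕ) (x : ℝ) : |truncReal k x| ≤ |x| := by
  have h := (lipschitzWith_truncReal k).dist_le_mul x 0
  simpa [truncReal_zero] using h

lemma truncReal_eq_self {k : ℕ} {x : ℝ} (h : |x| ≤ k) : truncReal k x = x := by
  rw [abs_le] at h
  rw [truncReal, min_eq_right h.2, max_eq_right h.1]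

lemma tendsto_truncReal (x : ℝ) : Tendsto (fun k => truncReal k x) atTop (𝓝 x) := by
  obtain ⟨N, hN⟩ := exists_nat_ge |x|
  refine tendsto_const_nhds.congr' ?_
  filter_upwards [eventually_ge_atTop N] with k hk
  exact (truncReal_eq_self (hN.trans (by exact_mod_cast hk))).symm

/-- Dominated convergence in `L^p`. -/
lemma tendsto_eLpNorm_sub_of_dominated {α : Type*} [MeasurableSpace α] {μ : Measure α} {p : ℝ≥0∞}
    (hp0 : p ≠ 0) (hp : p ≠ ∞) {f : ℕ → α → ℝ} {g F : α → ℝ}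
    (hf : ∀ j, AEStronglyMeasurable (f j) μ) (hg : AEStronglyMeasurable g μ) (hF : MemLp F p μ)
    (hb : ∀ j, ∀ᵐ x ∂μ, |f j x - g x| ≤ |F x|)
    (hlim : ∀ᵐ x ∂μ, Tendsto (fun j => f j x) atTop (𝓝 (g x))) :
    Tendsto (fun j => eLpNorm (f j - g) p μ) atTop (𝓝 0) := by
  have hpr : 0 < p.toReal := ENNReal.toReal_pos hp0 hp
  have h1 : Tendsto (fun j => ∫⁻ x, ‖f j x - g x‖ₑ ^ p.toReal ∂μ) atTop (𝓝 (∫⁻ x, 0 ∂μ)) := by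
    refine tendsto_lintegral_of_dominated_convergence' (fun x => ‖F x‖ₑ ^ p.toReal)
      (fun j => ((hf j).sub hg).enorm.pow_const _) (fun j => ?_) ?_ ?_
    · filter_upwards [hb j] with x hx
      gcongr
      rw [Real.enorm_eq_ofReal_abs, Real.enorm_eq_ofReal_abs]
      exact ENNReal.ofReal_le_ofReal hx
    · exact (lintegral_rpow_enorm_lt_top_of_eLpNorm_lt_top hp0 hp hF.2).ne
    · filter_upwards [hlim] with x hx
      have h2 : Tendsto (fun j => ‖f j x - g x‖ₑ) atTop (𝓝 0) := by
        have := (hx.sub_const (g x)).enorm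
        simpa using this
      have := (ENNReal.continuous_rpow_const (y := p.toReal)).continuousAt.tendsto.comp h2
      simpa [Function.comp_def, ENNReal.zero_rpow_of_pos hpr] using this
  simp only [lintegral_zero] at h1
  have h3 := (ENNReal.continuous_rpow_const (y := 1 / p.toReal)).continuousAt.tendsto.comp h1
  have h4 : (0 : ℝ≥0∞) ^ (1 / p.toReal) = 0 := ENNReal.zero_rpow_of_pos (by positivity)
  rw [h4] at h3
  refine h3.congr fun j => ?_
  rw [eLpNorm_eq_lintegral_rpow_enorm_toReal hp0 hp]
  rfl

/-- Truncation of a function in `L^σ`. -/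
noncomputable def truncLp (k : ℕ) (b : LpE n σ) : LpE n σ :=
  (lipschitzWith_truncReal k).compLp (truncReal_zero k) b

lemma coeFn_truncLp (k : ℕ) (b : LpE n σ) :
    truncLp k b =ᵐ[volume] fun x => truncReal k (b x) :=
  (lipschitzWith_truncReal k).coeFn_compLp (truncReal_zero k) b

lemma norm_truncLp_le (k : ℕ) (b : LpE n σ) : ‖truncLp k b‖ ≤ ‖b‖ := by
  simpa [truncLp] using (lipschitzWith_truncReal k).norm_compLp_le (truncReal_zero k) b

lemma continuous_truncLp [Fact (1 ≤ σ)] (k : ℕ) : Continuous (truncLp (n := n) (σ := σ) k) :=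
  (lipschitzWith_truncReal k).continuous_compLp (truncReal_zero k)

lemma tendsto_truncLp [hσ : Fact (1 ≤ σ)] (hσ' : σ ≠ ∞) (b : LpE n σ) :
    Tendsto (fun k => truncLp k b) atTop (𝓝 b) := by
  rw [Lp.tendsto_Lp_iff_tendsto_eLpNorm']
  have h0 : σ ≠ 0 := (zero_lt_one.trans_le hσ.out).ne'
  refine tendsto_eLpNorm_sub_of_dominated h0 hσ' (F := fun x => 2 * b x)
    (fun k => Lp.aestronglyMeasurable _) (Lp.aestronglyMeasurable _)
    ((Lp.memLp b).const_mul 2) (fun k => ?_) ?_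
  · filter_upwards [coeFn_truncLp k b] with x hx
    rw [hx, abs_mul, abs_two]
    exact (abs_sub _ _).trans (by linarith [abs_truncReal_le_abs k (b x)])
  · filter_upwards [ae_all_iff.2 fun k => coeFn_truncLp k b] with x hx
    simp_rw [hx]
    exact tendsto_truncReal _

lemma memLp_trunc_mul (k : ℕ) (b : LpE n σ) (z : LpE n γ) :
    MemLp (fun x => truncReal k (b x) * z x) γ volume := by
  refine ((Lp.memLp z).const_mul (k : ℝ)).mono ?_ (Eventually.of_forall fun x => ?_)
  · exact ((lipschitzWith_truncReal k).continuous.comp_aestronglyMeasurable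
      (Lp.aestronglyMeasurable b)).mul (Lp.aestronglyMeasurable z)
  · rw [norm_mul, norm_mul, Real.norm_eq_abs, Real.norm_eq_abs, Real.norm_eq_abs, Nat.abs_cast]
    exact mul_le_mul_of_nonneg_right (abs_truncReal_le k _) (abs_nonneg _)

/-- Multiplication of `z ∈ L^γ` by the truncation of `b`. -/
noncomputable def mulTrunc (k : ℕ) (b : LpE n σ) (z : LpE n γ) : LpE n γ :=
  (memLp_trunc_mul k b z).toLp _

lemma coeFn_mulTrunc (k : ℕ) (b : LpE n σ) (z : LpE n γ) :
    mulTrunc k b z =ᵐ[volume] fun x => truncLp k b x * z x := by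
  filter_upwards [(memLp_trunc_mul k b z).coeFn_toLp, coeFn_truncLp k b] with x h1 h2
  rw [mulTrunc, h1, h2]

lemma coeFn_mulTrunc' (k : ℕ) (b : LpE n σ) (z : LpE n γ) :
    mulTrunc k b z =ᵐ[volume] fun x => truncReal k (b x) * z x :=
  (memLp_trunc_mul k b z).coeFn_toLp

lemma norm_mulTrunc_le (k : ℕ) (b : LpE n σ) (z : LpE n γ) : ‖mulTrunc k b z‖ ≤ k * ‖z‖ := by
  refine Lp.norm_le_mul_norm_of_ae_le_mul ?_
  filter_upwards [coeFn_mulTrunc' k b z] with x hx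
  rw [hx, norm_mul]
  exact mul_le_mul_of_nonneg_right (abs_truncReal_le k _) (norm_nonneg _)

lemma mulTrunc_sub (k : ℕ) (b : LpE n σ) (z w : LpE n γ) :
    mulTrunc k b (z - w) = mulTrunc k b z - mulTrunc k b w := by
  refine Lp.ext ?_
  filter_upwards [coeFn_mulTrunc' k b z, coeFn_mulTrunc' k b w, coeFn_mulTrunc' k b (z - w),
    Lp.coeFn_sub z w, Lp.coeFn_sub (mulTrunc k b z) (mulTrunc k b w)] with x h1 h2 h3 h4 h5
  rw [h3, h5, h4, Pi.sub_apply, Pi.sub_apply, h1, h2, mul_sub]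

variable [hσ : Fact (1 ≤ σ)] [hγ : Fact (1 ≤ γ)]

lemma continuous_mulTrunc_left (hγ' : γ ≠ ∞) (k : ℕ) (z : LpE n γ) :
    Continuous fun b : LpE n σ => mulTrunc k b z := by
  have hσ0 : σ ≠ 0 := (zero_lt_one.trans_le hσ.out).ne'
  have hγ0 : γ ≠ 0 := (zero_lt_one.trans_le hγ.out).ne'
  rw [continuous_iff_seqContinuous]
  intro b b₀ hb
  refine tendsto_of_subseq_tendsto fun ns hns => ?_
  obtain ⟨ms, _, hms⟩ := (tendstoInMeasure_of_tendsto_Lp (hb.comp hns)).exists_seq_tendsto_ae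
  refine ⟨ms, ?_⟩
  rw [Lp.tendsto_Lp_iff_tendsto_eLpNorm']
  refine tendsto_eLpNorm_sub_of_dominated hγ0 hγ' (F := fun x => (2 * k : ℝ) * z x)
    (fun k => Lp.aestronglyMeasurable _) (Lp.aestronglyMeasurable _)
    ((Lp.memLp z).const_mul _) (fun j => ?_) ?_
  · filter_upwards [coeFn_mulTrunc' k (b (ns (ms j))) z, coeFn_mulTrunc' k b₀ z] with x h1 h2
    simp only [Function.comp_apply]
    rw [h1, h2, ← sub_mul, abs_mul, abs_mul]
    refine mul_le_mul_of_nonneg_right ?_ (abs_nonneg _)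
    rw [abs_of_nonneg (show (0 : ℝ) ≤ 2 * k by positivity)]
    exact (abs_sub _ _).trans
      (by linarith [abs_truncReal_le k (b (ns (ms j)) x), abs_truncReal_le k (b₀ x)])
  · filter_upwards [hms, coeFn_mulTrunc' k b₀ z,
      ae_all_iff.2 fun j => coeFn_mulTrunc' k (b (ns (ms j))) z] with x h1 h2 h3
    simp only [Function.comp_apply]
    simp_rw [h2, h3]
    exact (((lipschitzWith_truncReal k).continuous.tendsto _).comp h1).mul_const _

lemma continuous_mulTrunc (hγ' : γ ≠ ∞) (k : ℕ) :
    Continuous fun r : LpE n σ × LpE n γ => mulTrunc k r.1 r.2 := by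
  rw [continuous_iff_continuousAt]
  rintro ⟨b, z⟩
  rw [ContinuousAt, tendsto_iff_norm_sub_tendsto_zero]
  have h1 : Tendsto (fun r : LpE n σ × LpE n γ =>
      k * ‖r.2 - z‖ + ‖mulTrunc k r.1 z - mulTrunc k b z‖) (𝓝 (b, z)) (𝓝 0) := by
    have : Continuous fun r : LpE n σ × LpE n γ =>
        k * ‖r.2 - z‖ + ‖mulTrunc k r.1 z - mulTrunc k b z‖ :=
      ((continuous_snd.sub continuous_const).norm.const_mul _).add
        (((continuous_mulTrunc_left hγ' k z).comp continuous_fst).sub continuous_const).norm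
    simpa using this.tendsto (b, z)
  refine squeeze_zero (fun _ => norm_nonneg _) (fun r => ?_) h1
  calc ‖mulTrunc k r.1 r.2 - mulTrunc k b z‖
      = ‖mulTrunc k r.1 (r.2 - z) + (mulTrunc k r.1 z - mulTrunc k b z)‖ := by
        rw [mulTrunc_sub]; abel_nf
    _ ≤ _ := (norm_add_le _ _).trans (add_le_add_left (norm_mulTrunc_le _ _ _) _)

end Truncation

section Picard

open Filter Topology

variable {X : Type*} [NormedAddCommGroup X]

lemma aestronglyMeasurable_duhamel {T : ℝ} {S : ℝ → X → X}
    (hS : Continuous fun r : ℝ × X => S r.1 r.2) {g : ℝ → X}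
    (hg : AEStronglyMeasurable g (volume.restrict (Ioo 0 T))) (t : ℝ) :
    AEStronglyMeasurable (fun s => S (t - s) (g s)) (volume.restrict (Ioo 0 T)) :=
  hS.comp_aestronglyMeasurable
    ((by fun_prop : Continuous fun s : ℝ => t - s).aestronglyMeasurable.prodMk hg)

lemma integrableOn_duhamel {T : ℝ} {S : ℝ → X → X}
    (hS : Continuous fun r : ℝ × X => S r.1 r.2) (hSn : ∀ r x, ‖S r x‖ ≤ ‖x‖) {g : ℝ → X}
    (hg : AEStronglyMeasurable g (volume.restrict (Ioo 0 T))) {B : ℝ}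
    (hB : ∀ s ∈ Ioo 0 T, ‖g s‖ ≤ B) {t r : ℝ} (ht : t ≤ T) :
    IntegrableOn (fun s => S (r - s) (g s)) (Ioo 0 t) := by
  have h1 : IntegrableOn (fun s => S (r - s) (g s)) (Ioo 0 T) := by
    refine Integrable.mono' (integrable_const B) (aestronglyMeasurable_duhamel hS hg r) ?_
    filter_upwards [ae_restrict_mem measurableSet_Ioo] with s hs
    exact (hSn _ _).trans (hB s hs)
  exact h1.mono_set (Ioo_subset_Ioo_right ht)

variable [NormedSpace ℝ X]

lemma continuousOn_duhamel {T : ℝ} {S : ℝ → X → X}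
    (hS : Continuous fun r : ℝ × X => S r.1 r.2) (hSn : ∀ r x, ‖S r x‖ ≤ ‖x‖) {g : ℝ → X}
    (hg : AEStronglyMeasurable g (volume.restrict (Ioo 0 T))) {B : ℝ}
    (hB : ∀ s ∈ Ioo 0 T, ‖g s‖ ≤ B) :
    ContinuousOn (fun t => ∫ s in Ioo 0 t, S (t - s) (g s)) (Icc 0 T) := by
  have hcont : Continuous fun t => ∫ s in Ioo 0 T, (Iio t).indicator (fun s => S (t - s) (g s)) s := by
    rw [continuous_iff_continuousAt]
    intro t₀
    refine continuousAt_of_dominated (bound := fun _ => |B|) (Eventually.of_forall fun t => ?_)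
      (Eventually.of_forall fun t => ?_) (integrable_const _) ?_
    · exact (aestronglyMeasurable_duhamel hS hg t).indicator measurableSet_Iio
    · filter_upwards [ae_restrict_mem measurableSet_Ioo] with s hs
      refine (norm_indicator_le_norm_self _ _).trans ?_
      exact ((hSn _ _).trans (hB s hs)).trans (le_abs_self B)
    · have hne : ∀ᵐ s ∂(volume.restrict (Ioo 0 T)), s ≠ t₀ :=
        ae_restrict_of_ae (Measure.ae_ne volume t₀)
      filter_upwards [hne] with s hs
      have hc : Continuous fun t => S (t - s) (g s) := hS.comp
        (by fun_prop : Continuous fun t : ℝ => (t - s, g s))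
      rcases lt_or_gt_of_ne hs with h | h
      · refine hc.continuousAt.congr ?_
        filter_upwards [Ioi_mem_nhds h] with t ht
        exact (indicator_of_mem (show s ∈ Iio t from ht) (fun s => S (t - s) (g s))).symm
      · refine continuousAt_const (y := (0 : X)) |>.congr ?_
        filter_upwards [Iio_mem_nhds h] with t ht
        have hst : s ∉ Iio t := fun h' => lt_asymm (mem_Iio.1 h') (mem_Iio.1 ht)
        exact (indicator_of_notMem hst (fun s => S (t - s) (g s))).symm
  refine hcont.continuousOn.congr fun t ht => ?_
  simp only
  rw [setIntegral_indicator measurableSet_Iio]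
  congr 2
  ext s
  simp only [mem_inter_iff, mem_Ioo, mem_Iio]
  exact ⟨fun h => ⟨⟨h.1, h.2.trans_le ht.2⟩, h.2⟩, fun h => ⟨h.1.1, h.2⟩⟩

/-- Picard iteration for a semigroup perturbed by bounded operators. Every property which is
stable under the iteration and under pointwise limits holds for the solution. -/
lemma exists_duhamel_fixedPoint [CompleteSpace X] {T : ℝ} (hT : 0 < T) {S : ℝ → X → X}
    (hS : Continuous fun r : ℝ × X => S r.1 r.2) (hSn : ∀ r x, ‖S r x‖ ≤ ‖x‖)
    (hSsub : ∀ r x y, S r (x - y) = S r x - S r y) {A : ℝ → X → X} {k : ℝ} (hk : 0 < k)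
    (hAn : ∀ s x, ‖A s x‖ ≤ k * ‖x‖) (hAsub : ∀ s x y, A s (x - y) = A s x - A s y)
    (hAm : ∀ w : ℝ → X, ContinuousOn w (Icc 0 T) →
      AEStronglyMeasurable (fun s => A s (w s)) (volume.restrict (Ioo 0 T))) (x₀ : X) :
    ∃ u : ℝ → X, ContinuousOn u (Icc 0 T) ∧
      (∀ t ∈ Icc 0 T, u t = S t x₀ - ∫ s in Ioo 0 t, S (t - s) (A s (u s))) ∧
      ∀ Q : (ℝ → X) → Prop,
        (∀ (w : ℕ → ℝ → X) (w' : ℝ → X), (∀ j, Q (w j)) →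
          (∀ t ∈ Icc 0 T, Tendsto (fun j => w j t) atTop (𝓝 (w' t))) → Q w') →
        (∀ w w' : ℝ → X, ContinuousOn w (Icc 0 T) → Q w →
          (∀ t ∈ Icc 0 T, w' t = S t x₀ - ∫ s in Ioo 0 t, S (t - s) (A s (w s))) → Q w') →
        Q (fun _ => 0) → Q u := by
  let Φ : (ℝ → X) → ℝ → X := fun w t => S t x₀ - ∫ s in Ioo 0 t, S (t - s) (A s (w s))
  let w : ℕ → ℝ → X := fun j => Φ^[j] fun _ => 0
  have hw : ∀ j, w (j + 1) = Φ (w j) := fun j => Function.iterate_succ_apply' _ _ _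
  have hbdd : ∀ v : ℝ → X, ContinuousOn v (Icc 0 T) → ∃ B, 0 ≤ B ∧ ∀ s ∈ Ioo 0 T, ‖A s (v s)‖ ≤ B := by
    intro v hv
    obtain ⟨C, hC⟩ := isCompact_Icc.exists_bound_of_continuousOn hv
    have hC0 : 0 ≤ C := (norm_nonneg _).trans (hC 0 ⟨le_rfl, hT.le⟩)
    exact ⟨k * C, by positivity, fun s hs => (hAn _ _).trans
      (mul_le_mul_of_nonneg_left (hC s (Ioo_subset_Icc_self hs)) hk.le)⟩
  have hΦc : ∀ v, ContinuousOn v (Icc 0 T) → ContinuousOn (Φ v) (Icc 0 T) := by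
    intro v hv
    obtain ⟨B, _, hB⟩ := hbdd v hv
    exact (hS.comp (by fun_prop : Continuous fun t : ℝ => (t, x₀))).continuousOn.sub
      (continuousOn_duhamel hS hSn (hAm v hv) hB)
  have hwc : ∀ j, ContinuousOn (w j) (Icc 0 T) := by
    intro j
    induction j with
    | zero => exact continuousOn_const
    | succ j ih => rw [hw]; exact hΦc _ ih
  have hdiff : ∀ v v' : ℝ → X, ContinuousOn v (Icc 0 T) → ContinuousOn v' (Icc 0 T) → ∀ D,
      0 ≤ D → (∀ t ∈ Icc 0 T, ‖v t - v' t‖ ≤ D * Real.exp (2 * k * t)) →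
      ∀ t ∈ Icc 0 T, ‖Φ v t - Φ v' t‖ ≤ D / 2 * Real.exp (2 * k * t) := by
    intro v v' hv hv' D hD h t ht
    obtain ⟨B, _, hB⟩ := hbdd v hv
    obtain ⟨B', _, hB'⟩ := hbdd v' hv'
    have e1 : Φ v t - Φ v' t = -∫ s in Ioo 0 t, S (t - s) (A s (v s - v' s)) := by
      simp only [Φ, hAsub, hSsub]
      rw [integral_sub (integrableOn_duhamel hS hSn (hAm v hv) hB ht.2)
        (integrableOn_duhamel hS hSn (hAm v' hv') hB' ht.2)]
      abel
    have hint : IntervalIntegrable (fun s => k * (D * Real.exp (2 * k * s))) volume 0 t :=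
      (by fun_prop : Continuous fun s : ℝ => k * (D * Real.exp (2 * k * s))).intervalIntegrable _ _
    have e2 : ‖∫ s in Ioo 0 t, S (t - s) (A s (v s - v' s))‖ ≤
        ∫ s in Ioo 0 t, k * (D * Real.exp (2 * k * s)) := by
      refine norm_integral_le_of_norm_le
        ((intervalIntegrable_iff_integrableOn_Ioo_of_le ht.1).1 hint) ?_
      filter_upwards [ae_restrict_mem measurableSet_Ioo] with s hs
      refine (hSn _ _).trans ((hAn _ _).trans ?_)
      gcongr
      exact h s ⟨hs.1.le, hs.2.le.trans ht.2⟩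
    have e3 : ∫ s in Ioo 0 t, k * (D * Real.exp (2 * k * s)) =
        D / 2 * (Real.exp (2 * k * t) - 1) := by
      rw [← integral_Ioc_eq_integral_Ioo, ← intervalIntegral.integral_of_le ht.1,
        intervalIntegral.integral_eq_sub_of_hasDerivAt (f := fun s => D / 2 * Real.exp (2 * k * s))
          (fun s _ => ?_) hint]
      · simp; ring
      · have h1 : HasDerivAt (fun s : ℝ => 2 * k * s) (2 * k) s := by
          simpa using (hasDerivAt_id s).const_mul (2 * k)
        have h2 : k * (D * Real.exp (2 * k * s)) = D / 2 * (Real.exp (2 * k * s) * (2 * k)) := by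
          ring
        rw [h2]
        exact h1.exp.const_mul (D / 2)
    rw [e1, norm_neg]
    refine e2.trans ?_
    rw [e3]
    nlinarith
  have hgeo : ∀ j, ∀ t ∈ Icc 0 T,
      ‖w (j + 1) t - w j t‖ ≤ ‖x₀‖ / 2 ^ j * Real.exp (2 * k * t) := by
    intro j
    induction j with
    | zero =>
      intro t ht
      have h0 : ∀ s, A s 0 = 0 := fun s => by
        have := hAn s 0; simpa using this
      have h1 : ∀ s, S s 0 = 0 := fun s => by
        have := hSn s 0; simpa using this
      have : w 1 t - w 0 t = S t x₀ := by
        simp [w, Φ, h0, h1]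
      rw [zero_add, this]
      refine (hSn _ _).trans ?_
      simp only [pow_zero, div_one]
      have hexp : 1 ≤ Real.exp (2 * k * t) := Real.one_le_exp (by have := ht.1; positivity)
      nlinarith [norm_nonneg x₀]
    | succ j ih =>
      have := hdiff _ _ (hwc (j + 1)) (hwc j) _ (by positivity) ih
      rw [← hw, ← hw] at this
      intro t ht
      refine (this t ht).trans (le_of_eq ?_)
      rw [pow_succ]; field_simp
  set E := ‖x₀‖ * Real.exp (2 * k * T) with hE
  have hgeo' : ∀ t ∈ Icc 0 T, ∀ j, dist (w j t) (w (j + 1) t) ≤ (2 * E) / 2 / 2 ^ j := by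
    intro t ht j
    rw [dist_comm, dist_eq_norm]
    refine (hgeo j t ht).trans ?_
    rw [hE]
    have : Real.exp (2 * k * t) ≤ Real.exp (2 * k * T) := by
      apply Real.exp_le_exp.2; have := ht.2; gcongr
    calc _ ≤ ‖x₀‖ / 2 ^ j * Real.exp (2 * k * T) := by gcongr
      _ = _ := by ring
  have hlim : ∀ t, ∃ y, t ∈ Icc 0 T → Tendsto (fun j => w j t) atTop (𝓝 y) := by
    intro t
    by_cases ht : t ∈ Icc 0 T
    · obtain ⟨y, hy⟩ := cauchySeq_tendsto_of_complete (cauchySeq_of_le_geometric_two (hgeo' t ht))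
      exact ⟨y, fun _ => hy⟩
    · exact ⟨0, fun h => absurd h ht⟩
  choose u hu using hlim
  have hunif : TendstoUniformlyOn w u atTop (Icc 0 T) := by
    rw [Metric.tendstoUniformlyOn_iff]
    intro ε hε
    have h1 : Tendsto (fun j : ℕ => 2 * E / 2 ^ j) atTop (𝓝 0) :=
      tendsto_const_nhds.div_atTop (tendsto_pow_atTop_atTop_of_one_lt (by norm_num))
    filter_upwards [h1.eventually (gt_mem_nhds hε)] with j hj t ht
    rw [dist_comm]
    exact (dist_le_of_le_geometric_two_of_tendsto (hgeo' t ht) (hu t ht) j).trans_lt hj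
  have huc : ContinuousOn u (Icc 0 T) := hunif.continuousOn (Frequently.of_forall hwc)
  have hfix : ∀ t ∈ Icc 0 T, u t = Φ u t := by
    intro t ht
    obtain ⟨C, hC⟩ := isCompact_Icc.exists_bound_of_continuousOn huc
    refine tendsto_nhds_unique ((tendsto_add_atTop_iff_nat 1).2 (hu t ht)) ?_
    simp_rw [hw]
    have h2 : Tendsto (fun j => w j t - u t) atTop (𝓝 0) := by
      simpa using (hu t ht).sub_const (u t)
    rw [tendsto_iff_norm_sub_tendsto_zero]
    have h3 : Tendsto (fun j : ℕ => 2 * E / 2 ^ j / 2 * Real.exp (2 * k * t)) atTop (𝓝 0) := by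
      have h1 : Tendsto (fun j : ℕ => 2 * E / 2 ^ j) atTop (𝓝 0) :=
        tendsto_const_nhds.div_atTop (tendsto_pow_atTop_atTop_of_one_lt (by norm_num))
      simpa using (h1.div_const 2).mul_const (Real.exp (2 * k * t))
    refine squeeze_zero (fun _ => norm_nonneg _) (fun j => ?_) h3
    refine hdiff _ _ (hwc j) huc _ (by positivity) (fun s hs => ?_) t ht
    have h4 := dist_le_of_le_geometric_two_of_tendsto (hgeo' s hs) (hu s hs) j
    rw [dist_eq_norm] at h4
    refine h4.trans (le_mul_of_one_le_right (by positivity) (Real.one_le_exp ?_))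
    have := hs.1; positivity
  refine ⟨u, huc, hfix, fun Q hQlim hQstep hQ0 => ?_⟩
  refine hQlim w u (fun j => ?_) hu
  induction j with
  | zero => exact hQ0
  | succ j ih => exact hQstep (w j) _ (hwc j) ih fun t _ => by rw [hw]

end Picard

section HeatBoundBasic

open Filter Topology

variable {n : ℕ} {γ : ℝ≥0∞} [hγ : Fact (1 ≤ γ)] {T M l : ℝ}

lemma eLpNorm_top_le_of_tendsto {ι : Type*} {f : Filter ι} [f.NeBot] [f.IsCountablyGenerated]
    {z : ι → LpE n γ} {z₀ : LpE n γ} (hz : Tendsto z f (𝓝 z₀)) {c : ℝ≥0∞}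
    (hc : ∀ᶠ i in f, eLpNorm (z i) ∞ volume ≤ c) : eLpNorm z₀ ∞ volume ≤ c := by
  obtain ⟨ns, hns, hae⟩ := (tendstoInMeasure_of_tendsto_Lp hz).exists_seq_tendsto_ae'
  rw [eLpNorm_exponent_top]
  refine essSup_le_of_ae_le _ ?_
  obtain ⟨N, hN⟩ := eventually_atTop.1 (hns.eventually hc)
  have h1 : ∀ᵐ x, ∀ j, N ≤ j → ‖z (ns j) x‖ₑ ≤ c := by
    rw [ae_all_iff]; intro j
    by_cases hj : N ≤ j
    · have h2 := hN j hj
      rw [eLpNorm_exponent_top] at h2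
      filter_upwards [enorm_ae_le_eLpNormEssSup (z (ns j)) volume] with x hx _
      exact hx.trans h2
    · exact Eventually.of_forall fun x h => absurd h hj
  filter_upwards [hae, h1] with x hx h1x
  exact le_of_tendsto hx.enorm (eventually_atTop.2 ⟨N, h1x⟩)

lemma heatBound_of_tendsto {w : ℕ → ℝ → LpE n γ} {w' : ℝ → LpE n γ}
    (hw : ∀ᶠ j in atTop, HeatBound T M l (w j))
    (hlim : ∀ t ∈ Icc 0 T, Tendsto (fun j => w j t) atTop (𝓝 (w' t))) : HeatBound T M l w' := by
  intro t ht
  have h := hlim t (Ioc_subset_Icc_self ht)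
  exact ⟨le_of_tendsto h.norm (hw.mono fun j hj => (hj t ht).1),
    eLpNorm_top_le_of_tendsto h (hw.mono fun j hj => (hj t ht).2)⟩

lemma HeatBound.mono {u : ℝ → LpE n γ} (hu : HeatBound T M l u) {M' : ℝ} (h : M ≤ M') :
    HeatBound T M' l u := by
  intro t ht
  have ht0 := ht.1
  refine ⟨(hu t ht).1.trans (by gcongr), (hu t ht).2.trans (ENNReal.ofReal_le_ofReal ?_)⟩
  gcongr

lemma HeatBound.sub {u v : ℝ → LpE n γ} {M' : ℝ} (hM : 0 ≤ M) (hM' : 0 ≤ M')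
    (hu : HeatBound T M l u) (hv : HeatBound T M' l v) :
    HeatBound T (M + M') l fun t => u t - v t := by
  intro t ht
  have ht0 := ht.1
  constructor
  · refine (norm_sub_le _ _).trans ?_
    rw [add_mul]
    exact add_le_add (hu t ht).1 (hv t ht).1
  · rw [eLpNorm_congr_ae (Lp.coeFn_sub (u t) (v t))]
    refine (eLpNorm_sub_le (Lp.aestronglyMeasurable _) (Lp.aestronglyMeasurable _) le_top).trans ?_
    rw [add_mul, add_mul, ENNReal.ofReal_add (by positivity) (by positivity)]
    exact add_le_add (hu t ht).2 (hv t ht).2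

lemma heatBound_zero (hM : 0 ≤ M) : HeatBound T M l fun _ => (0 : LpE n γ) := by
  intro t ht
  refine ⟨by rw [norm_zero]; positivity, ?_⟩
  rw [eLpNorm_congr_ae (Lp.coeFn_zero ℝ γ volume), eLpNorm_zero]
  exact zero_le

/-- A self-improving heat bound. -/
lemma HeatBound.of_improvement {u : ℝ → LpE n γ} {M₀ D : ℝ} (hM₀ : 0 ≤ M₀) (hD : 0 ≤ D)
    (h0 : HeatBound T M₀ l u)
    (hstep : ∀ M, 0 ≤ M → HeatBound T M l u → HeatBound T (M / 2 + D) l u) :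
    HeatBound T (2 * D) l u := by
  have h1 : ∀ j : ℕ, HeatBound T (2 * D + M₀ / 2 ^ j) l u := by
    intro j
    induction j with
    | zero => exact h0.mono (by simp; positivity)
    | succ j ih =>
      refine (hstep _ (by positivity) ih).mono (le_of_eq ?_)
      rw [pow_succ]; field_simp; ring
  have h2 : Tendsto (fun j : ℕ => 2 * D + M₀ / 2 ^ j) atTop (𝓝 (2 * D)) := by
    have : Tendsto (fun j : ℕ => M₀ / 2 ^ j) atTop (𝓝 0) :=
      tendsto_const_nhds.div_atTop (tendsto_pow_atTop_atTop_of_one_lt (by norm_num))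
    simpa using this.const_add (2 * D)
  intro t ht
  refine ⟨ge_of_tendsto (h2.mul_const _) (Eventually.of_forall fun j => (h1 j t ht).1), ?_⟩
  refine ge_of_tendsto (ENNReal.tendsto_ofReal ((h2.mul_const _).mul_const _))
    (Eventually.of_forall fun j => (h1 j t ht).2)

end HeatBoundBasic

section Approximation

open Filter Topology

variable {n : ℕ} {σ γ : ℝ≥0∞} [hσ : Fact (1 ≤ σ)] [hγ : Fact (1 ≤ γ)] [hγ' : Fact (γ ≠ ∞)]

lemma kernelBound_zero (θ l T : ℝ) : KernelBound θ l T 0 fun _ => 0 := by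
  intro t _
  simp

/-- Testing the strong Duhamel formula. -/
lemma integral_duhamel_mul {T : ℝ} {f : LpE n γ} {g : ℝ → LpE n γ}
    (hg : AEStronglyMeasurable g (volume.restrict (Ioo 0 T))) {B : ℝ}
    (hB : ∀ s ∈ Ioo 0 T, ‖g s‖ ≤ B) {t : ℝ} (ht : t ≤ T)
    (γ' : ℝ≥0∞) [γ.HolderConjugate γ'] {ψ : EuclideanSpace ℝ (Fin n) → ℝ} (hψ : Measurable ψ)
    (hψ' : MemLp ψ γ' volume) :
    ∫ x, (heatLp t f - ∫ s in Ioo 0 t, heatLp (t - s) (g s) : LpE n γ) x * ψ x =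
      (∫ x, f x * heatFun t ψ x) - ∫ s in Ioo 0 t, ∫ x, g s x * heatFun (t - s) ψ x := by
  rw [← pairCLM_apply hψ', map_sub, pairCLM_apply, integral_heatLp_mul γ' t f hψ hψ',
    ← ContinuousLinearMap.integral_comp_comm _
      (integrableOn_duhamel continuous_heatLp norm_heatLp_le hg hB ht)]
  congr 2
  ext s
  rw [pairCLM_apply, integral_heatLp_mul γ' _ _ hψ hψ']

lemma memLp_heatFun (τ : ℝ) {q : ℝ≥0∞} (hq : 1 ≤ q) {ψ : EuclideanSpace ℝ (Fin n) → ℝ}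
    (hψ : Measurable ψ) (hψ' : MemLp ψ q volume) : MemLp (heatFun τ ψ) q volume :=
  ⟨(measurable_heatFun τ hψ).aestronglyMeasurable, (eLpNorm_heatFun_le τ hψ hq).trans_lt hψ'.2⟩

lemma integral_mulTrunc_mul (k : ℕ) (b : LpE n σ) (z : LpE n γ)
    (ψ : EuclideanSpace ℝ (Fin n) → ℝ) :
    ∫ x, mulTrunc k b z x * ψ x = ∫ x, truncLp k b x * (z x * ψ x) := by
  refine integral_congr_ae ?_
  filter_upwards [coeFn_mulTrunc k b z] with x hx
  rw [hx, mul_assoc]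

lemma aestronglyMeasurable_mulTrunc {T : ℝ} {a : ℝ → LpE n σ}
    (ha : AEStronglyMeasurable a (volume.restrict (Ioo 0 T))) (k : ℕ) {w : ℝ → LpE n γ}
    (hw : ContinuousOn w (Icc 0 T)) :
    AEStronglyMeasurable (fun s => mulTrunc k (a s) (w s)) (volume.restrict (Ioo 0 T)) :=
  (continuous_mulTrunc hγ'.out k).comp_aestronglyMeasurable
    (ha.prodMk ((hw.mono Ioo_subset_Icc_self).aestronglyMeasurable measurableSet_Ioo))

lemma exists_bound_mulTrunc {T : ℝ} (hT : 0 ≤ T) (a : ℝ → LpE n σ) (k : ℕ) {w : ℝ → LpE n γ}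
    (hw : ContinuousOn w (Icc 0 T)) :
    ∃ B, 0 ≤ B ∧ ∀ s ∈ Ioo 0 T, ‖mulTrunc k (a s) (w s)‖ ≤ B := by
  obtain ⟨C, hC⟩ := isCompact_Icc.exists_bound_of_continuousOn hw
  have hC0 : 0 ≤ C := (norm_nonneg _).trans (hC 0 ⟨le_rfl, hT⟩)
  exact ⟨k * C, by positivity, fun s hs => (norm_mulTrunc_le _ _ _).trans
    (mul_le_mul_of_nonneg_left (hC s (Ioo_subset_Icc_self hs)) (by positivity))⟩

/-- The smallness condition on the weight which makes the Duhamel map a contraction. -/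
def WeightCondition (n : ℕ) (σ γ : ℝ≥0∞) (L l : ℝ) : Prop :=
  2 ^ ((n : ℝ) / (2 * γ.toReal)) * (3 * L * (Real.Gamma (1 - (n : ℝ) / (2 * σ.toReal)) *
    (1 / l) ^ (1 - (n : ℝ) / (2 * σ.toReal)))) ≤ 1 / 2

/-- Solutions of the equation with truncated potential, with uniform bounds. -/
lemma exists_truncated_solution (hσ' : σ ≠ ∞) (hσn : (n : ℝ) / 2 < σ.toReal) {T L : ℝ} (hT : 0 < T)
    (hL : 0 ≤ L) {a : ℝ → LpE n σ} (ha : AEStronglyMeasurable a (volume.restrict (Ioo 0 T)))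
    (haL : ∀ᵐ s ∂(volume.restrict (Ioo 0 T)), ‖a s‖ ≤ L) (u₀ : LpE n γ) {k : ℕ} (hk : 0 < k) :
    ∃ u : ℝ → LpE n γ, ContinuousOn u (Icc 0 T) ∧
      (∀ t ∈ Icc 0 T, u t = heatLp t u₀ -
        ∫ s in Ioo 0 t, heatLp (t - s) (mulTrunc k (a s) (u s))) ∧
      ∀ l, 0 < l → WeightCondition n σ γ L l →
        HeatBound T (2 * (2 ^ ((n : ℝ) / (2 * γ.toReal)) * ‖u₀‖)) l u := by
  obtain ⟨u, hu1, hu2, hu3⟩ := exists_duhamel_fixedPoint hT (continuous_heatLp (n := n) (p := γ))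
    norm_heatLp_le heatLp_sub (A := fun s z => mulTrunc k (a s) z) (k := k) (by exact_mod_cast hk)
    (fun s z => norm_mulTrunc_le _ _ _) (fun s z w => mulTrunc_sub _ _ _ _)
    (fun w hw => aestronglyMeasurable_mulTrunc ha k hw) u₀
  refine ⟨u, hu1, hu2, fun l hl hcond => ?_⟩
  have hσ0 : 0 < σ.toReal := lt_of_le_of_lt (by positivity) hσn
  have hθ0 : 0 ≤ (n : ℝ) / (2 * σ.toReal) := by positivity
  have hθ1 : (n : ℝ) / (2 * σ.toReal) < 1 := by
    rw [div_lt_one (by positivity)]; linarith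
  have hΓ : 0 < Real.Gamma (1 - (n : ℝ) / (2 * σ.toReal)) :=
    Real.Gamma_pos_of_pos (by linarith)
  set C : ℝ := 2 ^ ((n : ℝ) / (2 * γ.toReal)) with hC
  have hC0 : 0 < C := by positivity
  refine hu3 (HeatBound T (2 * (C * ‖u₀‖)) l)
    (fun w w' hw hlim => heatBound_of_tendsto (Eventually.of_forall hw) hlim)
    (fun w w' hwc hw hw' => ?_) (heatBound_zero (by positivity))
  have : γ.HolderConjugate (ENNReal.conjExponent γ) := .conjExponent hγ.out
  have h1γ' : 1 ≤ ENNReal.conjExponent γ := (ENNReal.HolderConjugate.symm (p := γ)).one_le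
  obtain ⟨B, _, hB⟩ := exists_bound_mulTrunc hT.le a k hwc
  have key := heatBound_of_duhamel hσ' hγ'.out hl.le (f := u₀) (b₁ := fun s => truncLp k (a s))
    (b₂ := fun _ => 0) (u₁ := w) (u₂ := fun _ => 0) (v := w') (h₁ := fun _ => L)
    (h₂ := fun _ => 0) (M₁ := 2 * (C * ‖u₀‖)) (M₂ := 0)
    (K₁ := 3 * L * (Real.Gamma (1 - (n : ℝ) / (2 * σ.toReal)) *
      (1 / l) ^ (1 - (n : ℝ) / (2 * σ.toReal)))) (K₂ := 0) (by positivity) le_rfl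
    (by positivity) le_rfl hw (heatBound_zero le_rfl)
    (by filter_upwards [haL] with s hs using (norm_truncLp_le _ _).trans hs)
    (Eventually.of_forall fun s => by simp) (kernelBound_const hθ0 hθ1 hl hL)
    (kernelBound_zero _ _ _) (fun t ht ψ hψ hψc => ?_)
  · refine key.mono ?_
    rw [WeightCondition] at hcond
    have h4 := mul_le_mul_of_nonneg_right hcond (show 0 ≤ 2 * (C * ‖u₀‖) by positivity)
    linarith
  · refine ⟨fun s => ∫ x, mulTrunc k (a s) (w s) x * heatFun (t - s) ψ x, ?_, ?_⟩
    · rw [hw' t (Ioc_subset_Icc_self ht), integral_duhamel_mul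
        (aestronglyMeasurable_mulTrunc ha k hwc) hB ht.2 (ENNReal.conjExponent γ)
        hψ.continuous.measurable (memLp_of_test hψ hψc _)]
      exact abs_sub _ _
    · refine Eventually.of_forall fun s => ?_
      simp only [integral_mulTrunc_mul]
      exact le_add_of_nonneg_right (abs_nonneg _)

end Approximation

section Limit

open Filter Topology

variable {n : ℕ} {σ γ : ℝ≥0∞} [hσ : Fact (1 ≤ σ)] [hγ : Fact (1 ≤ γ)] [hγ' : Fact (γ ≠ ∞)]

/-- Stability of the truncated problems with respect to the truncation. -/
lemma heatBound_sub_of_truncated (hσ' : σ ≠ ∞) (hσn : (n : ℝ) / 2 < σ.toReal) {T L l M K : ℝ}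
    (hT : 0 < T) (hL : 0 ≤ L) {a : ℝ → LpE n σ}
    (ha : AEStronglyMeasurable a (volume.restrict (Ioo 0 T)))
    (haL : ∀ᵐ s ∂(volume.restrict (Ioo 0 T)), ‖a s‖ ≤ L) (hl : 0 < l)
    (hcond : WeightCondition n σ γ L l) (hM : 0 ≤ M) (hK0 : 0 ≤ K) {u₀ : LpE n γ}
    {u v : ℝ → LpE n γ} (huc : ContinuousOn u (Icc 0 T)) (hvc : ContinuousOn v (Icc 0 T)) {k m : ℕ}
    (hu : ∀ t ∈ Icc 0 T, u t = heatLp t u₀ -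
      ∫ s in Ioo 0 t, heatLp (t - s) (mulTrunc k (a s) (u s)))
    (hv : ∀ t ∈ Icc 0 T, v t = heatLp t u₀ -
      ∫ s in Ioo 0 t, heatLp (t - s) (mulTrunc m (a s) (v s)))
    (huM : HeatBound T M l u) (hvM : HeatBound T M l v) {h : ℝ → ℝ}
    (hh : ∀ s, ‖truncLp k (a s) - truncLp m (a s)‖ ≤ h s)
    (hK : KernelBound ((n : ℝ) / (2 * σ.toReal)) l T K h) :
    HeatBound T (2 * (2 ^ ((n : ℝ) / (2 * γ.toReal)) * (K * M))) l fun t => u t - v t := by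
  have hσ0 : 0 < σ.toReal := lt_of_le_of_lt (by positivity) hσn
  have hθ0 : 0 ≤ (n : ℝ) / (2 * σ.toReal) := by positivity
  have hθ1 : (n : ℝ) / (2 * σ.toReal) < 1 := by
    rw [div_lt_one (by positivity)]; linarith
  have hΓ : 0 < Real.Gamma (1 - (n : ℝ) / (2 * σ.toReal)) :=
    Real.Gamma_pos_of_pos (by linarith)
  refine HeatBound.of_improvement (M₀ := M + M) (by positivity) (by positivity)
    (huM.sub hM hM hvM) fun M' hM' hw => ?_
  have : γ.HolderConjugate (ENNReal.conjExponent γ) := .conjExponent hγ.out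
  have h1γ' : 1 ≤ ENNReal.conjExponent γ := (ENNReal.HolderConjugate.symm (p := γ)).one_le
  obtain ⟨B, _, hB⟩ := exists_bound_mulTrunc hT.le a k huc
  obtain ⟨B', _, hB'⟩ := exists_bound_mulTrunc hT.le a m hvc
  have key := heatBound_of_duhamel hσ' hγ'.out hl.le (f := (0 : LpE n γ))
    (b₁ := fun s => truncLp k (a s))
    (b₂ := fun s => truncLp k (a s) - truncLp m (a s)) (u₁ := fun t => u t - v t) (u₂ := v)
    (v := fun t => u t - v t) (h₁ := fun _ => L)
    (h₂ := h) (M₁ := M') (M₂ := M)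
    (K₁ := 3 * L * (Real.Gamma (1 - (n : ℝ) / (2 * σ.toReal)) *
      (1 / l) ^ (1 - (n : ℝ) / (2 * σ.toReal)))) (K₂ := K) hM' hM
    (by positivity) hK0 hw hvM
    (by filter_upwards [haL] with s hs using (norm_truncLp_le _ _).trans hs)
    (Eventually.of_forall hh) (kernelBound_const hθ0 hθ1 hl hL)
    hK (fun t ht ψ hψ hψc => ?_)
  · refine key.mono ?_
    rw [WeightCondition] at hcond
    have h4 := mul_le_mul_of_nonneg_right hcond hM'
    rw [norm_zero]
    linarith
  · have hψm := hψ.continuous.measurable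
    have hψL := memLp_of_test hψ hψc (ENNReal.conjExponent γ)
    have hsub : Ioo 0 t ⊆ Ioo 0 T := Ioo_subset_Ioo_right ht.2
    have hint : ∀ (j : ℕ) (w : ℝ → LpE n γ), ContinuousOn w (Icc 0 T) →
        IntegrableOn (fun s => ∫ x, mulTrunc j (a s) (w s) x * heatFun (t - s) ψ x) (Ioo 0 t) := by
      intro j w hw
      obtain ⟨B, _, hB⟩ := exists_bound_mulTrunc hT.le a j hw
      have := (pairCLM (p := γ) hψL).integrable_comp (integrableOn_duhamel continuous_heatLp
        norm_heatLp_le (aestronglyMeasurable_mulTrunc ha j hw) hB (r := t) ht.2)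
      refine this.congr (Eventually.of_forall fun s => ?_)
      simp only
      rw [pairCLM_apply, integral_heatLp_mul (ENNReal.conjExponent γ) _ _ hψm hψL]
    refine ⟨fun s => (∫ x, mulTrunc k (a s) (u s) x * heatFun (t - s) ψ x) -
      ∫ x, mulTrunc m (a s) (v s) x * heatFun (t - s) ψ x, ?_, ?_⟩
    · rw [integral_sub (hint k u huc) (hint m v hvc)]
      have e1 := integral_duhamel_mul (f := u₀) (aestronglyMeasurable_mulTrunc ha k huc) hB ht.2
        (ENNReal.conjExponent γ) hψm hψL
      have e2 := integral_duhamel_mul (f := u₀) (aestronglyMeasurable_mulTrunc ha m hvc) hB' ht.2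
        (ENNReal.conjExponent γ) hψm hψL
      rw [← hu t (Ioc_subset_Icc_self ht)] at e1
      rw [← hv t (Ioc_subset_Icc_self ht)] at e2
      refine le_add_of_nonneg_of_le (abs_nonneg _) (le_of_eq ?_)
      rw [← pairCLM_apply hψL, map_sub, pairCLM_apply, pairCLM_apply, e1, e2, ← abs_neg]
      congr 1
      ring
    · refine Eventually.of_forall fun s => ?_
      have hL := memLp_heatFun (t - s) h1γ' hψm hψL
      have e3 : (∫ x, mulTrunc k (a s) (u s) x * heatFun (t - s) ψ x) =
          (∫ x, mulTrunc k (a s) (u s - v s) x * heatFun (t - s) ψ x) +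
          ∫ x, mulTrunc k (a s) (v s) x * heatFun (t - s) ψ x := by
        rw [mulTrunc_sub, ← pairCLM_apply hL, ← pairCLM_apply hL, ← pairCLM_apply hL, ← map_add,
          sub_add_cancel]
      have e4 : (∫ x, mulTrunc k (a s) (v s) x * heatFun (t - s) ψ x) -
          (∫ x, mulTrunc m (a s) (v s) x * heatFun (t - s) ψ x) =
          ∫ x, (truncLp k (a s) - truncLp m (a s) : LpE n σ) x * (v s x * heatFun (t - s) ψ x) := by
        rw [← integral_sub (integrable_coe_mul _ _ hL) (integrable_coe_mul _ _ hL)]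
        refine integral_congr_ae ?_
        filter_upwards [coeFn_mulTrunc k (a s) (v s), coeFn_mulTrunc m (a s) (v s),
          Lp.coeFn_sub (truncLp k (a s)) (truncLp m (a s))] with x h1 h2 h3
        rw [h1, h2, h3, Pi.sub_apply]
        ring
      simp only
      rw [e3, add_sub_assoc, e4, integral_mulTrunc_mul]
      exact abs_add_le _ _

lemma tendsto_integral_truncLp (hσ' : σ ≠ ∞) {T L : ℝ} {a : ℝ → LpE n σ}
    (ha : AEStronglyMeasurable a (volume.restrict (Ioo 0 T)))
    (haL : ∀ᵐ s ∂(volume.restrict (Ioo 0 T)), ‖a s‖ ≤ L) :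
    Tendsto (fun k => ∫ s in Ioo 0 T, ‖truncLp k (a s) - a s‖) atTop (𝓝 0) := by
  have h := tendsto_integral_of_dominated_convergence (μ := volume.restrict (Ioo 0 T))
    (F := fun k s => ‖truncLp k (a s) - a s‖) (f := fun _ => 0) (fun _ => 2 * L)
    (fun k => (((continuous_truncLp k).comp_aestronglyMeasurable ha).sub ha).norm)
    (integrable_const _) (fun k => ?_) (Eventually.of_forall fun s => ?_)
  · simpa using h
  · filter_upwards [haL] with s hs
    rw [norm_norm]
    linarith [norm_sub_le (truncLp k (a s)) (a s), norm_truncLp_le k (a s)]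
  · exact tendsto_iff_norm_sub_tendsto_zero.1 (tendsto_truncLp hσ' (a s))

/-- The solutions of the truncated problems converge. -/
lemma exists_limit_solution (hσ' : σ ≠ ∞) (hσn : (n : ℝ) / 2 < σ.toReal) {T L : ℝ} (hT : 0 < T)
    (hL : 0 ≤ L) {a : ℝ → LpE n σ} (ha : AEStronglyMeasurable a (volume.restrict (Ioo 0 T)))
    (haL : ∀ᵐ s ∂(volume.restrict (Ioo 0 T)), ‖a s‖ ≤ L) (u₀ : LpE n γ)
    {l : ℝ} (hl : 0 < l) (hcond : WeightCondition n σ γ L l) :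
    ∃ (U : ℕ → ℝ → LpE n γ) (u : ℝ → LpE n γ),
      (∀ k, ContinuousOn (U k) (Icc 0 T)) ∧
      (∀ k, ∀ t ∈ Icc 0 T, U k t = heatLp t u₀ -
        ∫ s in Ioo 0 t, heatLp (t - s) (mulTrunc (k + 1) (a s) (U k s))) ∧
      (∀ k, HeatBound T (2 * (2 ^ ((n : ℝ) / (2 * γ.toReal)) * ‖u₀‖)) l (U k)) ∧
      ContinuousOn u (Icc 0 T) ∧ u 0 = u₀ ∧
      (∀ t ∈ Icc 0 T, Tendsto (fun k => U k t) atTop (𝓝 (u t))) ∧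
      (∀ ε, 0 < ε → ∀ᶠ k in atTop, HeatBound T ε l fun t => U k t - u t) ∧
      ∀ l, 0 < l → WeightCondition n σ γ L l →
        HeatBound T (2 * (2 ^ ((n : ℝ) / (2 * γ.toReal)) * ‖u₀‖)) l u := by
  choose U hU1 hU2 hU3 using fun k : ℕ =>
    exists_truncated_solution hσ' hσn hT hL ha haL u₀ k.succ_pos
  set C : ℝ := 2 ^ ((n : ℝ) / (2 * γ.toReal)) with hC
  have hC0 : 0 < C := by positivity
  set M := 2 * (C * ‖u₀‖) with hM
  have hM0 : 0 ≤ M := by positivity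
  have hσ0 : 0 < σ.toReal := lt_of_le_of_lt (by positivity) hσn
  set θ := (n : ℝ) / (2 * σ.toReal) with hθ
  have hθ0 : 0 ≤ θ := by positivity
  have hθ1 : θ < 1 := by
    rw [hθ, div_lt_one (by positivity)]; linarith
  have hθ2 : 0 < 1 - θ := by linarith
  have hcau : ∀ ε, 0 < ε → ∃ N, ∀ k ≥ N, ∀ m ≥ N, HeatBound T ε l fun t => U k t - U m t := by
    intro ε hε
    have hlim1 : Tendsto (fun δ : ℝ => 2 * (C * (2 * (4 * L * (δ ^ (1 - θ) / (1 - θ))) * M)))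
        (𝓝[>] 0) (𝓝 0) := by
      have : Tendsto (fun δ : ℝ => δ ^ (1 - θ)) (𝓝[>] 0) (𝓝 0) := by
        have := (Real.continuousAt_rpow_const 0 (1 - θ) (Or.inr hθ2.le)).tendsto
        rw [Real.zero_rpow hθ2.ne'] at this
        exact this.mono_left nhdsWithin_le_nhds
      simpa using (((((this.div_const (1 - θ)).const_mul (4 * L)).const_mul 2).mul_const
        M).const_mul C).const_mul 2
    obtain ⟨δ, hδε, hδ⟩ := ((hlim1.eventually (gt_mem_nhds (half_pos hε))).and
      self_mem_nhdsWithin).exists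
    have hδ0 : 0 < δ := hδ
    have hlim2 : Tendsto (fun k : ℕ => 2 * (C * (2 * (δ ^ (-θ) *
        (2 * ∫ s in Ioo 0 T, ‖truncLp (k + 1) (a s) - a s‖)) * M))) atTop (𝓝 0) := by
      have := (tendsto_integral_truncLp hσ' ha haL).comp (tendsto_add_atTop_nat 1)
      simpa using (((((this.const_mul 2).const_mul (δ ^ (-θ))).const_mul 2).mul_const
        M).const_mul C).const_mul 2
    obtain ⟨N, hN⟩ := eventually_atTop.1 (hlim2.eventually (gt_mem_nhds (half_pos hε)))
    refine ⟨N, fun k hk m hm => ?_⟩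
    have hmeas : ∀ j, AEStronglyMeasurable (fun s => ‖truncLp j (a s) - a s‖)
        (volume.restrict (Ioo 0 T)) := fun j =>
      (((continuous_truncLp j).comp_aestronglyMeasurable ha).sub ha).norm
    have hbd : ∀ j, ∀ᵐ s ∂(volume.restrict (Ioo 0 T)), ‖truncLp j (a s) - a s‖ ≤ 2 * L := by
      intro j
      filter_upwards [haL] with s hs
      linarith [norm_sub_le (truncLp j (a s)) (a s), norm_truncLp_le j (a s)]
    have hint : ∀ j, IntegrableOn (fun s => ‖truncLp j (a s) - a s‖) (Ioo 0 T) := fun j =>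
      Integrable.mono' (integrable_const (2 * L)) (hmeas j) (by simpa using hbd j)
    have hker := kernelBound_of_integral (T := T) hθ0 hθ1 hl.le hδ0 (H := 4 * L) (by positivity)
      (h := fun s => ‖truncLp (k + 1) (a s) - a s‖ + ‖truncLp (m + 1) (a s) - a s‖)
      ((hmeas _).add (hmeas _)) (fun s => by positivity)
      (by filter_upwards [hbd (k + 1), hbd (m + 1)] with s h1 h2; linarith)
    rw [integral_add (hint _) (hint _)] at hker
    have hI : ∀ j, 0 ≤ ∫ s in Ioo 0 T, ‖truncLp j (a s) - a s‖ := fun j =>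
      integral_nonneg fun s => norm_nonneg _
    have hI1 := hI (k + 1)
    have hI2 := hI (m + 1)
    refine (heatBound_sub_of_truncated hσ' hσn hT hL ha haL hl hcond hM0 (by positivity) (hU1 k)
      (hU1 m) (hU2 k) (hU2 m) (hU3 k l hl hcond) (hU3 m l hl hcond) (fun s => ?_) hker).mono ?_
    · rw [← sub_sub_sub_cancel_right _ _ (a s)]
      exact norm_sub_le _ _
    · have h1 := hN k hk
      have h2 := hN m hm
      linarith
  have hexp : ∀ t ∈ Icc 0 T, Real.exp (l * t) ≤ Real.exp (l * T) := fun t ht =>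
    Real.exp_le_exp.2 (mul_le_mul_of_nonneg_left ht.2 hl.le)
  have hU0 : ∀ k, U k 0 = u₀ := by
    intro k
    rw [hU2 k 0 ⟨le_rfl, hT.le⟩]
    simp [heatLp_of_nonpos]
  have hex : ∀ t ∈ Icc 0 T, ∃ z, Tendsto (fun k => U k t) atTop (𝓝 z) := by
    intro t ht
    refine cauchySeq_tendsto_of_complete (Metric.cauchySeq_iff.2 fun ε hε => ?_)
    obtain ⟨N, hN⟩ := hcau (ε / 2 / Real.exp (l * T)) (by positivity)
    refine ⟨N, fun k hk m hm => ?_⟩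
    rw [dist_eq_norm]
    rcases ht.1.eq_or_lt with h0 | h0
    · rw [← h0, hU0, hU0, sub_self, norm_zero]; exact hε
    · have h3 := (hN k hk m hm t ⟨h0, ht.2⟩).1
      calc ‖U k t - U m t‖ ≤ ε / 2 / Real.exp (l * T) * Real.exp (l * t) := h3
        _ ≤ ε / 2 / Real.exp (l * T) * Real.exp (l * T) :=
          mul_le_mul_of_nonneg_left (hexp t ht) (by positivity)
        _ = ε / 2 := by field_simp
        _ < ε := half_lt_self hε
  choose! u hu using hex
  have hu0 : u 0 = u₀ := by
    refine tendsto_nhds_unique (hu 0 ⟨le_rfl, hT.le⟩) ?_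
    simp only [hU0]
    exact tendsto_const_nhds
  have hconv : ∀ ε, 0 < ε → ∀ᶠ k in atTop, HeatBound T ε l fun t => U k t - u t := by
    intro ε hε
    obtain ⟨N, hN⟩ := hcau ε hε
    filter_upwards [eventually_ge_atTop N] with k hk
    exact heatBound_of_tendsto (eventually_atTop.2 ⟨N, fun m hm => hN k hk m hm⟩)
      fun t ht => (hu t ht).const_sub _
  refine ⟨U, u, hU1, hU2, fun k => hU3 k l hl hcond, ?_, hu0, hu, hconv, fun l' hl' hc' =>
    heatBound_of_tendsto (Eventually.of_forall fun k => hU3 k l' hl' hc') hu⟩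
  have hunif : TendstoUniformlyOn U u atTop (Icc 0 T) := by
    rw [Metric.tendstoUniformlyOn_iff]
    intro ε hε
    filter_upwards [hconv (ε / 2 / Real.exp (l * T)) (by positivity)] with k hk t ht
    rw [dist_comm, dist_eq_norm]
    rcases ht.1.eq_or_lt with h0 | h0
    · rw [← h0, hU0, hu0, sub_self, norm_zero]; exact hε
    · calc ‖U k t - u t‖ ≤ ε / 2 / Real.exp (l * T) * Real.exp (l * t) := (hk t ⟨h0, ht.2⟩).1
        _ ≤ ε / 2 / Real.exp (l * T) * Real.exp (l * T) :=
          mul_le_mul_of_nonneg_left (hexp t ht) (by positivity)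
        _ = ε / 2 := by field_simp
        _ < ε := half_lt_self hε
  exact hunif.continuousOn (Eventually.of_forall hU1).frequently

end Limit

section WeakEquation

open Filter Topology

variable {n : ℕ} {σ γ : ℝ≥0∞} [hσ : Fact (1 ≤ σ)] [hγ : Fact (1 ≤ γ)]

/-- The pairing with the slices of a test function is jointly continuous. -/
lemma continuous_integral_mul_slice {Φ : ℝ × EuclideanSpace ℝ (Fin n) → ℝ} (hΦ : Continuous Φ)
    (hc : HasCompactSupport Φ) :
    Continuous fun r : ℝ × LpE n γ => ∫ x, r.2 x * Φ (r.1, x) := by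
  have : γ.HolderConjugate (ENNReal.conjExponent γ) := .conjExponent hγ.out
  obtain ⟨B, hB0, hB⟩ := exists_slice_bound hΦ hc (ENNReal.conjExponent γ)
  have hleft : ∀ z : LpE n γ, Continuous fun t => ∫ x, z x * Φ (t, x) := by
    intro z
    rw [← continuousOn_univ]
    have hK := hc.isCompact.image continuous_snd
    refine continuousOn_integral_bilinear_of_locally_integrable_of_compact_support
      (ContinuousLinearMap.mul ℝ ℝ) (f := fun t x => Φ (t, x)) (g := fun x => z x) hK
      hΦ.continuousOn (fun t x _ hx => ?_) ((locallyIntegrable_coe z).integrableOn_isCompact hK)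
    by_contra h
    exact hx ⟨(t, x), subset_tsupport _ h, rfl⟩
  rw [continuous_iff_continuousAt]
  rintro ⟨t, z⟩
  rw [ContinuousAt, tendsto_iff_norm_sub_tendsto_zero]
  have h1 : Tendsto (fun r : ℝ × LpE n γ =>
      ‖r.2 - z‖ * B + ‖(∫ x, z x * Φ (r.1, x)) - ∫ x, z x * Φ (t, x)‖) (𝓝 (t, z)) (𝓝 0) := by
    have : Continuous fun r : ℝ × LpE n γ =>
        ‖r.2 - z‖ * B + ‖(∫ x, z x * Φ (r.1, x)) - ∫ x, z x * Φ (t, x)‖ :=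
      ((continuous_snd.sub continuous_const).norm.mul continuous_const).add
        ((((hleft z).comp continuous_fst).sub continuous_const).norm)
    simpa using this.tendsto (t, z)
  refine squeeze_zero (fun _ => norm_nonneg _) (fun r => ?_) h1
  have e : (∫ x, r.2 x * Φ (r.1, x)) = (∫ x, (r.2 - z : LpE n γ) x * Φ (r.1, x)) +
      ∫ x, z x * Φ (r.1, x) := by
    rw [← pairCLM_apply (hB r.1).1, ← pairCLM_apply (hB r.1).1, ← pairCLM_apply (hB r.1).1,
      ← map_add, sub_add_cancel]
  rw [e, add_sub_assoc]
  refine (norm_add_le _ _).trans (add_le_add_left ?_ _)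
  exact (abs_integral_mul_le _ _ (hB r.1).1).trans
    (mul_le_mul_of_nonneg_left (hB r.1).2 (norm_nonneg _))

/-- The Duhamel formula implies the weak formulation. -/
lemma weak_formulation_of_duhamel [hγ' : Fact (γ ≠ ∞)] {T : ℝ} (hT : 0 < T) {u₀ : LpE n γ}
    {u g : ℝ → LpE n γ}
    (hg : AEStronglyMeasurable g (volume.restrict (Ioo 0 T))) {B : ℝ}
    (hB : ∀ s ∈ Ioo 0 T, ‖g s‖ ≤ B)
    (hu : ∀ t ∈ Icc 0 T, u t = heatLp t u₀ - ∫ s in Ioo 0 t, heatLp (t - s) (g s))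
    {φ : ℝ × EuclideanSpace ℝ (Fin n) → ℝ} (hφ : ContDiff ℝ (⊤ : ℕ∞) φ) (hc : HasCompactSupport φ)
    (hsupp : tsupport φ ⊆ Ioo 0 T ×ˢ univ) :
    ∫ t in Ioo 0 T, ∫ x, u t x * backHeat φ (t, x) = ∫ t in Ioo 0 T, ∫ x, g t x * φ (t, x) := by
  have : γ.HolderConjugate (ENNReal.conjExponent γ) := .conjExponent hγ.out
  have hΦ := (contDiff_backHeat hφ).continuous
  have hΦc := hasCompactSupport_backHeat hφ hc
  obtain ⟨D, hD0, hD⟩ := exists_slice_bound hΦ hΦc (ENNReal.conjExponent γ)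
  have hpair := continuous_integral_mul_slice (γ := γ) hΦ hΦc
  have hzero : ∀ t x, t ∉ Ioo 0 T → φ (t, x) = 0 := by
    intro t x ht
    by_contra h
    exact ht (hsupp (subset_tsupport _ h)).1
  set G : ℝ → ℝ → ℝ := fun t s => (Ioi s).indicator
    (fun t => ∫ x, heatLp (t - s) (g s) x * backHeat φ (t, x)) t with hG
  have hGint : Integrable (Function.uncurry G)
      ((volume.restrict (Ioo 0 T)).prod (volume.restrict (Ioo 0 T))) := by
    refine Integrable.mono' (integrable_const (B * D)) ?_ ?_
    · have h1 : Function.uncurry G = {r : ℝ × ℝ | r.2 < r.1}.indicator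
          fun r => ∫ x, heatLp (r.1 - r.2) (g r.2) x * backHeat φ (r.1, x) := by
        ext ⟨t, s⟩
        simp [G, Function.uncurry, indicator]
      rw [h1]
      refine AEStronglyMeasurable.indicator ?_ (measurableSet_lt measurable_snd measurable_fst)
      have hg2 : AEStronglyMeasurable (fun r : ℝ × ℝ => g r.2)
          ((volume.restrict (Ioo 0 T)).prod (volume.restrict (Ioo 0 T))) := hg.comp_snd
      have h2 := continuous_heatLp.comp_aestronglyMeasurable
        ((by fun_prop : Continuous fun r : ℝ × ℝ => r.1 - r.2).aestronglyMeasurable.prodMk hg2)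
      exact hpair.comp_aestronglyMeasurable (continuous_fst.aestronglyMeasurable.prodMk h2)
    · rw [Measure.prod_restrict]
      filter_upwards [ae_restrict_mem (measurableSet_Ioo.prod measurableSet_Ioo)] with r hr
      have hB0 : 0 ≤ B := (norm_nonneg _).trans (hB r.2 hr.2)
      have h3 : ‖Function.uncurry G r‖ ≤
          ‖∫ x, heatLp (r.1 - r.2) (g r.2) x * backHeat φ (r.1, x)‖ :=
        norm_indicator_le_norm_self (fun t => ∫ x, heatLp (t - r.2) (g r.2) x * backHeat φ (t, x)) _
      refine h3.trans ?_
      exact (abs_integral_mul_le _ _ (hD r.1).1).trans (mul_le_mul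
        ((norm_heatLp_le _ _).trans (hB r.2 hr.2)) (hD r.1).2 ENNReal.toReal_nonneg hB0)
  have hfirst : ∫ t in Ioo 0 T, ∫ x, heatLp t u₀ x * backHeat φ (t, x) = 0 := by
    have h := integral_heatLp_mul_test (q := ENNReal.conjExponent γ) hφ hc u₀ 0 hT.le
    simp only [zero_add] at h
    rw [intervalIntegral.integral_of_le hT.le, integral_Ioc_eq_integral_Ioo] at h
    rw [← h]
    simp [hzero 0 _ (by simp), hzero T _ (by simp)]
  have hsecond : ∀ s ∈ Ioo 0 T, ∫ t in Ioo 0 T, G t s = -∫ x, g s x * φ (s, x) := by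
    intro s hs
    have h := integral_heatLp_mul_test (q := ENNReal.conjExponent γ) hφ hc (g s) s
      (sub_nonneg.2 hs.2.le)
    rw [add_sub_cancel] at h
    simp only [hzero T _ (by simp), mul_zero, integral_zero, zero_sub] at h
    rw [h]
    simp only [G]
    have e1 := intervalIntegral.integral_comp_add_left (a := 0) (b := T - s)
      (fun t => ∫ x, heatLp (t - s) (g s) x * backHeat φ (t, x)) s
    simp only [add_sub_cancel_left, add_zero, add_sub_cancel] at e1
    rw [e1, intervalIntegral.integral_of_le hs.2.le, integral_Ioc_eq_integral_Ioo,
      setIntegral_indicator measurableSet_Ioi]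
    congr 2
    ext t
    simp only [mem_inter_iff, mem_Ioo, mem_Ioi]
    constructor
    · rintro ⟨⟨h1, h2⟩, h3⟩; exact ⟨h3, h2⟩
    · rintro ⟨h1, h2⟩; exact ⟨⟨hs.1.trans h1, h2⟩, h1⟩
  have hsplit : ∀ t ∈ Ioo 0 T, ∫ x, u t x * backHeat φ (t, x) =
      (∫ x, heatLp t u₀ x * backHeat φ (t, x)) - ∫ s in Ioo 0 T, G t s := by
    intro t ht
    rw [hu t (Ioo_subset_Icc_self ht), ← pairCLM_apply (hD t).1, map_sub, pairCLM_apply,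
      ← ContinuousLinearMap.integral_comp_comm _
      (integrableOn_duhamel continuous_heatLp norm_heatLp_le hg hB ht.2.le)]
    congr 1
    have e2 : ∀ s, G t s = (Iio t).indicator
        (fun s => ∫ x, heatLp (t - s) (g s) x * backHeat φ (t, x)) s := by
      intro s
      simp [G, indicator]
    simp only [e2, pairCLM_apply]
    rw [setIntegral_indicator measurableSet_Iio]
    congr 2
    ext s
    simp only [mem_inter_iff, mem_Ioo, mem_Iio]
    constructor
    · rintro ⟨h1, h2⟩; exact ⟨⟨h1, h2.trans ht.2⟩, h2⟩
    · rintro ⟨⟨h1, h2⟩, h3⟩; exact ⟨h1, h3⟩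
  rw [setIntegral_congr_fun measurableSet_Ioo hsplit, integral_sub, hfirst, zero_sub,
    integral_integral_swap hGint, setIntegral_congr_fun measurableSet_Ioo hsecond, integral_neg,
    neg_neg]
  · have hcont : Continuous fun t => ∫ x, heatLp t u₀ x * backHeat φ (t, x) :=
      hpair.comp (continuous_id.prodMk (continuous_heatLp_left u₀))
    exact (hcont.continuousOn.integrableOn_compact isCompact_Icc).mono_set Ioo_subset_Icc_self
  · exact hGint.integral_prod_left

/-- A bound for the potential term when all factors are bounded. -/
lemma lintegral_potential_le_of_bounded (hσ' : σ ≠ ∞) (γ' : ℝ≥0∞) [γ.HolderConjugate γ']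
    (b : LpE n σ) (z : LpE n γ) {ψ : EuclideanSpace ℝ (Fin n) → ℝ}
    (hψ : AEStronglyMeasurable ψ volume) {A B : ℝ} (hA : 0 ≤ A) (hB : 0 ≤ B) (hz : ‖z‖ ≤ A)
    (hz' : eLpNorm z ∞ volume ≤ ENNReal.ofReal A) (h1 : eLpNorm ψ γ' volume ≤ ENNReal.ofReal B)
    (h2 : eLpNorm ψ ∞ volume ≤ ENNReal.ofReal B) :
    ∫⁻ x, ‖b x * (z x * ψ x)‖ₑ ≤ ENNReal.ofReal (‖b‖ * (A * B)) := by
  have hzA : eLpNorm z γ volume ≤ ENNReal.ofReal A := by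
    rw [← ENNReal.ofReal_toReal (Lp.eLpNorm_ne_top z), ← Lp.norm_def]
    exact ENNReal.ofReal_le_ofReal hz
  have h := lintegral_potential_le hσ' b (g := fun x => z x * ψ x)
    ((Lp.aestronglyMeasurable z).mul hψ) (X := A * B) (Y := 1) (by positivity) zero_le_one
    (eLpNorm_mul_one_le γ' (Lp.aestronglyMeasurable z) hψ hA hzA h1)
    (by rw [mul_one]; exact eLpNorm_mul_top_le (Lp.aestronglyMeasurable z) hψ hA hz' h2)
  simpa using h

lemma tendsto_integral_truncLp_mul (b : LpE n σ) {f : EuclideanSpace ℝ (Fin n) → ℝ}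
    (hf : AEStronglyMeasurable f volume) (hint : Integrable fun x => b x * f x) :
    Tendsto (fun k => ∫ x, truncLp k b x * f x) atTop (𝓝 (∫ x, b x * f x)) := by
  refine tendsto_integral_of_dominated_convergence (fun x => ‖b x * f x‖)
    (fun k => (Lp.aestronglyMeasurable _).mul hf) hint.norm (fun k => ?_) ?_
  · filter_upwards [coeFn_truncLp k b] with x hx
    rw [hx, norm_mul, norm_mul]
    exact mul_le_mul_of_nonneg_right (abs_truncReal_le_abs _ _) (norm_nonneg _)
  · have h := ae_all_iff.2 fun k => coeFn_truncLp k b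
    filter_upwards [h] with x hx
    simp only [hx]
    exact (tendsto_truncReal (b x)).mul_const _

variable [hγ' : Fact (γ ≠ ∞)]

/-- The weak formulation, separated into the heat part and the potential part. -/
lemma integral_weak_form_eq {T N : ℝ} {a : ℝ → LpE n σ}
    (ha : AEStronglyMeasurable a (volume.restrict (Ioo 0 T))) {u : ℝ → LpE n γ}
    (hu : ContinuousOn u (Icc 0 T)) {φ : ℝ × EuclideanSpace ℝ (Fin n) → ℝ}
    (hφ : ContDiff ℝ (⊤ : ℕ∞) φ) (hc : HasCompactSupport φ) (hN0 : 0 ≤ N)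
    (hN : ∀ᵐ t ∂(volume.restrict (Ioo 0 T)),
      ∫⁻ x, ‖a t x * (u t x * φ (t, x))‖ₑ ≤ ENNReal.ofReal N) :
    ∫ t in Ioo 0 T, ∫ x,
      (u t x * (-deriv (fun s => φ (s, x)) t - Laplacian.laplacian (fun y => φ (t, y)) x)
        + a t x * u t x * φ (t, x)) =
      (∫ t in Ioo 0 T, ∫ x, a t x * (u t x * φ (t, x))) -
        ∫ t in Ioo 0 T, ∫ x, u t x * backHeat φ (t, x) := by
  have : γ.HolderConjugate (ENNReal.conjExponent γ) := .conjExponent hγ.out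
  have hΦ := (contDiff_backHeat hφ).continuous
  have hΦc := hasCompactSupport_backHeat hφ hc
  obtain ⟨D, hD0, hD⟩ := exists_slice_bound hΦ hΦc (ENNReal.conjExponent γ)
  have hmeas : ∀ t, AEStronglyMeasurable (fun x => u t x * φ (t, x)) volume := fun t =>
    (Lp.aestronglyMeasurable _).mul (contDiff_slice hφ t).continuous.aestronglyMeasurable
  have hint : ∀ᵐ t ∂(volume.restrict (Ioo 0 T)), Integrable fun x => a t x * (u t x * φ (t, x)) := by
    filter_upwards [hN] with t ht
    exact ⟨(Lp.aestronglyMeasurable _).mul (hmeas t), ht.trans_lt ENNReal.ofReal_lt_top⟩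
  have hJ : IntegrableOn (fun t => ∫ x, a t x * (u t x * φ (t, x))) (Ioo 0 T) := by
    refine Integrable.mono' (integrable_const N) ?_ ?_
    · refine aestronglyMeasurable_of_tendsto_ae atTop
        (f := fun k t => ∫ x, truncLp k (a t) x * (u t x * φ (t, x))) (fun k => ?_) ?_
      · simp only [← integral_mulTrunc_mul]
        exact (continuous_integral_mul_slice hφ.continuous hc).comp_aestronglyMeasurable
          (continuous_id.aestronglyMeasurable.prodMk (aestronglyMeasurable_mulTrunc ha k hu))
      · filter_upwards [hint] with t ht
        exact tendsto_integral_truncLp_mul (a t) (hmeas t) ht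
    · filter_upwards [hN] with t ht
      exact abs_integral_le_of_lintegral_enorm_le hN0 ht
  have hP : IntegrableOn (fun t => ∫ x, u t x * backHeat φ (t, x)) (Ioo 0 T) := by
    have : ContinuousOn (fun t => ∫ x, u t x * backHeat φ (t, x)) (Icc 0 T) :=
      (continuous_integral_mul_slice hΦ hΦc).comp_continuousOn (continuousOn_id.prodMk hu)
    exact (this.integrableOn_compact isCompact_Icc).mono_set Ioo_subset_Icc_self
  rw [← integral_sub hJ hP]
  refine integral_congr_ae ?_
  filter_upwards [hint] with t ht
  rw [← integral_sub ht (integrable_coe_mul _ _ (hD t).1)]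
  congr 1
  ext x
  simp only [backHeat]
  ring

/-- The time support of a test function is bounded away from the endpoints. -/
lemma exists_Icc_of_tsupport_subset {T : ℝ} (hT : 0 < T)
    {φ : ℝ × EuclideanSpace ℝ (Fin n) → ℝ} (hc : HasCompactSupport φ)
    (hsupp : tsupport φ ⊆ Ioo 0 T ×ˢ univ) :
    ∃ t₀ t₁, 0 < t₀ ∧ t₀ ≤ t₁ ∧ t₁ < T ∧ ∀ t x, t ∉ Icc t₀ t₁ → φ (t, x) = 0 := by
  have hK : IsCompact (Prod.fst '' tsupport φ) := hc.isCompact.image continuous_fst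
  have hsub : Prod.fst '' tsupport φ ⊆ Ioo 0 T := by
    rintro _ ⟨r, hr, rfl⟩
    exact (hsupp hr).1
  have hmem : ∀ t x, φ (t, x) ≠ 0 → t ∈ Prod.fst '' tsupport φ := fun t x h =>
    ⟨(t, x), subset_tsupport _ h, rfl⟩
  rcases (Prod.fst '' tsupport φ).eq_empty_or_nonempty with h | h
  · refine ⟨T / 2, T / 2, by linarith, le_rfl, by linarith, fun t x _ => ?_⟩
    by_contra h2
    have := hmem t x h2
    rw [h] at this
    exact this
  · refine ⟨sInf _, sSup _, (hsub (hK.sInf_mem h)).1, csInf_le hK.bddBelow (hK.sSup_mem h),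
      (hsub (hK.sSup_mem h)).2, fun t x ht => ?_⟩
    by_contra h2
    have := hmem t x h2
    exact ht ⟨csInf_le hK.bddBelow this, le_csSup hK.bddAbove this⟩

/-- The limit of the truncated solutions solves the equation. -/
lemma exists_solution (hσ' : σ ≠ ∞) (hσn : (n : ℝ) / 2 < σ.toReal) {T L : ℝ} (hT : 0 < T)
    (hL : 0 ≤ L) {a : ℝ → LpE n σ} (ha : AEStronglyMeasurable a (volume.restrict (Ioo 0 T)))
    (haL : ∀ᵐ s ∂(volume.restrict (Ioo 0 T)), ‖a s‖ ≤ L) (u₀ : LpE n γ)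
    {l : ℝ} (hl : 0 < l) (hcond : WeightCondition n σ γ L l) :
    ∃ u : ℝ → LpE n γ, IsHeatPotentialSolution T a u₀ u ∧
      ∀ l, 0 < l → WeightCondition n σ γ L l →
        HeatBound T (2 * (2 ^ ((n : ℝ) / (2 * γ.toReal)) * ‖u₀‖)) l u := by
  obtain ⟨U, u, hUc, hU, hUb, huc, hu0, hlim, hconv, hub⟩ :=
    exists_limit_solution hσ' hσn hT hL ha haL u₀ hl hcond
  have hul := hub l hl hcond
  set M := 2 * (2 ^ ((n : ℝ) / (2 * γ.toReal)) * ‖u₀‖) with hM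
  have hM0 : 0 ≤ M := by positivity
  set κ := (n : ℝ) / (2 * γ.toReal) with hκ
  have hκ0 : 0 ≤ κ := by positivity
  -- a uniform bound away from the initial time
  have hunif : ∀ t₀, 0 < t₀ → ∀ (M' : ℝ) (w : ℝ → LpE n γ), 0 ≤ M' → HeatBound T M' l w →
      ∀ t ∈ Icc t₀ T, ‖w t‖ ≤ M' * (Real.exp (l * T) * (1 + t₀ ^ (-κ))) ∧
        eLpNorm (w t) ∞ volume ≤ ENNReal.ofReal (M' * (Real.exp (l * T) * (1 + t₀ ^ (-κ)))) := by
    intro t₀ ht₀ M' w hM' hw t ht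
    have ht0 : 0 < t := ht₀.trans_le ht.1
    have he : Real.exp (l * t) ≤ Real.exp (l * T) :=
      Real.exp_le_exp.2 (mul_le_mul_of_nonneg_left ht.2 hl.le)
    have hp : t ^ (-κ) ≤ t₀ ^ (-κ) :=
      Real.rpow_le_rpow_of_nonpos ht₀ ht.1 (neg_nonpos.2 hκ0)
    have hp0 : 0 ≤ t₀ ^ (-κ) := by positivity
    have h := hw t ⟨ht0, ht.2⟩
    refine ⟨h.1.trans ?_, h.2.trans (ENNReal.ofReal_le_ofReal ?_)⟩
    · refine mul_le_mul_of_nonneg_left (he.trans ?_) hM'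
      exact le_mul_of_one_le_right (Real.exp_pos _).le (by linarith)
    · rw [mul_assoc]
      refine mul_le_mul_of_nonneg_left ?_ hM'
      exact mul_le_mul he (hp.trans (by linarith)) (by positivity) (Real.exp_pos _).le
  refine ⟨u, ⟨huc, fun K hK hKT => ?_, hu0, fun φ hφ hc hsupp => ?_⟩, hub⟩
  · rcases K.eq_empty_or_nonempty with rfl | hne
    · exact ⟨0, by simp⟩
    refine ⟨_, (ae_restrict_iff' hK.measurableSet).2 (Eventually.of_forall fun t ht =>
      (hunif (sInf K) (hKT (hK.sInf_mem hne)).1 M u hM0 hul t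
        ⟨csInf_le hK.bddBelow ht, (hKT ht).2.le⟩).2)⟩
  have : γ.HolderConjugate (ENNReal.conjExponent γ) := .conjExponent hγ.out
  obtain ⟨t₀, t₁, ht₀, -, -, hzero⟩ := exists_Icc_of_tsupport_subset hT hc hsupp
  obtain ⟨B₁, hB₁0, hB₁⟩ := exists_slice_bound hφ.continuous hc (ENNReal.conjExponent γ)
  obtain ⟨B₂, hB₂0, hB₂⟩ := exists_slice_bound hφ.continuous hc ∞
  have hB : ∀ t q B, MemLp (fun x => φ (t, x)) q volume ∧
      (eLpNorm (fun x => φ (t, x)) q volume).toReal ≤ B → B ≤ max B₁ B₂ →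
      eLpNorm (fun x => φ (t, x)) q volume ≤ ENNReal.ofReal (max B₁ B₂) := by
    intro t q B h1 h2
    rw [← ENNReal.ofReal_toReal h1.1.2.ne]
    exact ENNReal.ofReal_le_ofReal (h1.2.trans h2)
  set B := max B₁ B₂ with hBdef
  have hB0 : 0 ≤ B := le_max_of_le_left hB₁0
  set E := Real.exp (l * T) * (1 + t₀ ^ (-κ)) with hE
  have hE0 : 0 ≤ E := by positivity
  have hpot : ∀ (M' : ℝ) (w : ℝ → LpE n γ), 0 ≤ M' → HeatBound T M' l w → ∀ t ∈ Ioo 0 T,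
      ∀ b : LpE n σ, ∫⁻ x, ‖b x * (w t x * φ (t, x))‖ₑ ≤ ENNReal.ofReal (‖b‖ * (M' * E * B)) := by
    intro M' w hM' hw t ht b
    by_cases h : t ∈ Icc t₀ t₁
    · have h1 := hunif t₀ ht₀ M' w hM' hw t ⟨h.1, ht.2.le⟩
      exact lintegral_potential_le_of_bounded hσ' (ENNReal.conjExponent γ) b (w t)
        (contDiff_slice hφ t).continuous.aestronglyMeasurable (by positivity) hB0 h1.1 h1.2
        (hB t _ _ (hB₁ t) (le_max_left _ _)) (hB t _ _ (hB₂ t) (le_max_right _ _))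
    · simp [hzero t _ h]
  have hN : ∀ᵐ t ∂(volume.restrict (Ioo 0 T)),
      ∫⁻ x, ‖a t x * (u t x * φ (t, x))‖ₑ ≤ ENNReal.ofReal (L * (M * E * B)) := by
    filter_upwards [haL, ae_restrict_mem measurableSet_Ioo] with t h1 h2
    refine (hpot M u hM0 hul t h2 (a t)).trans (ENNReal.ofReal_le_ofReal ?_)
    gcongr
  rw [integral_weak_form_eq ha huc hφ hc (by positivity) hN, sub_eq_zero]
  have hΦ := (contDiff_backHeat hφ).continuous
  have hΦc := hasCompactSupport_backHeat hφ hc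
  obtain ⟨D, hD0, hD⟩ := exists_slice_bound hΦ hΦc (ENNReal.conjExponent γ)
  have heq : ∀ k, ∫ t in Ioo 0 T, ∫ x, U k t x * backHeat φ (t, x) =
      ∫ t in Ioo 0 T, ∫ x, truncLp (k + 1) (a t) x * (U k t x * φ (t, x)) := by
    intro k
    obtain ⟨B, _, hB⟩ := exists_bound_mulTrunc hT.le a (k + 1) (hUc k)
    rw [weak_formulation_of_duhamel hT (aestronglyMeasurable_mulTrunc ha (k + 1) (hUc k)) hB (hU k)
      hφ hc hsupp]
    simp only [integral_mulTrunc_mul]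
  have hlim1 : Tendsto (fun k => ∫ t in Ioo 0 T, ∫ x, U k t x * backHeat φ (t, x)) atTop
      (𝓝 (∫ t in Ioo 0 T, ∫ x, u t x * backHeat φ (t, x))) := by
    refine tendsto_integral_of_dominated_convergence (fun _ => M * Real.exp (l * T) * D)
      (fun k => ?_) (integrable_const _) (fun k => ?_) ?_
    · have : ContinuousOn (fun t => ∫ x, U k t x * backHeat φ (t, x)) (Icc 0 T) :=
        (continuous_integral_mul_slice hΦ hΦc).comp_continuousOn (continuousOn_id.prodMk (hUc k))
      exact (this.mono Ioo_subset_Icc_self).aestronglyMeasurable measurableSet_Ioo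
    · filter_upwards [ae_restrict_mem measurableSet_Ioo] with t ht
      refine (abs_integral_mul_le _ _ (hD t).1).trans (mul_le_mul ?_ (hD t).2
        ENNReal.toReal_nonneg (by positivity))
      refine (hUb k t (Ioo_subset_Ioc_self ht)).1.trans (mul_le_mul_of_nonneg_left ?_ hM0)
      exact Real.exp_le_exp.2 (mul_le_mul_of_nonneg_left ht.2.le hl.le)
    · filter_upwards [ae_restrict_mem measurableSet_Ioo] with t ht
      exact ((pairCLM (hD t).1).continuous.tendsto _).comp (hlim t (Ioo_subset_Icc_self ht))
  have hlim2 : Tendsto (fun k => ∫ t in Ioo 0 T, ∫ x,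
      truncLp (k + 1) (a t) x * (U k t x * φ (t, x))) atTop
      (𝓝 (∫ t in Ioo 0 T, ∫ x, a t x * (u t x * φ (t, x)))) := by
    refine tendsto_integral_of_dominated_convergence (fun _ => L * (M * E * B))
      (fun k => ?_) (integrable_const _) (fun k => ?_) ?_
    · simp only [← integral_mulTrunc_mul]
      exact (continuous_integral_mul_slice hφ.continuous hc).comp_aestronglyMeasurable
        (continuous_id.aestronglyMeasurable.prodMk
          (aestronglyMeasurable_mulTrunc ha (k + 1) (hUc k)))
    · filter_upwards [haL, ae_restrict_mem measurableSet_Ioo] with t h1 h2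
      refine (abs_integral_le_of_lintegral_enorm_le (by positivity)
        (hpot M (U k) hM0 (hUb k) t h2 _)).trans ?_
      have := (norm_truncLp_le (k + 1) (a t)).trans h1
      gcongr
    · filter_upwards [haL, ae_restrict_mem measurableSet_Ioo] with t h1 h2
      have hmeas : ∀ z : LpE n γ, AEStronglyMeasurable (fun x => z x * φ (t, x)) volume := fun z =>
        (Lp.aestronglyMeasurable _).mul (contDiff_slice hφ t).continuous.aestronglyMeasurable
      have hia : Integrable fun x => a t x * (u t x * φ (t, x)) :=
        ⟨(Lp.aestronglyMeasurable _).mul (hmeas _),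
          (hpot M u hM0 hul t h2 _).trans_lt ENNReal.ofReal_lt_top⟩
      have hl1 := (tendsto_integral_truncLp_mul (a t) (hmeas (u t)) hia).comp
        (tendsto_add_atTop_nat 1)
      have hl2 : Tendsto (fun k => ∫ x, truncLp (k + 1) (a t) x *
          ((U k t - u t : LpE n γ) x * φ (t, x))) atTop (𝓝 0) := by
        rw [Metric.tendsto_nhds]
        intro ε hε
        filter_upwards [hconv (ε / 2 / (1 + L * (E * B))) (by positivity)] with k hk
        rw [dist_zero_right]
        have h3 := abs_integral_le_of_lintegral_enorm_le (by positivity)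
          (hpot _ _ (by positivity) hk t h2 (truncLp (k + 1) (a t)))
        refine (h3.trans ?_).trans_lt (half_lt_self hε)
        have h4 := (norm_truncLp_le (k + 1) (a t)).trans h1
        calc ‖truncLp (k + 1) (a t)‖ * (ε / 2 / (1 + L * (E * B)) * E * B)
            ≤ L * (ε / 2 / (1 + L * (E * B)) * E * B) := by gcongr
          _ = ε / 2 * (L * (E * B) / (1 + L * (E * B))) := by ring
          _ ≤ ε / 2 * 1 := by
            gcongr
            rw [div_le_one (by positivity)]; linarith
          _ = ε / 2 := mul_one _
      have hadd := hl1.add hl2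
      rw [add_zero] at hadd
      refine hadd.congr fun k => ?_
      simp only [Function.comp, ← integral_mulTrunc_mul]
      rw [mulTrunc_sub, ← pairCLM_apply (hB₁ t).1, ← pairCLM_apply (hB₁ t).1,
        ← pairCLM_apply (hB₁ t).1, ← map_add, add_sub_cancel]
  exact tendsto_nhds_unique hlim2 (hlim1.congr heq)

end WeakEquation

section WeakDerivative

open Filter Topology Real

lemma deriv_smoothTransition_eq_zero {r : ℝ} (hr : r ∉ Icc 0 1) :
    deriv smoothTransition r = 0 := by
  rw [mem_Icc, not_and_or, not_le, not_le] at hr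
  rcases hr with h | h
  · have : smoothTransition =ᶠ[𝓝 r] fun _ => 0 := by
      filter_upwards [gt_mem_nhds h] with x hx using smoothTransition.zero_of_nonpos hx.le
    rw [this.deriv_eq, deriv_const]
  · have : smoothTransition =ᶠ[𝓝 r] fun _ => 1 := by
      filter_upwards [lt_mem_nhds h] with x hx using smoothTransition.one_of_one_le hx.le
    rw [this.deriv_eq, deriv_const]

lemma continuous_deriv_smoothTransition : Continuous (deriv smoothTransition) :=
  (smoothTransition.contDiff (n := 1)).continuous_deriv le_rfl

lemma hasDerivAt_smoothTransition (r : ℝ) :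
    HasDerivAt smoothTransition (deriv smoothTransition r) r :=
  (((smoothTransition.contDiff (n := 1)).differentiable (by simp)) r).hasDerivAt

lemma integral_deriv_smoothTransition : ∫ r, deriv smoothTransition r = 1 := by
  rw [← setIntegral_eq_integral_of_forall_compl_eq_zero
      (fun r hr => deriv_smoothTransition_eq_zero hr), integral_Icc_eq_integral_Ioc,
    ← intervalIntegral.integral_of_le zero_le_one, intervalIntegral.integral_deriv_eq_sub]
  · simp
  · exact fun r _ => (hasDerivAt_smoothTransition r).differentiableAt
  · exact continuous_deriv_smoothTransition.intervalIntegrable _ _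

/-- Averages against a concentrating profile converge. -/
lemma tendsto_integral_profile {F : ℝ → ℝ} (hF : Continuous F) {C : ℝ} (hC : ∀ s, |F s| ≤ C)
    {δ : ℕ → ℝ} (hδ : Tendsto δ atTop (𝓝 0)) (c : ℝ) (ε : ℝ) :
    Tendsto (fun k => ∫ r, deriv smoothTransition r * F (c + ε * (δ k + δ k * r))) atTop
      (𝓝 (F c)) := by
  have hint : Integrable (deriv smoothTransition) :=
    continuous_deriv_smoothTransition.integrable_of_hasCompactSupport
      (HasCompactSupport.intro isCompact_Icc fun r hr => deriv_smoothTransition_eq_zero hr)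
  have h := tendsto_integral_of_dominated_convergence (μ := volume)
    (F := fun k r => deriv smoothTransition r * F (c + ε * (δ k + δ k * r)))
    (f := fun r => deriv smoothTransition r * F c) (fun r => |deriv smoothTransition r| * C)
    (fun k => (continuous_deriv_smoothTransition.mul
      (hF.comp (by fun_prop))).aestronglyMeasurable) (hint.norm.mul_const C)
    (fun k => Eventually.of_forall fun r => by
      rw [norm_mul]; exact mul_le_mul_of_nonneg_left (hC _) (abs_nonneg _))
    (Eventually.of_forall fun r => ?_)
  · rwa [integral_mul_const, integral_deriv_smoothTransition, one_mul] at h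
  · refine Tendsto.const_mul _ ((hF.tendsto c).comp ?_)
    simpa using ((hδ.add (hδ.mul_const r)).const_mul ε).const_add c

/-- A continuous function whose weak derivative is integrable is its primitive. -/
lemma integral_eq_sub_of_weak_deriv {α β : ℝ} (hαβ : α < β) {F H : ℝ → ℝ}
    (hF : ContinuousOn F (Icc α β)) (hH : IntegrableOn H (Ioo α β))
    (hweak : ∀ η : ℝ → ℝ, ContDiff ℝ (⊤ : ℕ∞) η → HasCompactSupport η → tsupport η ⊆ Ioo α β →
      ∫ s in Ioo α β, deriv η s * F s = ∫ s in Ioo α β, η s * H s) :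
    ∫ s in Ioo α β, H s = F α - F β := by
  set F' : ℝ → ℝ := IccExtend hαβ.le ((Icc α β).domRestrict F) with hF'
  have hF'c : Continuous F' := (continuousOn_iff_continuous_domRestrict.1 hF).Icc_extend'
  have hF'eq : ∀ s ∈ Icc α β, F' s = F s := fun s hs => by
    rw [hF', IccExtend_of_mem _ _ hs]; rfl
  obtain ⟨C, hC⟩ := isCompact_Icc.exists_bound_of_continuousOn hF
  have hF'C : ∀ s, |F' s| ≤ C := fun s => by
    rw [hF', IccExtend]
    exact hC _ (projIcc α β hαβ.le s).2
  set δ : ℕ → ℝ := fun k => (β - α) / 4 / (k + 1) with hδ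
  have hδ0 : ∀ k, 0 < δ k := fun k => by
    have := sub_pos.2 hαβ
    simp only [hδ]; positivity
  have hδ4 : ∀ k, 4 * δ k ≤ β - α := fun k => by
    have h1 : δ k ≤ (β - α) / 4 := div_le_self (by linarith) (by linarith [k.cast_nonneg (α := ℝ)])
    linarith
  have hδlim : Tendsto δ atTop (𝓝 0) :=
    tendsto_const_nhds.div_atTop (tendsto_natCast_atTop_atTop.atTop_add tendsto_const_nhds)
  set η : ℕ → ℝ → ℝ := fun k s =>
    smoothTransition ((s - α - δ k) / δ k) * smoothTransition ((β - δ k - s) / δ k) with hη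
  have hηd : ∀ k s, HasDerivAt (η k) (deriv smoothTransition ((s - α - δ k) / δ k) / δ k -
      deriv smoothTransition ((β - δ k - s) / δ k) / δ k) s := by
    intro k s
    have hk := hδ0 k
    have h4 := hδ4 k
    have h1 : HasDerivAt (fun s => smoothTransition ((s - α - δ k) / δ k))
        (deriv smoothTransition ((s - α - δ k) / δ k) * (1 / δ k)) s :=
      (hasDerivAt_smoothTransition _).comp s
        ((((hasDerivAt_id s).sub_const α).sub_const (δ k)).div_const (δ k))
    have h2 : HasDerivAt (fun s => smoothTransition ((β - δ k - s) / δ k))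
        (deriv smoothTransition ((β - δ k - s) / δ k) * (-1 / δ k)) s :=
      (hasDerivAt_smoothTransition _).comp s (((hasDerivAt_id s).const_sub (β - δ k)).div_const (δ k))
    refine (h1.mul h2).congr_deriv ?_
    have e1 : deriv smoothTransition ((s - α - δ k) / δ k) *
        smoothTransition ((β - δ k - s) / δ k) = deriv smoothTransition ((s - α - δ k) / δ k) := by
      by_cases h : (s - α - δ k) / δ k ∈ Icc 0 1
      · rw [smoothTransition.one_of_one_le, mul_one]
        have := (div_le_one hk).1 h.2
        rw [one_le_div hk]; linarith
      · rw [deriv_smoothTransition_eq_zero h, zero_mul]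
    have e2 : smoothTransition ((s - α - δ k) / δ k) *
        deriv smoothTransition ((β - δ k - s) / δ k) =
        deriv smoothTransition ((β - δ k - s) / δ k) := by
      by_cases h : (β - δ k - s) / δ k ∈ Icc 0 1
      · rw [smoothTransition.one_of_one_le, one_mul]
        have := (div_le_one hk).1 h.2
        rw [one_le_div hk]; linarith
      · rw [deriv_smoothTransition_eq_zero h, mul_zero]
    linear_combination (1 / δ k) * e1 - (1 / δ k) * e2
  have hηsupp : ∀ k s, s ∉ Icc (α + δ k) (β - δ k) → η k s = 0 := by
    intro k s hs
    have hk := hδ0 k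
    rw [mem_Icc, not_and_or, not_le, not_le] at hs
    rcases hs with h | h
    · simp only [hη]
      rw [smoothTransition.zero_of_nonpos, zero_mul]
      exact div_nonpos_of_nonpos_of_nonneg (by linarith) hk.le
    · simp only [hη]
      rw [smoothTransition.zero_of_nonpos (x := (β - δ k - s) / δ k), mul_zero]
      exact div_nonpos_of_nonpos_of_nonneg (by linarith) hk.le
  have hηt : ∀ k, tsupport (η k) ⊆ Icc (α + δ k) (β - δ k) := fun k =>
    closure_minimal (fun s hs => by by_contra h; exact hs (hηsupp k s h)) isClosed_Icc
  have hIcc : ∀ k, Icc (α + δ k) (β - δ k) ⊆ Ioo α β := fun k s hs =>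
    ⟨by linarith [hs.1, hδ0 k], by linarith [hs.2, hδ0 k]⟩
  have hηc : ∀ k, ContDiff ℝ (⊤ : ℕ∞) (η k) := fun k =>
    (smoothTransition.contDiff.comp (by fun_prop)).mul (smoothTransition.contDiff.comp (by fun_prop))
  have hηcs : ∀ k, HasCompactSupport (η k) := fun k =>
    HasCompactSupport.intro isCompact_Icc (hηsupp k)
  have hleft : ∀ k, ∫ s in Ioo α β, deriv (η k) s * F s =
      (∫ r, deriv smoothTransition r * F' (α + 1 * (δ k + δ k * r))) -
        ∫ r, deriv smoothTransition r * F' (β + (-1) * (δ k + δ k * r)) := by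
    intro k
    have hk := hδ0 k
    have e1 : ∫ s in Ioo α β, deriv (η k) s * F s = ∫ s, deriv (η k) s * F' s := by
      refine Eq.trans ?_ (setIntegral_eq_integral_of_forall_compl_eq_zero (s := Ioo α β) ?_)
      · refine setIntegral_congr_fun measurableSet_Ioo fun s hs => ?_
        simp only [hF'eq s (Ioo_subset_Icc_self hs)]
      · intro s hs
        have h0 : deriv (η k) s = 0 := by
          by_contra h
          exact hs (hIcc k (hηt k (support_deriv_subset h)))
        rw [h0, zero_mul]
    have hcomp : ∀ (c e : ℝ), Integrable (fun s => deriv smoothTransition (c + e * s) * F' s) ∨ e = 0 := by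
      intro c e
      by_cases he : e = 0
      · exact Or.inr he
      left
      refine ((continuous_deriv_smoothTransition.comp (by fun_prop)).mul
        hF'c).integrable_of_hasCompactSupport ?_
      refine HasCompactSupport.mul_right ?_
      have h1 : HasCompactSupport (deriv smoothTransition) :=
        HasCompactSupport.intro isCompact_Icc fun r hr => deriv_smoothTransition_eq_zero hr
      exact h1.comp_homeomorph ((Homeomorph.mulLeft₀ e he).trans (Homeomorph.addLeft c))
    have hi1 : Integrable fun s => deriv smoothTransition ((s - α - δ k) / δ k) / δ k * F' s := by
      have h := (hcomp ((-α - δ k) / δ k) (1 / δ k)).resolve_right (by positivity)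
      refine (h.const_mul (1 / δ k)).congr (Eventually.of_forall fun s => ?_)
      simp only
      rw [show (-α - δ k) / δ k + 1 / δ k * s = (s - α - δ k) / δ k by ring]
      ring
    have hi2 : Integrable fun s => deriv smoothTransition ((β - δ k - s) / δ k) / δ k * F' s := by
      have h := (hcomp ((β - δ k) / δ k) (-1 / δ k)).resolve_right
        (div_ne_zero (by norm_num) hk.ne')
      refine (h.const_mul (1 / δ k)).congr (Eventually.of_forall fun s => ?_)
      simp only
      rw [show (β - δ k) / δ k + -1 / δ k * s = (β - δ k - s) / δ k by ring]
      ring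
    rw [e1]
    simp_rw [(hηd k _).deriv, sub_mul]
    rw [integral_sub hi1 hi2]
    congr 1
    · rw [← integral_add_left_eq_self _ (α + δ k)]
      have := Measure.integral_comp_mul_left (fun s => deriv smoothTransition
        ((α + δ k + s - α - δ k) / δ k) / δ k * F' (α + δ k + s)) (δ k)
      rw [abs_of_pos (by positivity), smul_eq_mul, eq_comm, inv_mul_eq_iff_eq_mul₀ hk.ne'] at this
      rw [this, ← integral_const_mul]
      congr 1; ext r
      rw [show (α + δ k + δ k * r - α - δ k) / δ k = r by field_simp; ring,
        show α + 1 * (δ k + δ k * r) = α + δ k + δ k * r by ring]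
      field_simp
    · rw [← integral_sub_left_eq_self _ volume (β - δ k)]
      have := Measure.integral_comp_mul_left (fun s => deriv smoothTransition
        ((β - δ k - (β - δ k - s)) / δ k) / δ k * F' (β - δ k - s)) (δ k)
      rw [abs_of_pos (by positivity), smul_eq_mul, eq_comm, inv_mul_eq_iff_eq_mul₀ hk.ne'] at this
      rw [this, ← integral_const_mul]
      congr 1; ext r
      rw [show (β - δ k - (β - δ k - δ k * r)) / δ k = r by field_simp; ring,
        show β + (-1) * (δ k + δ k * r) = β - δ k - δ k * r by ring]
      field_simp
  have hlim1 : Tendsto (fun k => ∫ s in Ioo α β, deriv (η k) s * F s) atTop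
      (𝓝 (F α - F β)) := by
    simp_rw [hleft]
    rw [← hF'eq α (left_mem_Icc.2 hαβ.le), ← hF'eq β (right_mem_Icc.2 hαβ.le)]
    exact (tendsto_integral_profile hF'c hF'C hδlim α 1).sub
      (tendsto_integral_profile hF'c hF'C hδlim β (-1))
  have hlim2 : Tendsto (fun k => ∫ s in Ioo α β, η k s * H s) atTop (𝓝 (∫ s in Ioo α β, H s)) := by
    refine tendsto_integral_of_dominated_convergence (fun s => |H s|)
      (fun k => (hηc k).continuous.aestronglyMeasurable.mul hH.1) hH.norm
      (fun k => Eventually.of_forall fun s => ?_) ?_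
    · rw [norm_mul]
      refine mul_le_of_le_one_left (norm_nonneg _) ?_
      rw [norm_mul, norm_of_nonneg (smoothTransition.nonneg _),
        norm_of_nonneg (smoothTransition.nonneg _)]
      exact mul_le_one₀ (smoothTransition.le_one _) (smoothTransition.nonneg _)
        (smoothTransition.le_one _)
    · filter_upwards [ae_restrict_mem measurableSet_Ioo] with s hs
      refine tendsto_const_nhds.congr' ?_
      have h1 := hδlim.eventually (gt_mem_nhds (show 0 < (s - α) / 2 by linarith [hs.1]))
      have h2 := hδlim.eventually (gt_mem_nhds (show 0 < (β - s) / 2 by linarith [hs.2]))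
      filter_upwards [h1, h2] with k h1 h2
      simp only [hη]
      rw [smoothTransition.one_of_one_le, smoothTransition.one_of_one_le, mul_one, one_mul]
      · rw [one_le_div (hδ0 k)]; linarith
      · rw [one_le_div (hδ0 k)]; linarith
  exact tendsto_nhds_unique hlim2
    (hlim1.congr fun k => hweak (η k) (hηc k) (hηcs k) ((hηt k).trans (hIcc k)))

end WeakDerivative

section GaussTest

open Filter Topology

variable {n : ℕ}

/-- A test function moving along a rescaled direction. -/
noncomputable def gaussTest (η : ℝ → ℝ) (ψ : EuclideanSpace ℝ (Fin n) → ℝ) (t : ℝ)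
    (y : EuclideanSpace ℝ (Fin n)) (r : ℝ × EuclideanSpace ℝ (Fin n)) : ℝ :=
  η r.1 * ψ (r.2 + √(t - r.1) • y)

variable {η : ℝ → ℝ} {ψ : EuclideanSpace ℝ (Fin n) → ℝ} {α t : ℝ}

lemma gaussTest_eventually_eq_zero (hs : tsupport η ⊆ Ioo α t) (y : EuclideanSpace ℝ (Fin n))
    {r : ℝ × EuclideanSpace ℝ (Fin n)} (hr : t ≤ r.1) : gaussTest η ψ t y =ᶠ[𝓝 r] 0 := by
  have h1 : r.1 ∉ tsupport η := fun h => (hs h).2.not_ge hr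
  have h2 := (notMem_tsupport_iff_eventuallyEq.1 h1)
  filter_upwards [continuous_fst.continuousAt.eventually h2] with q hq
  simp only [Pi.zero_apply] at hq
  simp [gaussTest, hq]

lemma contDiff_gaussTest (hη : ContDiff ℝ (⊤ : ℕ∞) η) (hs : tsupport η ⊆ Ioo α t)
    (hψ : ContDiff ℝ (⊤ : ℕ∞) ψ) (y : EuclideanSpace ℝ (Fin n)) :
    ContDiff ℝ (⊤ : ℕ∞) (gaussTest η ψ t y) := by
  rw [contDiff_iff_contDiffAt]
  intro r
  rcases lt_or_ge r.1 t with h | h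
  · have h1 : ContDiffAt ℝ (⊤ : ℕ∞) (fun r : ℝ × EuclideanSpace ℝ (Fin n) => √(t - r.1)) r :=
      (contDiffAt_const.sub contDiffAt_fst).sqrt (sub_pos.2 h).ne'
    exact (hη.contDiffAt.comp r contDiffAt_fst).mul
      (hψ.contDiffAt.comp r (contDiffAt_snd.add (h1.smul contDiffAt_const)))
  · exact contDiffAt_const.congr_of_eventuallyEq (gaussTest_eventually_eq_zero hs y h)

lemma gaussTest_supports (hη : HasCompactSupport η) (hs : tsupport η ⊆ Ioo α t)
    (hψ : HasCompactSupport ψ) (y : EuclideanSpace ℝ (Fin n)) :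
    HasCompactSupport (gaussTest η ψ t y) ∧
      tsupport (gaussTest η ψ t y) ⊆ Ioo α t ×ˢ univ := by
  have hK : IsCompact ((fun r : ℝ × EuclideanSpace ℝ (Fin n) =>
      (r.1, r.2 - √(t - r.1) • y)) '' (tsupport η ×ˢ tsupport ψ)) :=
    (hη.isCompact.prod hψ.isCompact).image (by fun_prop)
  have hzero : ∀ r, r ∉ ((fun r : ℝ × EuclideanSpace ℝ (Fin n) =>
      (r.1, r.2 - √(t - r.1) • y)) '' (tsupport η ×ˢ tsupport ψ)) → gaussTest η ψ t y r = 0 := by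
    intro r hr
    by_contra h
    have h1 := left_ne_zero_of_mul h
    have h2 := right_ne_zero_of_mul h
    exact hr ⟨(r.1, r.2 + √(t - r.1) • y), ⟨subset_tsupport _ h1, subset_tsupport _ h2⟩, by simp⟩
  refine ⟨HasCompactSupport.intro hK hzero, ?_⟩
  refine (closure_minimal (fun r hr => ?_) hK.isClosed).trans ?_
  · by_contra h; exact hr (hzero r h)
  · rintro _ ⟨r, hr, rfl⟩
    exact ⟨hs hr.1, mem_univ _⟩

lemma laplacian_comp_add_right (hψ : ContDiff ℝ (⊤ : ℕ∞) ψ) (c : EuclideanSpace ℝ (Fin n)) (k : ℝ)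
    (x : EuclideanSpace ℝ (Fin n)) :
    Laplacian.laplacian (fun x => k * ψ (x + c)) x = k * Laplacian.laplacian ψ (x + c) := by
  have hc : ContDiff ℝ (⊤ : ℕ∞) fun x => ψ (x + c) := hψ.comp (contDiff_id.add contDiff_const)
  rw [laplacian_eq_sum_fderiv (contDiff_const.mul hc), laplacian_eq_sum_fderiv hψ, Finset.mul_sum]
  refine Finset.sum_congr rfl fun i _ => ?_
  have h1 : ∀ z w, fderiv ℝ (fun x => k * ψ (x + c)) z w = k * fderiv ℝ ψ (z + c) w := by
    intro z w
    rw [fderiv_const_mul ((hc.differentiable (by simp)) z), fderiv_comp_add_right]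
    simp
  simp_rw [h1]
  have hd : ContDiff ℝ (⊤ : ℕ∞) fun z => fderiv ℝ ψ (z + c) (EuclideanSpace.basisFun (Fin n) ℝ i) :=
    (contDiff_fderiv_apply hψ _).comp (contDiff_id.add contDiff_const)
  rw [fderiv_const_mul ((hd.differentiable (by simp)) x),
    fderiv_comp_add_right (f := fun z => fderiv ℝ ψ z (EuclideanSpace.basisFun (Fin n) ℝ i))]
  simp

/-- The transported profile of the backward heat operator applied to `gaussTest`. -/
noncomputable def gaussProfile (η : ℝ → ℝ) (ψ : EuclideanSpace ℝ (Fin n) → ℝ) (t s : ℝ)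
    (y p : EuclideanSpace ℝ (Fin n)) : ℝ :=
  deriv η s * ψ p + η s * Laplacian.laplacian ψ p - η s * ((2 * √(t - s))⁻¹ * fderiv ℝ ψ p y)

lemma backHeat_gaussTest (hη : ContDiff ℝ (⊤ : ℕ∞) η) (hs : tsupport η ⊆ Ioo α t)
    (hψ : ContDiff ℝ (⊤ : ℕ∞) ψ) (y : EuclideanSpace ℝ (Fin n)) (s : ℝ)
    (x : EuclideanSpace ℝ (Fin n)) :
    backHeat (gaussTest η ψ t y) (s, x) = gaussProfile η ψ t s y (x + √(t - s) • y) := by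
  rcases lt_or_ge s t with h | h
  · have hp : 0 < t - s := sub_pos.2 h
    have h1 : HasDerivAt (fun s => x + √(t - s) • y) ((-1 / (2 * √(t - s))) • y) s :=
      (((((hasDerivAt_id s).const_sub t).sqrt hp.ne').smul_const y).const_add x)
    have h2 : HasDerivAt (fun s => ψ (x + √(t - s) • y))
        (fderiv ℝ ψ (x + √(t - s) • y) ((-1 / (2 * √(t - s))) • y)) s :=
      ((hψ.differentiable (by simp)) _).hasFDerivAt.comp_hasDerivAt s h1
    have h3 := ((hη.differentiable (by simp)) s).hasDerivAt.mul h2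
    simp only [backHeat]
    have e1 : deriv (fun s => gaussTest η ψ t y (s, x)) s = _ := h3.deriv
    rw [e1]
    simp only [gaussTest]
    rw [laplacian_comp_add_right hψ, map_smul, smul_eq_mul, gaussProfile]
    ring
  · have h0 : s ∉ tsupport η := fun hm => (hs hm).2.not_ge h
    have h1 : η s = 0 := image_eq_zero_of_notMem_tsupport h0
    have h2 : deriv η s = 0 := by
      by_contra hne
      exact h0 (support_deriv_subset hne)
    rw [gaussProfile, h1, h2, backHeat_eq_zero _ (contDiff_gaussTest hη hs hψ y)]
    · simp
    · exact notMem_tsupport_iff_eventuallyEq.2 (gaussTest_eventually_eq_zero hs y h)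

lemma continuous_laplacian (hψ : ContDiff ℝ (⊤ : ℕ∞) ψ) : Continuous (Laplacian.laplacian ψ) := by
  rw [show Laplacian.laplacian ψ = _ from funext (laplacian_eq_sum_fderiv hψ)]
  exact (ContDiff.sum fun i _ =>
    contDiff_fderiv_apply (contDiff_fderiv_apply hψ _) _).continuous

lemma hasCompactSupport_laplacian (hψ : ContDiff ℝ (⊤ : ℕ∞) ψ) (hc : HasCompactSupport ψ) :
    HasCompactSupport (Laplacian.laplacian ψ) := by
  refine HasCompactSupport.intro hc.isCompact fun x hx => ?_
  have h0 : ∀ {f : EuclideanSpace ℝ (Fin n) → ℝ}, x ∉ tsupport f → fderiv ℝ f x = 0 := by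
    intro f hf
    by_contra h
    exact hf (support_fderiv_subset ℝ h)
  rw [laplacian_eq_sum_fderiv hψ]
  refine Finset.sum_eq_zero fun i _ => ?_
  rw [h0, zero_apply]
  exact fun h => hx (tsupport_fderiv_apply_subset ℝ _ h)

lemma hasCompactSupport_norm_fderiv (hc : HasCompactSupport ψ) :
    HasCompactSupport fun x => ‖fderiv ℝ ψ x‖ :=
  (hc.fderiv ℝ).norm

/-- Domination of the profile by a compactly supported function, up to linear growth in `y`. -/
lemma exists_gaussProfile_bound (hη : ContDiff ℝ (⊤ : ℕ∞) η) (hηc : HasCompactSupport η)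
    (hs : tsupport η ⊆ Ioo α t) (hψ : ContDiff ℝ (⊤ : ℕ∞) ψ) (hc : HasCompactSupport ψ) :
    ∃ g : EuclideanSpace ℝ (Fin n) → ℝ, Continuous g ∧ HasCompactSupport g ∧
      ∀ s y p, |gaussProfile η ψ t s y p| ≤ (1 + ‖y‖) * g p := by
  obtain ⟨A, hA⟩ := hηc.exists_bound_of_continuous hη.continuous
  obtain ⟨A', hA'⟩ := hηc.deriv.exists_bound_of_continuous (hη.continuous_deriv (by simp))
  have hcont : ContinuousOn (fun s => η s * (2 * √(t - s))⁻¹) (tsupport η) := by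
    refine hη.continuous.continuousOn.mul (ContinuousOn.inv₀ (by fun_prop) fun s hm => ?_)
    have := Real.sqrt_pos.2 (sub_pos.2 (hs hm).2)
    positivity
  obtain ⟨Z, hZ⟩ := hηc.isCompact.exists_bound_of_continuousOn hcont
  have hZ' : ∀ s, |η s * (2 * √(t - s))⁻¹| ≤ max Z 0 := by
    intro s
    by_cases hm : s ∈ tsupport η
    · exact (hZ s hm).trans (le_max_left _ _)
    · rw [image_eq_zero_of_notMem_tsupport hm]; simp
  have hA0 : 0 ≤ A := (norm_nonneg _).trans (hA 0)
  have hA0' : 0 ≤ A' := (norm_nonneg _).trans (hA' 0)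
  refine ⟨fun p => A' * |ψ p| + A * |Laplacian.laplacian ψ p| + max Z 0 * ‖fderiv ℝ ψ p‖, ?_, ?_,
    fun s y p => ?_⟩
  · exact ((continuous_const.mul hψ.continuous.abs).add
      (continuous_const.mul (continuous_laplacian hψ).abs)).add
      (continuous_const.mul (hψ.continuous_fderiv (by simp)).norm)
  · exact (((hc.norm).mul_left (f' := fun p => ‖ψ p‖)).add
      ((hasCompactSupport_laplacian hψ hc).norm.mul_left)).add
      ((hasCompactSupport_norm_fderiv hc).mul_left)
  · have h1 : |deriv η s * ψ p| ≤ A' * |ψ p| := by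
      rw [abs_mul]; exact mul_le_mul_of_nonneg_right (hA' s) (abs_nonneg _)
    have h2 : |η s * Laplacian.laplacian ψ p| ≤ A * |Laplacian.laplacian ψ p| := by
      rw [abs_mul]; exact mul_le_mul_of_nonneg_right (hA s) (abs_nonneg _)
    have h3 : |η s * ((2 * √(t - s))⁻¹ * fderiv ℝ ψ p y)| ≤
        max Z 0 * ‖fderiv ℝ ψ p‖ * ‖y‖ := by
      rw [← mul_assoc, abs_mul, mul_assoc]
      exact mul_le_mul (hZ' s) ((fderiv ℝ ψ p).le_opNorm y) (abs_nonneg _) (le_max_right _ _)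
    have h4 := (abs_sub (deriv η s * ψ p + η s * Laplacian.laplacian ψ p)
      (η s * ((2 * √(t - s))⁻¹ * fderiv ℝ ψ p y))).trans
      (add_le_add_left (abs_add_le _ _) _)
    have h5 : 0 ≤ A' * |ψ p| * ‖y‖ := by positivity
    have h6 : 0 ≤ A * |Laplacian.laplacian ψ p| * ‖y‖ := by positivity
    have h7 : 0 ≤ max Z 0 * ‖fderiv ℝ ψ p‖ := mul_nonneg (le_max_right _ _) (norm_nonneg _)
    rw [gaussProfile]
    nlinarith

lemma integral_gaussProfile (hψ : ContDiff ℝ (⊤ : ℕ∞) ψ) (hc : HasCompactSupport ψ) {s : ℝ}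
    (hst : s < t) (x : EuclideanSpace ℝ (Fin n)) :
    ∫ y, gaussProfile η ψ t s y (x + √(t - s) • y) ∂gaussMeasure n =
      deriv η s * heatFun (t - s) ψ x := by
  have hbdd : ∀ {f : EuclideanSpace ℝ (Fin n) → ℝ}, Continuous f → HasCompactSupport f →
      Integrable (fun y => f (x + √(t - s) • y)) (gaussMeasure n) := by
    intro f hf hfc
    obtain ⟨B, hB⟩ := hfc.exists_bound_of_continuous hf
    exact Integrable.mono' (integrable_const B) (hf.comp (by fun_prop)).aestronglyMeasurable
      (Eventually.of_forall fun y => hB _)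
  have h1 := hbdd hψ.continuous hc
  have h2 := hbdd (continuous_laplacian hψ) (hasCompactSupport_laplacian hψ hc)
  have h3 : Integrable (fun y => (2 * √(t - s))⁻¹ * fderiv ℝ ψ (x + √(t - s) • y) y)
      (gaussMeasure n) := by
    obtain ⟨B, hB⟩ := (hc.fderiv ℝ).exists_bound_of_continuous (hψ.continuous_fderiv (by simp))
    have hcont : Continuous fun y => fderiv ℝ ψ (x + √(t - s) • y) y :=
      ((hψ.continuous_fderiv (by simp)).comp (by fun_prop)).clm_apply continuous_id
    refine Integrable.const_mul (Integrable.mono' (integrable_norm_gauss.const_mul B)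
      hcont.aestronglyMeasurable (Eventually.of_forall fun y => ?_)) _
    exact (ContinuousLinearMap.le_opNorm _ _).trans
      (mul_le_mul_of_nonneg_right (hB _) (norm_nonneg _))
  have h12 : Integrable (fun y => deriv η s * ψ (x + √(t - s) • y) +
      η s * Laplacian.laplacian ψ (x + √(t - s) • y)) (gaussMeasure n) :=
    (h1.const_mul _).add (h2.const_mul _)
  simp only [gaussProfile]
  rw [integral_sub h12 (h3.const_mul _),
    integral_add (h1.const_mul _) (h2.const_mul _), integral_const_mul, integral_const_mul,
    integral_const_mul, integral_fderiv_gauss_eq_heatFun_laplacian hψ hc (sub_pos.2 hst)]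
  simp only [heatFun]
  ring

end GaussTest

section Fubini

open Filter Topology

variable {n : ℕ} {σ γ : ℝ≥0∞} [hσ : Fact (1 ≤ σ)] [hγ : Fact (1 ≤ γ)] [hγ' : Fact (γ ≠ ∞)]

lemma integrable_gauss_prod {K : EuclideanSpace ℝ (Fin n) → EuclideanSpace ℝ (Fin n) → ℝ}
    (hK : AEStronglyMeasurable (Function.uncurry K) ((gaussMeasure n).prod volume))
    (h1 : ∀ y, Integrable (K y)) {ω : EuclideanSpace ℝ (Fin n) → ℝ}
    (hω : Integrable ω (gaussMeasure n)) (h2 : ∀ y, ∫ x, ‖K y x‖ ≤ ω y) :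
    Integrable (Function.uncurry K) ((gaussMeasure n).prod volume) := by
  rw [integrable_prod_iff hK]
  refine ⟨Eventually.of_forall h1, Integrable.mono' hω hK.norm.integral_prod_right'
    (Eventually.of_forall fun y => ?_)⟩
  rw [Real.norm_eq_abs, abs_of_nonneg (integral_nonneg fun _ => norm_nonneg _)]
  exact h2 y

lemma continuous_integral_mul_translate {γ' : ℝ≥0∞} [γ.HolderConjugate γ']
    {ρ : EuclideanSpace ℝ (Fin n) → ℝ} (hρ : MemLp ρ γ' volume) :
    Continuous fun r : EuclideanSpace ℝ (Fin n) × LpE n γ => ∫ x, r.2 x * ρ (x + r.1) := by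
  have h1 : ∀ r : EuclideanSpace ℝ (Fin n) × LpE n γ, ∫ x, r.2 x * ρ (x + r.1) =
      pairCLM hρ (DomAddAct.mk (-r.1) +ᵥ r.2 : LpE n γ) := by
    intro r
    rw [pairCLM_apply, ← integral_add_right_eq_self (fun x => r.2 x * ρ (x + r.1)) (-r.1)]
    refine (integral_congr_ae ?_).symm
    filter_upwards [DomAddAct.vadd_Lp_ae_eq (DomAddAct.mk (-r.1)) r.2] with x hx
    rw [hx]
    simp [add_comm]
  simp_rw [h1]
  exact (pairCLM hρ).continuous.comp ((DomAddAct.continuous_mk.comp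
    (continuous_fst.neg)).vadd continuous_snd)

lemma memLp_translate {q : ℝ≥0∞} {ρ : EuclideanSpace ℝ (Fin n) → ℝ} (hρ : MemLp ρ q volume)
    (c : EuclideanSpace ℝ (Fin n)) : MemLp (fun x => ρ (x + c)) q volume :=
  hρ.comp_measurePreserving (measurePreserving_add_right volume c)

lemma eLpNorm_translate {q : ℝ≥0∞} {ρ : EuclideanSpace ℝ (Fin n) → ℝ} (hρ : MemLp ρ q volume)
    (c : EuclideanSpace ℝ (Fin n)) :
    eLpNorm (fun x => ρ (x + c)) q volume = eLpNorm ρ q volume :=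
  eLpNorm_comp_measurePreserving hρ.1 (measurePreserving_add_right volume c)

variable {η : ℝ → ℝ} {ψ : EuclideanSpace ℝ (Fin n) → ℝ} {α t : ℝ}

/-- The pairing with the transported profile is jointly measurable. -/
lemma aestronglyMeasurable_gaussProfile {γ' : ℝ≥0∞} [γ.HolderConjugate γ']
    (hη : ContDiff ℝ (⊤ : ℕ∞) η) (hψ : ContDiff ℝ (⊤ : ℕ∞) ψ) (hc : HasCompactSupport ψ)
    {w : ℝ → LpE n γ} (hw : ContinuousOn w (Icc α t)) :
    AEStronglyMeasurable (fun r : EuclideanSpace ℝ (Fin n) × ℝ =>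
      ∫ x, w r.2 x * gaussProfile η ψ t r.2 r.1 (x + √(t - r.2) • r.1))
      ((gaussMeasure n).prod (volume.restrict (Ioo α t))) := by
  let e := EuclideanSpace.basisFun (Fin n) ℝ
  have hd : ∀ i, MemLp (fun p => fderiv ℝ ψ p (e i)) γ' volume := fun i =>
    (contDiff_fderiv_apply hψ (e i)).continuous.memLp_of_hasCompactSupport (hc.fderiv_apply ℝ (e i))
  have h0 : MemLp ψ γ' volume := hψ.continuous.memLp_of_hasCompactSupport hc
  have hL : MemLp (Laplacian.laplacian ψ) γ' volume :=
    (continuous_laplacian hψ).memLp_of_hasCompactSupport (hasCompactSupport_laplacian hψ hc)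
  have hexp : ∀ p y, fderiv ℝ ψ p y = ∑ i, y i * fderiv ℝ ψ p (e i) := by
    intro p y
    conv_lhs => rw [← e.sum_repr y, map_sum]
    refine Finset.sum_congr rfl fun i _ => ?_
    rw [map_smul, smul_eq_mul]
    simp [e]
  have hformula : ∀ r : EuclideanSpace ℝ (Fin n) × ℝ,
      ∫ x, w r.2 x * gaussProfile η ψ t r.2 r.1 (x + √(t - r.2) • r.1) =
        deriv η r.2 * (∫ x, w r.2 x * ψ (x + √(t - r.2) • r.1)) +
        η r.2 * (∫ x, w r.2 x * Laplacian.laplacian ψ (x + √(t - r.2) • r.1)) -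
        η r.2 * ((2 * √(t - r.2))⁻¹ * ∑ i, r.1 i *
          ∫ x, w r.2 x * fderiv ℝ ψ (x + √(t - r.2) • r.1) (e i)) := by
    intro r
    have i1 := integrable_coe_mul γ' (w r.2) (memLp_translate h0 (√(t - r.2) • r.1))
    have i2 := integrable_coe_mul γ' (w r.2) (memLp_translate hL (√(t - r.2) • r.1))
    have i3 := fun i => integrable_coe_mul γ' (w r.2) (memLp_translate (hd i) (√(t - r.2) • r.1))
    have i4 := integrable_finsetSum Finset.univ fun i _ => (i3 i).const_mul (r.1 i)
    have i12 : Integrable fun x => deriv η r.2 * (w r.2 x * ψ (x + √(t - r.2) • r.1)) +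
        η r.2 * (w r.2 x * Laplacian.laplacian ψ (x + √(t - r.2) • r.1)) :=
      (i1.const_mul _).add (i2.const_mul _)
    simp_rw [← integral_const_mul (r.1 _)]
    rw [← integral_finsetSum _ fun i _ => (i3 i).const_mul (r.1 i), ← integral_const_mul,
      ← integral_const_mul, ← integral_const_mul, ← integral_const_mul,
      ← integral_add (i1.const_mul _) (i2.const_mul _),
      ← integral_sub i12 ((i4.const_mul _).const_mul _)]
    congr 1; ext x
    simp only [gaussProfile]
    have : ∑ i, r.1 i * (w r.2 x * fderiv ℝ ψ (x + √(t - r.2) • r.1) (e i)) =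
        w r.2 x * fderiv ℝ ψ (x + √(t - r.2) • r.1) r.1 := by
      rw [hexp _ r.1, Finset.mul_sum]
      exact Finset.sum_congr rfl fun i _ => by ring
    rw [this]
    ring
  have hwm : AEStronglyMeasurable (fun r : EuclideanSpace ℝ (Fin n) × ℝ => w r.2)
      ((gaussMeasure n).prod (volume.restrict (Ioo α t))) :=
    ((hw.mono Ioo_subset_Icc_self).aestronglyMeasurable measurableSet_Ioo).comp_snd
  have hcm : AEStronglyMeasurable (fun r : EuclideanSpace ℝ (Fin n) × ℝ => √(t - r.2) • r.1)
      ((gaussMeasure n).prod (volume.restrict (Ioo α t))) :=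
    (by fun_prop : Continuous fun r : EuclideanSpace ℝ (Fin n) × ℝ =>
      √(t - r.2) • r.1).aestronglyMeasurable
  have hq : ∀ {ρ : EuclideanSpace ℝ (Fin n) → ℝ}, MemLp ρ γ' volume →
      AEStronglyMeasurable (fun r : EuclideanSpace ℝ (Fin n) × ℝ =>
        ∫ x, w r.2 x * ρ (x + √(t - r.2) • r.1))
        ((gaussMeasure n).prod (volume.restrict (Ioo α t))) := fun hρ =>
    (continuous_integral_mul_translate hρ).comp_aestronglyMeasurable (hcm.prodMk hwm)
  have hη1 : Measurable fun r : EuclideanSpace ℝ (Fin n) × ℝ => η r.2 :=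
    hη.continuous.measurable.comp measurable_snd
  have hη2 : Measurable fun r : EuclideanSpace ℝ (Fin n) × ℝ => deriv η r.2 :=
    (hη.continuous_deriv (by simp)).measurable.comp measurable_snd
  have hs : Measurable fun r : EuclideanSpace ℝ (Fin n) × ℝ => (2 * √(t - r.2))⁻¹ := by fun_prop
  simp_rw [hformula]
  refine ((hη2.aestronglyMeasurable.mul (hq h0)).add (hη1.aestronglyMeasurable.mul (hq hL))).sub
    (hη1.aestronglyMeasurable.mul (hs.aestronglyMeasurable.mul ?_))
  refine Finset.aestronglyMeasurable_fun_sum _ fun i _ => ?_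
  have hi : Measurable fun r : EuclideanSpace ℝ (Fin n) × ℝ => r.1 i := by fun_prop
  exact hi.aestronglyMeasurable.mul (hq (hd i))

end Fubini

section WeakDuhamel

open Filter Topology

variable {n : ℕ} {σ γ : ℝ≥0∞} [hσ : Fact (1 ≤ σ)] [hγ : Fact (1 ≤ γ)] [hγ' : Fact (γ ≠ ∞)]

/-- A solution is bounded on every compact time interval inside `(0,T)`. -/
lemma IsHeatPotentialSolution.exists_bound {T : ℝ} {a : ℝ → LpE n σ} {u₀ : LpE n γ}
    {v : ℝ → LpE n γ} (hv : IsHeatPotentialSolution T a u₀ v) {α β : ℝ} (hα : 0 < α)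
    (hαβ : α < β) (hβ : β < T) :
    ∃ A, 0 ≤ A ∧ ∀ s ∈ Icc α β, ‖v s‖ ≤ A ∧ eLpNorm (v s) ∞ volume ≤ ENNReal.ofReal A := by
  have hsub : Icc α β ⊆ Icc 0 T := Icc_subset_Icc hα.le hβ.le
  have hc := hv.continuousOn.mono hsub
  obtain ⟨A, hA⟩ := isCompact_Icc.exists_bound_of_continuousOn hc
  obtain ⟨M, hM⟩ := hv.locally_bounded (Icc α β) isCompact_Icc
    fun s hs => ⟨hα.trans_le hs.1, hs.2.trans_lt hβ⟩
  rw [ae_restrict_iff' measurableSet_Icc] at hM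
  have hd := Measure.dense_of_ae hM
  refine ⟨max A M, le_max_of_le_left ((norm_nonneg _).trans (hA α (left_mem_Icc.2 hαβ.le))),
    fun s hs => ⟨(hA s hs).trans (le_max_left _ _), ?_⟩⟩
  have hcl : s ∈ closure (Ioo α β ∩ {x | x ∈ Icc α β →
      eLpNorm (v x) ∞ volume ≤ ENNReal.ofReal M}) := by
    have h1 := closure_mono (hd.open_subset_closure_inter (isOpen_Ioo (a := α) (b := β)))
    rw [closure_closure, closure_Ioo hαβ.ne] at h1
    exact h1 hs
  obtain ⟨x, hx, hxs⟩ := mem_closure_iff_seq_limit.1 hcl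
  have h2 : Tendsto (fun j => v (x j)) atTop (𝓝 (v s)) :=
    (hc s hs).tendsto.comp (tendsto_nhdsWithin_iff.2
      ⟨hxs, Eventually.of_forall fun j => Ioo_subset_Icc_self (hx j).1⟩)
  exact eLpNorm_top_le_of_tendsto h2 (Eventually.of_forall fun j =>
    ((hx j).2 (Ioo_subset_Icc_self (hx j).1)).trans (ENNReal.ofReal_le_ofReal (le_max_right _ _)))

lemma exists_eLpNorm_bound {ψ : EuclideanSpace ℝ (Fin n) → ℝ} (hψ : ContDiff ℝ (⊤ : ℕ∞) ψ)
    (hc : HasCompactSupport ψ) (q : ℝ≥0∞) :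
    ∃ B, 0 ≤ B ∧ eLpNorm ψ q volume ≤ ENNReal.ofReal B ∧
      eLpNorm ψ ∞ volume ≤ ENNReal.ofReal B := by
  have h1 := memLp_of_test hψ hc q
  have h2 := memLp_of_test hψ hc ∞
  refine ⟨max (eLpNorm ψ q volume).toReal (eLpNorm ψ ∞ volume).toReal,
    le_max_of_le_left ENNReal.toReal_nonneg, ?_, ?_⟩
  · rw [← ENNReal.ofReal_toReal h1.2.ne]
    exact ENNReal.ofReal_le_ofReal (by rw [ENNReal.ofReal_toReal h1.2.ne]; exact le_max_left _ _)
  · rw [← ENNReal.ofReal_toReal h2.2.ne]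
    exact ENNReal.ofReal_le_ofReal (by rw [ENNReal.ofReal_toReal h2.2.ne]; exact le_max_right _ _)

variable {T L α t : ℝ} {a : ℝ → LpE n σ} {u₀ : LpE n γ} {v : ℝ → LpE n γ}
  {η : ℝ → ℝ} {ψ : EuclideanSpace ℝ (Fin n) → ℝ}

/-- The equation tested against `gaussTest`. -/
lemma IsHeatPotentialSolution.integral_gaussTest (hσ' : σ ≠ ∞)
    (ha : AEStronglyMeasurable a (volume.restrict (Ioo 0 T)))
    (haL : ∀ᵐ s ∂(volume.restrict (Ioo 0 T)), ‖a s‖ ≤ L) (hL : 0 ≤ L)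
    (hv : IsHeatPotentialSolution T a u₀ v)
    (hα : 0 < α) (hαt : α < t) (htT : t < T) (hη : ContDiff ℝ (⊤ : ℕ∞) η)
    (hηc : HasCompactSupport η) (hηs : tsupport η ⊆ Ioo α t) (hψ : ContDiff ℝ (⊤ : ℕ∞) ψ)
    (hψc : HasCompactSupport ψ) (y : EuclideanSpace ℝ (Fin n)) :
    ∫ s in Ioo α t, ∫ x, v s x * gaussProfile η ψ t s y (x + √(t - s) • y) =
      ∫ s in Ioo α t, η s * ∫ x, a s x * (v s x * ψ (x + √(t - s) • y)) := by
  have : γ.HolderConjugate (ENNReal.conjExponent γ) := .conjExponent hγ.out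
  obtain ⟨A, hA0, hA⟩ := hv.exists_bound hα hαt htT
  have hφ := contDiff_gaussTest hη hηs hψ y
  obtain ⟨hc, hsupp⟩ := gaussTest_supports hηc hηs hψc y
  have hsub : Ioo α t ⊆ Ioo 0 T := Ioo_subset_Ioo hα.le htT.le
  obtain ⟨B₁, hB₁0, hB₁⟩ := exists_slice_bound hφ.continuous hc (ENNReal.conjExponent γ)
  obtain ⟨B₂, hB₂0, hB₂⟩ := exists_slice_bound hφ.continuous hc ∞
  have hB : ∀ s q B, MemLp (fun x => gaussTest η ψ t y (s, x)) q volume ∧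
      (eLpNorm (fun x => gaussTest η ψ t y (s, x)) q volume).toReal ≤ B → B ≤ max B₁ B₂ →
      eLpNorm (fun x => gaussTest η ψ t y (s, x)) q volume ≤ ENNReal.ofReal (max B₁ B₂) := by
    intro s q B h1 h2
    rw [← ENNReal.ofReal_toReal h1.1.2.ne]
    exact ENNReal.ofReal_le_ofReal (h1.2.trans h2)
  have hB0 : 0 ≤ max B₁ B₂ := le_max_of_le_left hB₁0
  have hout : ∀ s x, s ∉ Ioo α t → (s, x) ∉ tsupport (gaussTest η ψ t y) :=
    fun s x hs h => hs (hsupp h).1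
  have hN : ∀ᵐ s ∂(volume.restrict (Ioo 0 T)),
      ∫⁻ x, ‖a s x * (v s x * gaussTest η ψ t y (s, x))‖ₑ ≤
        ENNReal.ofReal (L * (A * max B₁ B₂)) := by
    filter_upwards [haL] with s hs
    by_cases h : s ∈ Ioo α t
    · have h1 := hA s (Ioo_subset_Icc_self h)
      refine (lintegral_potential_le_of_bounded hσ' (ENNReal.conjExponent γ) (a s) (v s)
        (contDiff_slice hφ s).continuous.aestronglyMeasurable hA0 hB0 h1.1 h1.2
        (hB s _ _ (hB₁ s) (le_max_left _ _)) (hB s _ _ (hB₂ s) (le_max_right _ _))).trans ?_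
      exact ENNReal.ofReal_le_ofReal (by gcongr)
    · simp [image_eq_zero_of_notMem_tsupport (hout s _ h)]
  have heq := hv.equation _ hφ hc (hsupp.trans (prod_mono hsub subset_rfl))
  rw [integral_weak_form_eq ha hv.continuousOn hφ hc (by positivity) hN, sub_eq_zero,
    setIntegral_eq_of_subset_of_forall_sdiff_eq_zero measurableSet_Ioo hsub,
    setIntegral_eq_of_subset_of_forall_sdiff_eq_zero measurableSet_Ioo hsub] at heq
  · simp only [backHeat_gaussTest hη hηs hψ] at heq
    rw [← heq]
    congr 1; ext s
    rw [← integral_const_mul]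
    congr 1; ext x
    simp only [gaussTest]
    ring
  · intro s hs
    simp [backHeat_eq_zero _ hφ (hout s _ hs.2)]
  · intro s hs
    simp [image_eq_zero_of_notMem_tsupport (hout s _ hs.2)]

/-- The potential term of the Duhamel formula is integrable. -/
lemma integrableOn_potential_heatFun (hσ' : σ ≠ ∞)
    (ha : AEStronglyMeasurable a (volume.restrict (Ioo 0 T)))
    (haL : ∀ᵐ s ∂(volume.restrict (Ioo 0 T)), ‖a s‖ ≤ L)
    (hv : ContinuousOn v (Icc 0 T)) {A : ℝ} (hA0 : 0 ≤ A)
    (hA : ∀ s ∈ Icc α t, ‖v s‖ ≤ A ∧ eLpNorm (v s) ∞ volume ≤ ENNReal.ofReal A)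
    (hα : 0 < α) (htT : t < T) (hψ : ContDiff ℝ (⊤ : ℕ∞) ψ) (hψc : HasCompactSupport ψ) :
    IntegrableOn (fun s => ∫ x, a s x * (v s x * heatFun (t - s) ψ x)) (Ioo α t) := by
  have : γ.HolderConjugate (ENNReal.conjExponent γ) := .conjExponent hγ.out
  have h1γ' : 1 ≤ ENNReal.conjExponent γ := (ENNReal.HolderConjugate.symm (p := γ)).one_le
  have hsub : Ioo α t ⊆ Ioo 0 T := Ioo_subset_Ioo hα.le htT.le
  have hψm := hψ.continuous.measurable
  have hψL := memLp_of_test hψ hψc (ENNReal.conjExponent γ)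
  obtain ⟨B, hB0, hB1, hB2⟩ := exists_eLpNorm_bound hψ hψc (ENNReal.conjExponent γ)
  have hbd : ∀ s ∈ Ioo α t, ∫⁻ x, ‖a s x * (v s x * heatFun (t - s) ψ x)‖ₑ ≤
      ENNReal.ofReal (‖a s‖ * (A * B)) := by
    intro s hs
    have h1 := hA s (Ioo_subset_Icc_self hs)
    exact lintegral_potential_le_of_bounded hσ' (ENNReal.conjExponent γ) (a s) (v s)
      (measurable_heatFun _ hψm).aestronglyMeasurable hA0 hB0 h1.1 h1.2
      ((eLpNorm_heatFun_le _ hψm h1γ').trans hB1) ((eLpNorm_heatFun_le _ hψm le_top).trans hB2)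
  have haL' := ae_restrict_of_ae_restrict_of_subset hsub haL
  refine Integrable.mono' (integrable_const (L * (A * B))) ?_ ?_
  · refine aestronglyMeasurable_of_tendsto_ae atTop
      (f := fun k s => ∫ x, truncLp k (a s) x * (v s x * heatFun (t - s) ψ x)) (fun k => ?_) ?_
    · have h1 : ∀ s, ∫ x, truncLp k (a s) x * (v s x * heatFun (t - s) ψ x) =
          pairCLM hψL (heatLp (t - s) (mulTrunc k (a s) (v s))) := fun s => by
        rw [pairCLM_apply, integral_heatLp_mul _ _ _ hψm hψL, integral_mulTrunc_mul]
      simp only [h1]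
      exact (pairCLM hψL).continuous.comp_aestronglyMeasurable ((aestronglyMeasurable_duhamel
        continuous_heatLp (aestronglyMeasurable_mulTrunc ha k hv) t).mono_set hsub)
    · filter_upwards [ae_restrict_mem measurableSet_Ioo] with s hs
      refine tendsto_integral_truncLp_mul (a s) ((Lp.aestronglyMeasurable _).mul
        (measurable_heatFun _ hψm).aestronglyMeasurable) ⟨?_, (hbd s hs).trans_lt
          ENNReal.ofReal_lt_top⟩
      exact (Lp.aestronglyMeasurable _).mul ((Lp.aestronglyMeasurable _).mul
        (measurable_heatFun _ hψm).aestronglyMeasurable)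
  · filter_upwards [haL', ae_restrict_mem measurableSet_Ioo] with s h1 hs
    refine (abs_integral_le_of_lintegral_enorm_le (by positivity) (hbd s hs)).trans ?_
    gcongr

end WeakDuhamel

section Average

open Filter Topology

variable {n : ℕ} {σ γ : ℝ≥0∞} [hσ : Fact (1 ≤ σ)] [hγ : Fact (1 ≤ γ)] [hγ' : Fact (γ ≠ ∞)]
  {T L A α t : ℝ} {a : ℝ → LpE n σ} {u₀ : LpE n γ} {v : ℝ → LpE n γ}
  {η : ℝ → ℝ} {ψ : EuclideanSpace ℝ (Fin n) → ℝ}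

/-- Averaging the heat part over the Gaussian directions. -/
lemma integral_integral_gaussProfile (hv : ContinuousOn v (Icc α t)) (hη : ContDiff ℝ (⊤ : ℕ∞) η)
    (hηc : HasCompactSupport η) (hηs : tsupport η ⊆ Ioo α t) (hψ : ContDiff ℝ (⊤ : ℕ∞) ψ)
    (hψc : HasCompactSupport ψ) :
    ∫ y, (∫ s in Ioo α t, ∫ x, v s x * gaussProfile η ψ t s y (x + √(t - s) • y))
        ∂gaussMeasure n =
      ∫ s in Ioo α t, deriv η s * ∫ x, v s x * heatFun (t - s) ψ x := by
  have : γ.HolderConjugate (ENNReal.conjExponent γ) := .conjExponent hγ.out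
  obtain ⟨g, hg, hgc, hgb⟩ := exists_gaussProfile_bound hη hηc hηs hψ hψc
  obtain ⟨A, hA⟩ := isCompact_Icc.exists_bound_of_continuousOn hv
  have hgL : MemLp g (ENNReal.conjExponent γ) volume := hg.memLp_of_hasCompactSupport hgc
  set G := (eLpNorm g (ENNReal.conjExponent γ) volume).toReal with hG
  have hcont : ∀ s, Continuous fun r : EuclideanSpace ℝ (Fin n) × EuclideanSpace ℝ (Fin n) =>
      gaussProfile η ψ t s r.1 (r.2 + √(t - s) • r.1) := by
    intro s
    have hp : Continuous fun r : EuclideanSpace ℝ (Fin n) × EuclideanSpace ℝ (Fin n) =>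
      r.2 + √(t - s) • r.1 := by fun_prop
    exact ((continuous_const.mul (hψ.continuous.comp hp)).add
      (continuous_const.mul ((continuous_laplacian hψ).comp hp))).sub
      (continuous_const.mul (continuous_const.mul
        (((hψ.continuous_fderiv (by simp)).comp hp).clm_apply continuous_fst)))
  have hKint : ∀ s y, Integrable
      (fun x => v s x * gaussProfile η ψ t s y (x + √(t - s) • y)) ∧
      ∫ x, ‖v s x * gaussProfile η ψ t s y (x + √(t - s) • y)‖ ≤ (1 + ‖y‖) * (‖v s‖ * G) := by
    intro s y
    have h1 := integrable_coe_mul _ (v s) (memLp_translate hgL (√(t - s) • y))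
    have h2 := integral_norm_mul_le _ (v s) (memLp_translate hgL (√(t - s) • y))
    rw [eLpNorm_translate hgL] at h2
    have h3 : ∀ x, ‖v s x * gaussProfile η ψ t s y (x + √(t - s) • y)‖ ≤
        (1 + ‖y‖) * ‖v s x * g (x + √(t - s) • y)‖ := by
      intro x
      rw [norm_mul, norm_mul]
      have h4 := (hgb s y (x + √(t - s) • y)).trans
        (mul_le_mul_of_nonneg_left (le_abs_self _) (by positivity))
      calc _ ≤ ‖v s x‖ * ((1 + ‖y‖) * |g (x + √(t - s) • y)|) :=
            mul_le_mul_of_nonneg_left h4 (norm_nonneg _)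
        _ = _ := by rw [Real.norm_eq_abs (g _)]; ring
    have h5 : Integrable fun x => v s x * gaussProfile η ψ t s y (x + √(t - s) • y) := by
      refine Integrable.mono' (h1.norm.const_mul (1 + ‖y‖)) ?_ (Eventually.of_forall h3)
      exact (Lp.aestronglyMeasurable _).mul
        ((hcont s).comp (continuous_const.prodMk continuous_id)).aestronglyMeasurable
    refine ⟨h5, (integral_mono h5.norm (h1.norm.const_mul (1 + ‖y‖)) h3).trans ?_⟩
    rw [integral_const_mul]
    exact mul_le_mul_of_nonneg_left h2 (by positivity)
  have hω : ∀ c, Integrable (fun y : EuclideanSpace ℝ (Fin n) => (1 + ‖y‖) * c)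
      (gaussMeasure n) := fun c => ((integrable_const 1).add integrable_norm_gauss).mul_const c
  have hQ : Integrable (Function.uncurry fun (y : EuclideanSpace ℝ (Fin n)) (s : ℝ) =>
      ∫ x, v s x * gaussProfile η ψ t s y (x + √(t - s) • y))
      ((gaussMeasure n).prod (volume.restrict (Ioo α t))) := by
    refine Integrable.mono' ((hω (A * G)).comp_fst _)
      (aestronglyMeasurable_gaussProfile (γ' := ENNReal.conjExponent γ) hη hψ hψc hv) ?_
    filter_upwards [Measure.quasiMeasurePreserving_snd.ae (ae_restrict_mem measurableSet_Ioo)]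
      with r hr
    refine ((norm_integral_le_integral_norm _).trans (hKint r.2 r.1).2).trans ?_
    have := hA r.2 (Ioo_subset_Icc_self hr)
    have hG0 : 0 ≤ G := ENNReal.toReal_nonneg
    gcongr
  rw [integral_integral_swap hQ]
  refine setIntegral_congr_fun measurableSet_Ioo fun s hs => ?_
  rw [integral_integral_swap (integrable_gauss_prod ?_ (fun y => (hKint s y).1) (hω (‖v s‖ * G))
    fun y => (hKint s y).2), ← integral_const_mul]
  · congr 1; ext x
    rw [integral_const_mul, integral_gaussProfile hψ hψc hs.2]
    ring
  · exact AEStronglyMeasurable.mul (Lp.aestronglyMeasurable (v s)).comp_snd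
      (hcont s).aestronglyMeasurable

/-- Averaging the potential part over the Gaussian directions. -/
lemma integral_integral_potential_gauss (hσ' : σ ≠ ∞)
    (ha : AEStronglyMeasurable a (volume.restrict (Ioo 0 T)))
    (haL : ∀ᵐ s ∂(volume.restrict (Ioo 0 T)), ‖a s‖ ≤ L)
    (hv : ContinuousOn v (Icc 0 T)) (hA0 : 0 ≤ A)
    (hA : ∀ s ∈ Icc α t, ‖v s‖ ≤ A ∧ eLpNorm (v s) ∞ volume ≤ ENNReal.ofReal A)
    (hα : 0 < α) (htT : t < T) (hη : ContDiff ℝ (⊤ : ℕ∞) η)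
    (hηc : HasCompactSupport η) (hψ : ContDiff ℝ (⊤ : ℕ∞) ψ) (hψc : HasCompactSupport ψ) :
    ∫ y, (∫ s in Ioo α t, η s * ∫ x, a s x * (v s x * ψ (x + √(t - s) • y))) ∂gaussMeasure n =
      ∫ s in Ioo α t, η s * ∫ x, a s x * (v s x * heatFun (t - s) ψ x) := by
  have : γ.HolderConjugate (ENNReal.conjExponent γ) := .conjExponent hγ.out
  have hsub : Ioo α t ⊆ Ioo 0 T := Ioo_subset_Ioo hα.le htT.le
  have hψL := memLp_of_test hψ hψc (ENNReal.conjExponent γ)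
  have hψT := memLp_of_test hψ hψc ∞
  obtain ⟨B, hB0, hB1, hB2⟩ := exists_eLpNorm_bound hψ hψc (ENNReal.conjExponent γ)
  obtain ⟨E, hE⟩ := hηc.exists_bound_of_continuous hη.continuous
  have hE0 : 0 ≤ E := (norm_nonneg _).trans (hE 0)
  have haL' := ae_restrict_of_ae_restrict_of_subset hsub haL
  have hmeas : ∀ s y, AEStronglyMeasurable (fun x => v s x * ψ (x + √(t - s) • y)) volume :=
    fun s y => (Lp.aestronglyMeasurable _).mul (memLp_translate hψL _).1
  have hbd : ∀ s ∈ Ioo α t, ∀ y, ∫⁻ x, ‖a s x * (v s x * ψ (x + √(t - s) • y))‖ₑ ≤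
      ENNReal.ofReal (‖a s‖ * (A * B)) := by
    intro s hs y
    have h1 := hA s (Ioo_subset_Icc_self hs)
    exact lintegral_potential_le_of_bounded hσ' (ENNReal.conjExponent γ) (a s) (v s)
      (memLp_translate hψL _).1 hA0 hB0 h1.1 h1.2 ((eLpNorm_translate hψL _).le.trans hB1)
      ((eLpNorm_translate hψT _).le.trans hB2)
  have hint : ∀ s ∈ Ioo α t, ∀ y, Integrable fun x => a s x * (v s x * ψ (x + √(t - s) • y)) :=
    fun s hs y => ⟨(Lp.aestronglyMeasurable _).mul (hmeas s y),
      (hbd s hs y).trans_lt ENNReal.ofReal_lt_top⟩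
  have hae : ∀ {P : ℝ → Prop}, (∀ᵐ s ∂(volume.restrict (Ioo α t)), P s) →
      ∀ᵐ r ∂((gaussMeasure n).prod (volume.restrict (Ioo α t))), P r.2 := fun h =>
    Measure.quasiMeasurePreserving_snd.ae h
  have hQ : Integrable (Function.uncurry fun (y : EuclideanSpace ℝ (Fin n)) (s : ℝ) =>
      η s * ∫ x, a s x * (v s x * ψ (x + √(t - s) • y)))
      ((gaussMeasure n).prod (volume.restrict (Ioo α t))) := by
    refine Integrable.mono' (integrable_const (E * (L * (A * B)))) ?_ ?_
    · have hη2 : Continuous fun r : EuclideanSpace ℝ (Fin n) × ℝ => η r.2 :=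
        hη.continuous.comp continuous_snd
      refine hη2.aestronglyMeasurable.mul ?_
      refine aestronglyMeasurable_of_tendsto_ae atTop
        (f := fun k (r : EuclideanSpace ℝ (Fin n) × ℝ) =>
          ∫ x, truncLp k (a r.2) x * (v r.2 x * ψ (x + √(t - r.2) • r.1))) (fun k => ?_) ?_
      · simp only [← integral_mulTrunc_mul]
        have hcm : Continuous fun r : EuclideanSpace ℝ (Fin n) × ℝ => √(t - r.2) • r.1 := by
          fun_prop
        exact (continuous_integral_mul_translate hψL).comp_aestronglyMeasurable
          (hcm.aestronglyMeasurable.prodMk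
            ((aestronglyMeasurable_mulTrunc ha k hv).mono_set hsub).comp_snd)
      · filter_upwards [hae (ae_restrict_mem measurableSet_Ioo)] with r hr
        exact tendsto_integral_truncLp_mul (a r.2) (hmeas r.2 r.1) (hint r.2 hr r.1)
    · filter_upwards [hae (ae_restrict_mem measurableSet_Ioo), hae haL'] with r hr h1
      have h2 := abs_integral_le_of_lintegral_enorm_le (by positivity) (hbd r.2 hr r.1)
      rw [Function.uncurry, norm_mul]
      refine mul_le_mul (hE _) (h2.trans ?_) (norm_nonneg _) hE0
      gcongr
  rw [integral_integral_swap hQ]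
  refine setIntegral_congr_fun measurableSet_Ioo fun s hs => ?_
  rw [integral_const_mul, integral_integral_swap (integrable_gauss_prod ?_ (hint s hs)
    (integrable_const (‖a s‖ * (A * B))) fun y => ?_)]
  · congr 2; ext x
    rw [integral_const_mul, integral_const_mul]
    rfl
  · have h1 : Continuous fun r : EuclideanSpace ℝ (Fin n) × EuclideanSpace ℝ (Fin n) =>
        ψ (r.2 + √(t - s) • r.1) := hψ.continuous.comp (by fun_prop)
    exact AEStronglyMeasurable.mul (Lp.aestronglyMeasurable (a s)).comp_snd
      (AEStronglyMeasurable.mul (Lp.aestronglyMeasurable (v s)).comp_snd h1.aestronglyMeasurable)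
  · rw [integral_norm_eq_lintegral_enorm (hint s hs y).1]
    exact ENNReal.toReal_le_of_le_ofReal (by positivity) (hbd s hs y)

/-- Every solution satisfies the Duhamel formula on intervals inside `(0,T)`. -/
lemma IsHeatPotentialSolution.duhamel (hσ' : σ ≠ ∞)
    (ha : AEStronglyMeasurable a (volume.restrict (Ioo 0 T)))
    (haL : ∀ᵐ s ∂(volume.restrict (Ioo 0 T)), ‖a s‖ ≤ L) (hL : 0 ≤ L)
    (hv : IsHeatPotentialSolution T a u₀ v) (hα : 0 < α) (hαt : α < t) (htT : t < T)
    (hψ : ContDiff ℝ (⊤ : ℕ∞) ψ) (hψc : HasCompactSupport ψ) :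
    ∫ x, v t x * ψ x = (∫ x, v α x * heatFun (t - α) ψ x) -
      ∫ s in Ioo α t, ∫ x, a s x * (v s x * heatFun (t - s) ψ x) := by
  have : γ.HolderConjugate (ENNReal.conjExponent γ) := .conjExponent hγ.out
  have hψm := hψ.continuous.measurable
  have hψL := memLp_of_test hψ hψc (ENNReal.conjExponent γ)
  obtain ⟨A, hA0, hA⟩ := hv.exists_bound hα hαt htT
  have hvc : ContinuousOn v (Icc α t) := hv.continuousOn.mono (Icc_subset_Icc hα.le htT.le)
  have hF : ∀ s, ∫ x, v s x * heatFun (t - s) ψ x = pairCLM hψL (heatLp (t - s) (v s)) :=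
    fun s => by rw [pairCLM_apply, integral_heatLp_mul _ _ _ hψm hψL]
  have hFc : ContinuousOn (fun s => ∫ x, v s x * heatFun (t - s) ψ x) (Icc α t) := by
    simp only [hF]
    have h1 : ContinuousOn (fun s => (t - s, v s)) (Icc α t) :=
      (by fun_prop : Continuous fun s : ℝ => t - s).continuousOn.prodMk hvc
    have h2 := ((pairCLM hψL).continuous.comp
      (continuous_heatLp (n := n) (p := γ))).comp_continuousOn h1
    refine h2.congr fun s _ => ?_
    simp only [Function.comp_apply]
  have key := integral_eq_sub_of_weak_deriv hαt hFc
    (integrableOn_potential_heatFun hσ' ha haL hv.continuousOn hA0 hA hα htT hψ hψc)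
    fun η hη hηc hηs => by
      rw [← integral_integral_gaussProfile hvc hη hηc hηs hψ hψc,
        ← integral_integral_potential_gauss hσ' ha haL hv.continuousOn hA0 hA hα htT hη hηc hψ hψc]
      congr 1; ext y
      exact hv.integral_gaussTest hσ' ha haL hL hα hαt htT hη hηc hηs hψ hψc y
  have h0 : ∫ x, v t x * heatFun (t - t) ψ x = ∫ x, v t x * ψ x := by
    rw [hF, sub_self, heatLp_of_nonpos le_rfl, pairCLM_apply]
  rw [h0] at key
  linarith

end Average

section Uniqueness

open Filter Topology

variable {n : ℕ} {σ γ : ℝ≥0∞} [hσ : Fact (1 ≤ σ)] [hγ : Fact (1 ≤ γ)] [hγ' : Fact (γ ≠ ∞)]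
  {T L l : ℝ} {a : ℝ → LpE n σ} {u₀ : LpE n γ} {v₁ v₂ : ℝ → LpE n γ}

lemma integrable_potential_heatFun (hσ' : σ ≠ ∞) (b : LpE n σ) {z : LpE n γ} {A : ℝ} (hA : 0 ≤ A)
    (hz : ‖z‖ ≤ A ∧ eLpNorm z ∞ volume ≤ ENNReal.ofReal A) (τ : ℝ)
    {ψ : EuclideanSpace ℝ (Fin n) → ℝ} (hψ : ContDiff ℝ (⊤ : ℕ∞) ψ) (hψc : HasCompactSupport ψ) :
    Integrable fun x => b x * (z x * heatFun τ ψ x) := by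
  have : γ.HolderConjugate (ENNReal.conjExponent γ) := .conjExponent hγ.out
  have h1γ' : 1 ≤ ENNReal.conjExponent γ := (ENNReal.HolderConjugate.symm (p := γ)).one_le
  have hψm := hψ.continuous.measurable
  obtain ⟨B, hB0, hB1, hB2⟩ := exists_eLpNorm_bound hψ hψc (ENNReal.conjExponent γ)
  have hm := (measurable_heatFun τ hψm).aestronglyMeasurable (μ := volume)
  exact ⟨(Lp.aestronglyMeasurable _).mul ((Lp.aestronglyMeasurable _).mul hm),
    (lintegral_potential_le_of_bounded hσ' (ENNReal.conjExponent γ) b z hm hA hB0 hz.1 hz.2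
      ((eLpNorm_heatFun_le _ hψm h1γ').trans hB1)
      ((eLpNorm_heatFun_le _ hψm le_top).trans hB2)).trans_lt ENNReal.ofReal_lt_top⟩

/-- A bounded function satisfies some heat bound. -/
lemma heatBound_of_bounded {A : ℝ} (hT : 0 < T) (hl : 0 ≤ l) (hA : 0 ≤ A) {u : ℝ → LpE n γ}
    (hu : ∀ s ∈ Ioc 0 T, ‖u s‖ ≤ A ∧ eLpNorm (u s) ∞ volume ≤ ENNReal.ofReal A) :
    HeatBound T (A * (1 + T ^ ((n : ℝ) / (2 * γ.toReal)))) l u := by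
  intro s hs
  have hs0 : 0 < s := hs.1
  set κ := (n : ℝ) / (2 * γ.toReal) with hκ
  have hκ0 : 0 ≤ κ := by positivity
  have hexp : 1 ≤ Real.exp (l * s) := Real.one_le_exp (by positivity)
  have hTκ : 0 < T ^ κ := by positivity
  refine ⟨(hu s hs).1.trans ?_, (hu s hs).2.trans (ENNReal.ofReal_le_ofReal ?_)⟩
  · rw [mul_assoc]
    exact le_mul_of_one_le_right hA (one_le_mul_of_one_le_of_one_le (by linarith) hexp)
  · have h1 : 1 ≤ (1 + T ^ κ) * s ^ (-κ) := by
      rw [Real.rpow_neg hs0.le, ← div_eq_mul_inv, one_le_div (by positivity)]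
      linarith [Real.rpow_le_rpow hs0.le hs.2 hκ0]
    calc A ≤ A * (((1 + T ^ κ) * s ^ (-κ)) * Real.exp (l * s)) :=
          le_mul_of_one_le_right hA (one_le_mul_of_one_le_of_one_le h1 hexp)
      _ = _ := by ring

/-- The difference of two solutions is controlled by its value at any positive time. -/
lemma norm_sub_le_of_solutions (hσ' : σ ≠ ∞) (hσn : (n : ℝ) / 2 < σ.toReal)
    (ha : AEStronglyMeasurable a (volume.restrict (Ioo 0 T)))
    (haL : ∀ᵐ s ∂(volume.restrict (Ioo 0 T)), ‖a s‖ ≤ L) (hL : 0 ≤ L)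
    (hl : 0 < l) (hcond : WeightCondition n σ γ L l)
    (h₁ : IsHeatPotentialSolution T a u₀ v₁) (h₂ : IsHeatPotentialSolution T a u₀ v₂) {α t : ℝ}
    (hα : 0 < α) (hαt : α < t) (htT : t < T) :
    ‖v₁ t - v₂ t‖ ≤ 2 * (2 ^ ((n : ℝ) / (2 * γ.toReal)) * ‖v₁ α - v₂ α‖) * Real.exp (l * T) := by
  have hσ0 : 0 < σ.toReal := lt_of_le_of_lt (by positivity) hσn
  have hθ0 : 0 ≤ (n : ℝ) / (2 * σ.toReal) := by positivity
  have hθ1 : (n : ℝ) / (2 * σ.toReal) < 1 := by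
    rw [div_lt_one (by positivity)]; linarith
  have hΓ : 0 < Real.Gamma (1 - (n : ℝ) / (2 * σ.toReal)) :=
    Real.Gamma_pos_of_pos (by linarith)
  obtain ⟨A₁, hA₁0, hA₁⟩ := h₁.exists_bound hα hαt htT
  obtain ⟨A₂, hA₂0, hA₂⟩ := h₂.exists_bound hα hαt htT
  have hT' : 0 < t - α := sub_pos.2 hαt
  set w : ℝ → LpE n γ := fun s => v₁ (α + s) - v₂ (α + s) with hw
  have hmem : ∀ s ∈ Ioc 0 (t - α), α + s ∈ Icc α t := fun s hs =>
    ⟨by linarith [hs.1], by linarith [hs.2]⟩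
  have hw0 : HeatBound (t - α) ((A₁ + A₂) * (1 + (t - α) ^ ((n : ℝ) / (2 * γ.toReal)))) l w := by
    refine heatBound_of_bounded hT' hl.le (by positivity) fun s hs => ?_
    have e1 := hA₁ _ (hmem s hs)
    have e2 := hA₂ _ (hmem s hs)
    refine ⟨(norm_sub_le _ _).trans (add_le_add e1.1 e2.1), ?_⟩
    simp only [hw]
    rw [eLpNorm_congr_ae (Lp.coeFn_sub _ _), ENNReal.ofReal_add hA₁0 hA₂0]
    exact (eLpNorm_sub_le (Lp.aestronglyMeasurable _) (Lp.aestronglyMeasurable _) le_top).trans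
      (add_le_add e1.2 e2.2)
  have hshift : ∀ᵐ s ∂(volume.restrict (Ioo 0 (t - α))), ‖a (α + s)‖ ≤ L := by
    rw [ae_restrict_iff' measurableSet_Ioo] at haL ⊢
    filter_upwards [(measurePreserving_add_left volume α).quasiMeasurePreserving.ae haL] with s hs h
    exact hs ⟨by linarith [h.1], by linarith [h.2]⟩
  have key : HeatBound (t - α) (2 * (2 ^ ((n : ℝ) / (2 * γ.toReal)) * ‖v₁ α - v₂ α‖)) l w := by
    refine HeatBound.of_improvement (by positivity) (by positivity) hw0 fun M hM hwM => ?_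
    have step := heatBound_of_duhamel hσ' hγ'.out hl.le (f := v₁ α - v₂ α)
      (b₁ := fun s => a (α + s)) (b₂ := fun _ => 0) (u₁ := w) (u₂ := fun _ => 0) (v := w)
      (h₁ := fun _ => L) (h₂ := fun _ => 0) (M₁ := M) (M₂ := 0)
      (K₁ := 3 * L * (Real.Gamma (1 - (n : ℝ) / (2 * σ.toReal)) *
        (1 / l) ^ (1 - (n : ℝ) / (2 * σ.toReal)))) (K₂ := 0) hM le_rfl
      (by positivity) le_rfl hwM (heatBound_zero le_rfl) hshift
      (Eventually.of_forall fun s => by simp) (kernelBound_const hθ0 hθ1 hl hL)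
      (kernelBound_zero _ _ _) (fun τ hτ ψ hψ hψc => ?_)
    · refine step.mono ?_
      rw [WeightCondition] at hcond
      have h4 := mul_le_mul_of_nonneg_right hcond hM
      linarith
    · have : γ.HolderConjugate (ENNReal.conjExponent γ) := .conjExponent hγ.out
      have hψm := hψ.continuous.measurable
      have hψL := memLp_of_test hψ hψc (ENNReal.conjExponent γ)
      have hατ : α < α + τ := by linarith [hτ.1]
      have hτt : α + τ ≤ t := by linarith [hτ.2]
      have hτT : α + τ < T := hτt.trans_lt htT
      have hsub : Icc α (α + τ) ⊆ Icc α t := Icc_subset_Icc_right hτt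
      have d1 := h₁.duhamel hσ' ha haL hL hα hατ hτT hψ hψc
      have d2 := h₂.duhamel hσ' ha haL hL hα hατ hτT hψ hψc
      have i1 := integrableOn_potential_heatFun hσ' ha haL h₁.continuousOn hA₁0
        (fun s hs => hA₁ s (hsub hs)) hα hτT hψ hψc
      have i2 := integrableOn_potential_heatFun hσ' ha haL h₂.continuousOn hA₂0
        (fun s hs => hA₂ s (hsub hs)) hα hτT hψ hψc
      set G : ℝ → ℝ := fun s => (∫ x, a s x * (v₁ s x * heatFun (α + τ - s) ψ x)) -
        ∫ x, a s x * (v₂ s x * heatFun (α + τ - s) ψ x) with hG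
      have hGint : ∫ s in Ioo α (α + τ), G s = ∫ s in Ioo 0 τ, G (α + s) := by
        rw [← integral_Ioc_eq_integral_Ioo, ← integral_Ioc_eq_integral_Ioo,
          ← intervalIntegral.integral_of_le hατ.le, ← intervalIntegral.integral_of_le hτ.1.le,
          intervalIntegral.integral_comp_add_left, add_zero]
      refine ⟨fun s => G (α + s), ?_, ?_⟩
      · rw [← hGint, hG, integral_sub i1 i2]
        have hL1 := memLp_heatFun τ (ENNReal.HolderConjugate.symm (p := γ)).one_le hψm hψL
        rw [add_sub_cancel_left] at d1 d2
        have e1 : ∫ x, w τ x * ψ x = (∫ x, v₁ (α + τ) x * ψ x) - ∫ x, v₂ (α + τ) x * ψ x := by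
          rw [← pairCLM_apply hψL, ← pairCLM_apply hψL, ← pairCLM_apply hψL, ← map_sub]
        have e2 : ∫ x, (v₁ α - v₂ α : LpE n γ) x * heatFun τ ψ x =
            (∫ x, v₁ α x * heatFun τ ψ x) - ∫ x, v₂ α x * heatFun τ ψ x := by
          rw [← pairCLM_apply hL1, ← pairCLM_apply hL1, ← pairCLM_apply hL1, ← map_sub]
        rw [e1, e2, d1, d2, sub_sub_sub_comm]
        exact abs_sub _ _
      · filter_upwards [ae_restrict_mem measurableSet_Ioo] with s hs
        have hs' : α + s ∈ Icc α t := ⟨by linarith [hs.1], by linarith [hs.2]⟩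
        refine le_add_of_le_of_nonneg (le_of_eq ?_) (abs_nonneg _)
        simp only [hG]
        rw [← integral_sub (integrable_potential_heatFun hσ' _ hA₁0 (hA₁ _ hs') _ hψ hψc)
          (integrable_potential_heatFun hσ' _ hA₂0 (hA₂ _ hs') _ hψ hψc),
          add_sub_add_left_eq_sub]
        congr 1
        refine integral_congr_ae ?_
        filter_upwards [Lp.coeFn_sub (v₁ (α + s)) (v₂ (α + s))] with x hx
        simp only [hw]
        rw [hx, Pi.sub_apply]
        ring
  have h := (key (t - α) ⟨hT', le_rfl⟩).1
  simp only [hw, add_sub_cancel] at h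
  refine h.trans (mul_le_mul_of_nonneg_left ?_ (by positivity))
  exact Real.exp_le_exp.2 (mul_le_mul_of_nonneg_left (by linarith) hl.le)

lemma IsHeatPotentialSolution.eqOn (hσ' : σ ≠ ∞) (hσn : (n : ℝ) / 2 < σ.toReal) (hT : 0 < T)
    (ha : AEStronglyMeasurable a (volume.restrict (Ioo 0 T)))
    (haL : ∀ᵐ s ∂(volume.restrict (Ioo 0 T)), ‖a s‖ ≤ L) (hL : 0 ≤ L)
    (hl : 0 < l) (hcond : WeightCondition n σ γ L l)
    (h₁ : IsHeatPotentialSolution T a u₀ v₁) (h₂ : IsHeatPotentialSolution T a u₀ v₂) :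
    EqOn v₁ v₂ (Icc 0 T) := by
  have hIoo : EqOn v₁ v₂ (Ioo 0 T) := by
    intro t ht
    have h0 : (0 : ℝ) ∈ Icc 0 T := left_mem_Icc.2 hT.le
    have hlim : Tendsto (fun α => ‖v₁ α - v₂ α‖) (𝓝[>] 0) (𝓝 0) := by
      have h := ((h₁.continuousOn.sub h₂.continuousOn).norm 0 h0).tendsto
      rw [Pi.sub_apply, h₁.initial, h₂.initial, sub_self, norm_zero] at h
      have hle : 𝓝[>] (0 : ℝ) ≤ 𝓝[Icc 0 T] 0 := by
        rw [← nhdsWithin_Ioo_eq_nhdsGT hT]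
        exact nhdsWithin_mono _ Ioo_subset_Icc_self
      exact h.mono_left hle
    have hlim2 := ((hlim.const_mul (2 ^ ((n : ℝ) / (2 * γ.toReal)))).const_mul 2).mul_const
      (Real.exp (l * T))
    have hle : ‖v₁ t - v₂ t‖ ≤ 0 := by
      refine ge_of_tendsto (by simpa using hlim2) ?_
      filter_upwards [Ioo_mem_nhdsGT ht.1] with α hα
      exact norm_sub_le_of_solutions hσ' hσn ha haL hL hl hcond h₁ h₂ hα.1 hα.2 ht.2
    exact sub_eq_zero.1 (norm_le_zero_iff.1 hle)
  refine hIoo.of_subset_closure h₁.continuousOn h₂.continuousOn Ioo_subset_Icc_self ?_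
  rw [closure_Ioo hT.ne]

end Uniqueness

section Weight

lemma weightCondition_rpow {n : ℕ} {σ γ : ℝ≥0∞} (hσn : (n : ℝ) / 2 < σ.toReal) {L L' : ℝ}
    (hL : 0 ≤ L) (hL' : L < L') :
    WeightCondition n σ γ L ((6 * 2 ^ ((n : ℝ) / (2 * γ.toReal)) *
      Real.Gamma (1 - (n : ℝ) / (2 * σ.toReal)) * L') ^
        (2 * σ.toReal / (2 * σ.toReal - n))) := by
  have hσ0 : 0 < σ.toReal := lt_of_le_of_lt (by positivity) hσn
  have hθ1 : (n : ℝ) / (2 * σ.toReal) < 1 := by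
    rw [div_lt_one (by positivity)]; linarith
  have hΓ : 0 < Real.Gamma (1 - (n : ℝ) / (2 * σ.toReal)) :=
    Real.Gamma_pos_of_pos (by linarith)
  have hpow : 2 * σ.toReal / (2 * σ.toReal - n) * (1 - (n : ℝ) / (2 * σ.toReal)) = 1 := by
    have : 2 * σ.toReal - n ≠ 0 := by linarith
    field_simp
  have hL'0 : 0 < L' := hL.trans_lt hL'
  rw [WeightCondition, one_div, Real.inv_rpow (by positivity), ← Real.rpow_mul (by positivity),
    hpow, Real.rpow_one]
  have e : (2 : ℝ) ^ ((n : ℝ) / (2 * γ.toReal)) * (3 * L *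
      (Real.Gamma (1 - (n : ℝ) / (2 * σ.toReal)) * (6 * 2 ^ ((n : ℝ) / (2 * γ.toReal)) *
      Real.Gamma (1 - (n : ℝ) / (2 * σ.toReal)) * L')⁻¹)) = L / L' / 2 := by
    have : (2 : ℝ) ^ ((n : ℝ) / (2 * γ.toReal)) ≠ 0 := by positivity
    generalize Real.Gamma (1 - (n : ℝ) / (2 * σ.toReal)) = g at *
    generalize (2 : ℝ) ^ ((n : ℝ) / (2 * γ.toReal)) = h at *
    field_simp
    ring
  rw [e]
  have := (div_le_one hL'0).2 hL'.le
  linarith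

end Weight

theorem lemma2p3 (n : ℕ) (hn : 1 ≤ n) (σ γ : ℝ≥0∞) [Fact (1 ≤ σ)] [Fact (1 ≤ γ)]
    (hσ : σ ≠ ∞) (hσn : (n : ℝ) / 2 < σ.toReal) (hγ : γ ≠ ∞) :
    ∃ C : ℝ, 0 < C ∧
      ∀ (T : ℝ), 0 < T →
      ∀ (a : ℝ → Lp ℝ σ (volume : Measure (EuclideanSpace ℝ (Fin n)))),
        MemLp a ∞ (volume.restrict (Ioo 0 T)) →
      ∀ (u₀ : Lp ℝ γ (volume : Measure (EuclideanSpace ℝ (Fin n)))),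
      ∃ u : ℝ → Lp ℝ γ (volume : Measure (EuclideanSpace ℝ (Fin n))),
        IsHeatPotentialSolution T a u₀ u ∧
        (∀ v : ℝ → Lp ℝ γ (volume : Measure (EuclideanSpace ℝ (Fin n))),
          IsHeatPotentialSolution T a u₀ v → EqOn v u (Icc 0 T)) ∧
        ∀ t ∈ Ioc 0 T,
          eLpNorm (u t) ∞ volume ≤
            ENNReal.ofReal
              (C * Real.exp
                  (C * (eLpNorm a ∞ (volume.restrict (Ioo 0 T))).toReal ^
                      (2 * σ.toReal / (2 * σ.toReal - n)) * t) *
                t ^ (-(n : ℝ) / (2 * γ.toReal)) * ‖u₀‖) := by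
  have hγ' : Fact (γ ≠ ∞) := ⟨hγ⟩
  have hσ0 : 0 < σ.toReal := lt_of_le_of_lt (by positivity) hσn
  have hθ1 : (n : ℝ) / (2 * σ.toReal) < 1 := by
    rw [div_lt_one (by positivity)]; linarith
  have hΓ : 0 < Real.Gamma (1 - (n : ℝ) / (2 * σ.toReal)) :=
    Real.Gamma_pos_of_pos (by linarith)
  set κ := (n : ℝ) / (2 * γ.toReal) with hκ
  set c := 6 * 2 ^ κ * Real.Gamma (1 - (n : ℝ) / (2 * σ.toReal)) with hc
  have hc0 : 0 < c := by positivity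
  set ϑ := 2 * σ.toReal / (2 * σ.toReal - n) with hϑ
  have hϑ0 : 0 ≤ ϑ := div_nonneg (by positivity) (by linarith)
  refine ⟨max (2 * 2 ^ κ) (c ^ ϑ), lt_max_of_lt_left (by positivity), fun T hT a ha u₀ => ?_⟩
  set L := (eLpNorm a ∞ (volume.restrict (Ioo 0 T))).toReal with hL
  have hL0 : 0 ≤ L := ENNReal.toReal_nonneg
  have haL : ∀ᵐ s ∂(volume.restrict (Ioo 0 T)), ‖a s‖ ≤ L := by
    have h := enorm_ae_le_eLpNormEssSup a (volume.restrict (Ioo 0 T))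
    filter_upwards [h] with s hs
    rw [← eLpNorm_exponent_top] at hs
    have := ENNReal.toReal_mono ha.2.ne hs
    rwa [toReal_enorm] at this
  have hw : ∀ L', L < L' → 0 < (c * L') ^ ϑ ∧ WeightCondition n σ γ L ((c * L') ^ ϑ) :=
    fun L' hL' => ⟨Real.rpow_pos_of_pos (mul_pos hc0 (hL0.trans_lt hL')) _,
      weightCondition_rpow hσn hL0 hL'⟩
  obtain ⟨hl, hcond⟩ := hw (L + 1) (by linarith)
  obtain ⟨u, hu, hub⟩ := exists_solution hσ hσn hT hL0 ha.1 haL u₀ hl hcond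
  refine ⟨u, hu, fun v hv => hv.eqOn hσ hσn hT ha.1 haL hL0 hl hcond hu, fun t ht => ?_⟩
  have ht0 : 0 < t := ht.1
  have hbound : eLpNorm (u t) ∞ volume ≤ ENNReal.ofReal
      (2 * (2 ^ κ * ‖u₀‖) * Real.exp ((c * L) ^ ϑ * t) * t ^ (-κ)) := by
    have hcont : Continuous fun L' : ℝ =>
        2 * (2 ^ κ * ‖u₀‖) * Real.exp ((c * L') ^ ϑ * t) * t ^ (-κ) := by
      have := (Real.continuous_rpow_const hϑ0).comp (continuous_const_mul c)
      exact (continuous_const.mul (Real.continuous_exp.comp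
        (this.mul continuous_const))).mul continuous_const
    refine ge_of_tendsto (ENNReal.tendsto_ofReal
      ((hcont.tendsto L).mono_left (nhdsWithin_le_nhds (s := Ioi L)))) ?_
    filter_upwards [self_mem_nhdsWithin] with L' hL'
    exact (hub _ (hw L' hL').1 (hw L' hL').2 t ht).2
  refine hbound.trans (ENNReal.ofReal_le_ofReal ?_)
  rw [neg_div, Real.mul_rpow hc0.le hL0]
  set C := max (2 * 2 ^ κ) (c ^ ϑ) with hC
  have hC1 : 2 * 2 ^ κ ≤ C := le_max_left _ _
  have hC2 : c ^ ϑ ≤ C := le_max_right _ _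
  have hLϑ : 0 ≤ L ^ ϑ := by positivity
  calc 2 * (2 ^ κ * ‖u₀‖) * Real.exp (c ^ ϑ * L ^ ϑ * t) * t ^ (-κ)
      = 2 * 2 ^ κ * Real.exp (c ^ ϑ * L ^ ϑ * t) * t ^ (-κ) * ‖u₀‖ := by ring
    _ ≤ C * Real.exp (C * L ^ ϑ * t) * t ^ (-κ) * ‖u₀‖ := by gcongr
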